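/- \textbf{Proposition (Stability).} Let $p>0$. Put \[ \rho=\begin{cases}\infty&p>2\\ \frac{4}{4-p}&p\le 2\end{cases},\quad q=\begin{cases}\frac{p^2+2p}{2}&p>2\\ 2p+4&p\le2\end{cases},\quad r=\begin{cases}p+2&p>2\\ \frac{4p+8}{p}&p\le2\end{cases},\quad \alpha=\begin{cases}\frac{p^2+2p}{2p+2}&p>2\\ \frac{2p+4}{p+1}&p\le2\end{cases},\quad \beta=\begin{cases}\frac{p+2}{p+1}&p>2\\ \frac{4p+8}{3p+8}&p\le2,\end{cases} \] and, for a time interval $I\subseteq\mathbb R$, $X(I)=L_t^qL_x^r(I\times\mathbb R^2)$ and $Y(I)=L_t^\alpha L_x^\beta(I\times\mathbb R^2)$. Call $a:\mathbb R^2\to\mathbb R$ \emph{admissible} if it is nonnegative and continuous, $a,\nabla a\in L^\infty(\mathbb R^2)$ and, if $p\le 2$, also $a,\nabla a\in L^1(\mathbb R^2)$ (with $\nabla a$ the weak gradient), $x\cdot\nabla a(x)\le0$ for almost every $x$, and the radial limits $\lim_{R\to\infty}a(R\theta)$, $\theta\in\mathbb S^1$, exist and depend continuously on $\theta$. Write $F(v)=a|v|^pv$.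 Solutions of $(i\partial_t+\Delta)v=G$ on $I\times\mathbb R^2$ with datum $v(t_0)$, $t_0\in I$, are understood in the sense of the Duhamel formula \[ v(t)=e^{i(t-t_0)\Delta}v(t_0)-i\int_{t_0}^te^{i(t-s)\Delta}G(s)\,ds\qquad\text{for a.e. } t\in I, \] as an identity of tempered distributions on $\mathbb R^2$ (tested against Schwartz functions, with absolutely convergent pairings). For all $L>0$ and $A\ge0$ there exist $\varepsilon_1>0$ and $C>0$, depending only on $p$, $L$ and $A$, such that the following holds for every admissible $a$ with $\|a\|_{L^\rho(\mathbb R^2)}\le A$. Let $I\subseteq\mathbb R$ be an interval, $t_0\in I$, $u_0\in H^1(\mathbb R^2)$, and let $\tilde u,e:I\times\mathbb R^2\to\mathbb C$ be measurable such that $\tilde u$ is a solution of \[ (i\partial_t+\Delta)\tilde u=F(\tilde u)+e \] on $I\times\mathbb{R}^2$ with datum $\tilde u_0=\tilde u(t_0)$ and $\|\tilde u\|_{X(I)}\le L$. Suppose that \[ \|u_0-\tilde u_0\|_{H^1(\mathbb R^2)}+\|e\|_{Y(I)}<\varepsilon \] for some $\varepsilon\le\varepsilon_1$. Then the global solution $u\in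 C(\mathbb R;H^1(\mathbb R^2))$ of $i\partial_tu+\Delta u=a|u|^pu$ with $u(t_0)=u_0$ satisfies \[ \|u-\tilde u\|_{X(I)}+\|F(u)-F(\tilde u)\|_{Y(I)}\le C\varepsilon . \] -/

import Mathlib

open MeasureTheory Filter Topology
open scoped ENNReal SchwartzMap FourierTransform ContDiff

namespace StabilityNLS

noncomputable section

/-- The plane `ℝ²` with its Euclidean norm. -/
abbrev Plane : Type := EuclideanSpace ℝ (Fin 2)

/-! ### Exponents -/

/-- The exponent `ρ = ρ(p)` of the weight. -/
def rhoExp (p : ℝ) : ℝ≥0∞ := if 2 < p then ⊤ else ENNReal.ofReal (4 / (4 - p))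

/-- The time exponent `q = q(p)` of `X`. -/
def qExp (p : ℝ) : ℝ := if 2 < p then (p ^ 2 + 2 * p) / 2 else 2 * p + 4

/-- The space exponent `r = r(p)` of `X`. -/
def rExp (p : ℝ) : ℝ := if 2 < p then p + 2 else (4 * p + 8) / p

/-- The time exponent `α = α(p)` of `Y`. -/
def alphaExp (p : ℝ) : ℝ :=
  if 2 < p then (p ^ 2 + 2 * p) / (2 * p + 2) else (2 * p + 4) / (p + 1)

/-- The space exponent `β = β(p)` of `Y`. -/
def betaExp (p : ℝ) : ℝ :=
  if 2 < p then (p + 2) / (p + 1) else (4 * p + 8) / (3 * p + 8)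

/-! ### Norms -/

/-- The space-time norm `‖v‖_{L_t^m L_x^k(I × ℝ²)} = ‖ ‖v(t, ·)‖_{L^k(ℝ²)} ‖_{L^m(I)}`. -/
def mixedNorm (m k : ℝ) (I : Set ℝ) (v : ℝ → Plane → ℂ) : ℝ≥0∞ :=
  eLpNorm (fun t => eLpNorm (v t) (ENNReal.ofReal k) volume) (ENNReal.ofReal m)
    (volume.restrict I)

/-- The norm of `X(I) = L_t^q L_x^r(I × ℝ²)`. -/
def normX (p : ℝ) (I : Set ℝ) (v : ℝ → Plane → ℂ) : ℝ≥0∞ := mixedNorm (qExp p) (rExp p) I v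

/-- The norm of `Y(I) = L_t^α L_x^β(I × ℝ²)`. -/
def normY (p : ℝ) (I : Set ℝ) (v : ℝ → Plane → ℂ) : ℝ≥0∞ :=
  mixedNorm (alphaExp p) (betaExp p) I v

open Classical in
/-- The norm of `H¹(ℝ²)`, i.e. `(‖f‖_{L²}² + ‖∇f‖_{L²}²)^{1/2}`, computed through the `L²` Fourier
transform, where `∇` has the symbol `2πiξ`; it is `⊤` when `f` is not in `H¹(ℝ²)`. -/
def normH1 (f : Plane → ℂ) : ℝ≥0∞ :=
  if h : MemLp f 2 volume then
    eLpNorm (fun ξ : Plane => √(1 + (2 * Real.pi * ‖ξ‖) ^ 2) • (𝓕 (h.toLp f) : Lp ℂ 2 volume) ξ)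
      2 volume
  else ⊤

/-! ### The weight and the nonlinearity -/

/-- `g` is the weak (distributional) gradient of the locally integrable function `a`. -/
def IsWeakGradient (a : Plane → ℝ) (g : Plane → Plane) : Prop :=
  ∀ φ : Plane → ℝ, ContDiff ℝ ∞ φ → HasCompactSupport φ →
    ∫ x, a x • gradient φ x = -∫ x, φ x • g x

/-- Admissible weights `a` for the power `p`. Since `a` and `∇a` are in `L^∞`, `a` has a Lipschitz
representative; `a` is this representative, so that its radial limits make sense. -/
structure Admissible (p : ℝ) (a : Plane → ℝ) : Prop where
  continuous : Continuous a
  nonneg : ∀ x, 0 ≤ a x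
  memLp_top : MemLp a ⊤ volume
  memLp_one : p ≤ 2 → MemLp a 1 volume
  exists_gradient : ∃ g : Plane → Plane, IsWeakGradient a g ∧ MemLp g ⊤ volume ∧
    (p ≤ 2 → MemLp g 1 volume) ∧ ∀ᵐ x, inner ℝ x (g x) ≤ 0
  exists_radial_limit : ∃ aInf : Metric.sphere (0 : Plane) 1 → ℝ, Continuous aInf ∧
    ∀ θ : Metric.sphere (0 : Plane) 1,
      Tendsto (fun R : ℝ => a (R • (θ : Plane))) atTop (𝓝 (aInf θ))

/-- The nonlinearity `F(v) = a |v|^p v`. -/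
def nonlin (p : ℝ) (a : Plane → ℝ) (v : ℝ → Plane → ℂ) : ℝ → Plane → ℂ :=
  fun t x => (a x : ℂ) * ((‖v t x‖ ^ p : ℝ) : ℂ) * v t x

/-! ### The Schrödinger equation -/

/-- The symbol of `e^{itΔ}`; in the normalization `∫ e^{-2πi x·ξ} f(x) dx` of the Fourier
transform, `-Δ` has the symbol `(2π|ξ|)²`. -/
def freeSymbol (t : ℝ) (ξ : Plane) : ℂ :=
  Complex.exp (((-(t * (2 * Real.pi * ‖ξ‖) ^ 2) : ℝ) : ℂ) * Complex.I)

theorem hasTemperateGrowth_freeSymbol (t : ℝ) : (freeSymbol t).HasTemperateGrowth := by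
  have h1 : Function.HasTemperateGrowth
      (fun θ : ℝ => Complex.exp ((θ : ℂ) * Complex.I)) := by
    have hd : ∀ n : ℕ, iteratedDeriv n (fun θ : ℝ => Complex.exp ((θ : ℂ) * Complex.I)) =
        fun θ : ℝ => Complex.I ^ n * Complex.exp ((θ : ℂ) * Complex.I) := by
      intro n
      induction n with
      | zero => simp
      | succ n ih =>
        rw [iteratedDeriv_succ, ih]
        funext θ
        have h0 : HasDerivAt (fun θ : ℝ => (θ : ℂ) * Complex.I) Complex.I θ := by
          simpa using (Complex.ofRealCLM.hasDerivAt (x := θ)).mul_const Complex.I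
        have := (h0.cexp.const_mul (Complex.I ^ n)).deriv
        rw [this]
        ring
    refine ⟨(Complex.ofRealCLM.contDiff.mul contDiff_const).cexp, fun n => ⟨0, 1, fun θ => ?_⟩⟩
    rw [norm_iteratedFDeriv_eq_norm_iteratedDeriv, hd]
    simp [Complex.norm_exp_ofReal_mul_I]
  have h2 : Function.HasTemperateGrowth
      (fun ξ : Plane => -(t * (2 * Real.pi * ‖ξ‖) ^ 2)) := by
    have : (fun ξ : Plane => -(t * (2 * Real.pi * ‖ξ‖) ^ 2)) =
        fun ξ : Plane => (-(t * (2 * Real.pi) ^ 2)) * ‖ξ‖ ^ 2 := by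
      funext ξ; ring
    rw [this]
    exact (Function.HasTemperateGrowth.const _).mul
      (Function.hasTemperateGrowth_norm_sq Plane)
  exact h1.comp h2

/-- The free propagator `e^{itΔ}` on Schwartz functions, the Fourier multiplier with the symbol
`freeSymbol t`. -/
def freeProp (t : ℝ) : 𝓢(Plane, ℂ) →L[ℂ] 𝓢(Plane, ℂ) :=
  SchwartzMap.fourierMultiplierCLM ℂ (freeSymbol t)

/-- `v` solves `(i∂ₜ + Δ) v = G` on `I × ℝ²` with datum `v(t₀)` at the time `t₀ ∈ I`, in the sense
of the Duhamel formula
`v(t) = e^{i(t-t₀)Δ} v(t₀) - i ∫_{t₀}^t e^{i(t-s)Δ} G(s) ds` for almost all `t ∈ I`,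
an identity between tempered distributions on `ℝ²`: it is tested against all Schwartz functions
`ψ`, the propagator being moved to `ψ` by `⟨e^{iτΔ} f, ψ⟩ = ⟨f, e^{iτΔ} ψ⟩` for the bilinear
pairing `⟨f, ψ⟩ = ∫ f ψ dx`. All integrals are required to converge absolutely. -/
def IsDuhamelSolution (I : Set ℝ) (t₀ : ℝ) (v G : ℝ → Plane → ℂ) : Prop :=
  ∀ᵐ t ∂(volume.restrict I), ∀ ψ : 𝓢(Plane, ℂ),
    Integrable (fun x => v t x * ψ x) ∧
    Integrable (fun x => v t₀ x * freeProp (t - t₀) ψ x) ∧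
    IntegrableOn (fun z : ℝ × Plane => G z.1 z.2 * freeProp (t - z.1) ψ z.2)
      (Set.uIoc t₀ t ×ˢ Set.univ) ∧
    (∫ x, v t x * ψ x) =
      (∫ x, v t₀ x * freeProp (t - t₀) ψ x) -
        Complex.I * ∫ s in t₀..t, ∫ x, G s x * freeProp (t - s) ψ x

/-- `u ∈ C(ℝ; H¹(ℝ²))` is a global solution of `i∂ₜu + Δu = a|u|^p u` with `u(t₀) = u₀`. -/
structure IsGlobalSolution (p : ℝ) (a : Plane → ℝ) (t₀ : ℝ) (u₀ : Plane → ℂ)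
    (u : ℝ → Plane → ℂ) : Prop where
  measurable : AEStronglyMeasurable (fun z : ℝ × Plane => u z.1 z.2)
  mem_H1 : ∀ t, normH1 (u t) < ⊤
  continuous_H1 : ∀ t, Tendsto (fun s => normH1 (fun x => u s x - u t x)) (𝓝 t) (𝓝 0)
  initial : u t₀ =ᵐ[volume] u₀
  duhamel : IsDuhamelSolution Set.univ t₀ u (nonlin p a u)

/-- `v` is an approximate solution on `I × ℝ²` with error `e`: a solution of
`(i∂ₜ + Δ) v = F(v) + e`, with datum `v(t₀)` at the time `t₀`. -/
structure IsApproxSolution (p : ℝ) (a : Plane → ℝ) (I : Set ℝ) (t₀ : ℝ)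
    (v e : ℝ → Plane → ℂ) : Prop where
  measurable : AEStronglyMeasurable (fun z : ℝ × Plane => v z.1 z.2)
    ((volume.restrict I).prod volume)
  measurable_error : AEStronglyMeasurable (fun z : ℝ × Plane => e z.1 z.2)
    ((volume.restrict I).prod volume)
  duhamel : IsDuhamelSolution I t₀ v (fun t x => nonlin p a v t x + e t x)

end

end StabilityNLS

/-! Everything reduces to functions of time. Put `m = ‖u - ũ‖_r`, `n = ‖ũ‖_r` and `g = ‖F(u) -
F(ũ)‖_β`, where the norms are in space and `β` is the conjugate exponent `r'` of `r`. The dispersive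
estimate `‖e^{itΔ}‖_{r' → r} ≤ |t|^{-(1-2/r)}` and the Duhamel formula give `m(t) ≤ h(t) + ∫ (g(s) +
‖e(s)‖_β) |t-s|^{-(1-2/r)} ds`, the integral running between `t₀` and `t`, with `h` controlling the
free evolution of `u₀ - ũ₀`. The pair `(q, r)` is not `L²`-admissible, but the
Hardy-Littlewood-Sobolev inequality (`hls_operator`) maps `L^α` to `L^q`, because `α = q/(p+1)` and
`p/q = 2/r`. Hölder's inequality with the weight in `L^ρ` gives `g ≤ (p+1) A (n+m)^p m`.

These scalar inequalities imply the theorem (`scalar_stability`). The window `[t₀-τ, t₀+τ]` is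
enlarged in finitely many steps, each adding at most a small amount `η` to the `L^q` norm of `n`. On
the new shell the nonlinear term is absorbed into the left side, the old window contributes a
multiple of `ε`, and continuity in `τ` closes the bootstrap. The Duhamel formula is always based at
`t₀`, so `u - ũ` need not be controlled in `H¹` at later times. The number of steps depends only on
`p`, `L` and `A`.

The term `h` is bounded by a `T T*` argument (`exists_free_evolution_bound`), which needs `|⟨(1-Δ)⁻¹
e^{i(t-s)Δ} φ, ψ⟩| ≲ |t-s|^{-2/q}` for `φ`, `ψ` in the unit ball of `L^{r'}`. This follows from
`(1-Δ)⁻¹ = ∫ e^{-l} e^{lΔ} dl` over `l > 0` and the bound `|l+it|^{-(1-2/r)}` for `e^{(l+it)Δ}`,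
itself an interpolation between the Gaussian kernel bound and Plancherel
(`norm_gaussForm_le_of_re_pos`). At `t = 0`, with no decay asked for, the same argument is the
Sobolev embedding `H¹ ⊂ L^r`, which makes `m` locally finite, as the bootstrap requires. -/

namespace StabilityNLS

noncomputable section

/-! ### The Hardy-Littlewood-Sobolev inequality on the line -/

/-- The kernel `|x|^{-γ}` of the Riesz potential on the line. -/
def rieszKer (γ x : ℝ) : ℝ≥0∞ := ENNReal.ofReal (|x| ^ (-γ))

theorem measurable_rieszKer (γ : ℝ) : Measurable (rieszKer γ) := by
  unfold rieszKer; fun_prop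

theorem rieszKer_sub_comm (γ s t : ℝ) : rieszKer γ (t - s) = rieszKer γ (s - t) := by
  simp [rieszKer, abs_sub_comm]

theorem lintegral_Ioo_rpow {σ R : ℝ} (hσ : σ < 1) (hR : 0 < R) :
    ∫⁻ b in Set.Ioo 0 R, ENNReal.ofReal (b ^ (-σ)) =
      ENNReal.ofReal (R ^ (1 - σ) / (1 - σ)) := by
  have hint : IntervalIntegrable (fun b : ℝ => b ^ (-σ)) volume 0 R :=
    intervalIntegral.intervalIntegrable_rpow' (by linarith)
  have h1 := integral_rpow (a := 0) (b := R) (r := -σ) (Or.inl (by linarith))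
  rw [Real.zero_rpow (by linarith), sub_zero, intervalIntegral.integral_of_le hR.le,
    integral_Ioc_eq_integral_Ioo] at h1
  rw [← ofReal_integral_eq_lintegral_ofReal, h1]
  · rw [neg_add_eq_sub]
  · exact (intervalIntegrable_iff_integrableOn_Ioo_of_le hR.le).1 hint
  · filter_upwards [ae_restrict_mem measurableSet_Ioo] with x hx
    exact Real.rpow_nonneg hx.1.le _

theorem lintegral_abs_lt_rieszKer {γ R : ℝ} (hγ : γ < 1) (hR : 0 < R) :
    ∫⁻ x in Set.Ioo (-R) R, rieszKer γ x ≤ ENNReal.ofReal (2 * (R ^ (1 - γ) / (1 - γ))) := by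
  have hpos : ∫⁻ x in Set.Ioo 0 R, rieszKer γ x = ENNReal.ofReal (R ^ (1 - γ) / (1 - γ)) := by
    rw [← lintegral_Ioo_rpow hγ hR]
    refine setLIntegral_congr_fun measurableSet_Ioo fun x hx => ?_
    simp [rieszKer, abs_of_pos hx.1]
  have hneg : ∫⁻ x in Set.Ioo (-R) 0, rieszKer γ x = ∫⁻ x in Set.Ioo 0 R, rieszKer γ x := by
    rw [← lintegral_indicator measurableSet_Ioo, ← lintegral_indicator measurableSet_Ioo,
      ← lintegral_neg_eq_self]
    refine lintegral_congr fun x => ?_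
    simp only [Set.indicator, Set.mem_Ioo, rieszKer, abs_neg]
    refine if_congr ⟨fun h => ⟨?_, ?_⟩, fun h => ⟨?_, ?_⟩⟩ rfl rfl <;> linarith [h.1, h.2]
  have hsub : Set.Ioo (-R) R ⊆ (Set.Ioo (-R) 0 ∪ Set.Ioo 0 R) ∪ {0} := by
    intro x hx
    rcases lt_trichotomy x 0 with h | h | h
    · exact Or.inl (Or.inl ⟨hx.1, h⟩)
    · exact Or.inr h
    · exact Or.inl (Or.inr ⟨h, hx.2⟩)
  calc ∫⁻ x in Set.Ioo (-R) R, rieszKer γ x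
      ≤ ∫⁻ x in (Set.Ioo (-R) 0 ∪ Set.Ioo 0 R) ∪ {0}, rieszKer γ x := lintegral_mono_set hsub
    _ ≤ (∫⁻ x in Set.Ioo (-R) 0 ∪ Set.Ioo 0 R, rieszKer γ x) + ∫⁻ x in {0}, rieszKer γ x :=
        lintegral_union_le _ _ _
    _ ≤ ((∫⁻ x in Set.Ioo (-R) 0, rieszKer γ x) + ∫⁻ x in Set.Ioo 0 R, rieszKer γ x) + 0 := by
        gcongr
        · exact lintegral_union_le _ _ _
        · simp
    _ = _ := by
        have : 0 ≤ R ^ (1 - γ) / (1 - γ) := div_nonneg (by positivity) (by linarith)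
        rw [hneg, hpos, add_zero, ← ENNReal.ofReal_add this this, two_mul]

/-- The interval of radius `|E|` about `t` takes the singularity; outside it the kernel is at most
`|E|^{-γ}`. Both parts scale like `|E|^{1-γ}`. -/
theorem setLIntegral_rieszKer_le {γ : ℝ} (hγ0 : 0 < γ) (hγ : γ < 1) {E : Set ℝ}
    (t : ℝ) :
    ∫⁻ s in E, rieszKer γ (t - s) ≤
      ENNReal.ofReal (2 / (1 - γ) + 1) * volume E ^ (1 - γ) := by
  have hc : 0 < 2 / (1 - γ) + 1 := by
    have : 0 < 1 - γ := by linarith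
    positivity
  rcases eq_or_ne (volume E) 0 with h0 | h0
  · rw [setLIntegral_measure_zero _ _ h0]; exact zero_le
  rcases eq_or_ne (volume E) ⊤ with h1 | h1
  · rw [h1, ENNReal.top_rpow_of_pos (by linarith), ENNReal.mul_top (by simpa using hc)]
    exact le_top
  set v := (volume E).toReal with hv
  have hvpos : 0 < v := ENNReal.toReal_pos h0 h1
  have hvE : volume E = ENNReal.ofReal v := (ENNReal.ofReal_toReal h1).symm
  have hshift : ∫⁻ s in Set.Ioo (t - v) (t + v), rieszKer γ (t - s) ≤
      ENNReal.ofReal (2 * (v ^ (1 - γ) / (1 - γ))) := by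
    refine le_trans (le_of_eq ?_) (lintegral_abs_lt_rieszKer hγ hvpos)
    rw [← lintegral_indicator measurableSet_Ioo, ← lintegral_indicator measurableSet_Ioo,
      ← lintegral_sub_left_eq_self _ t]
    refine lintegral_congr fun x => ?_
    simp only [Set.indicator, Set.mem_Ioo, rieszKer, sub_sub_cancel]
    refine if_congr ⟨fun h => ⟨?_, ?_⟩, fun h => ⟨?_, ?_⟩⟩ rfl rfl <;> linarith [h.1, h.2]
  have hsub : E ⊆ Set.Ioo (t - v) (t + v) ∪ (E ∩ (Set.Ioo (t - v) (t + v))ᶜ) := by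
    intro s hs
    by_cases h : s ∈ Set.Ioo (t - v) (t + v)
    · exact Or.inl h
    · exact Or.inr ⟨hs, h⟩
  have hfar : ∫⁻ s in E ∩ (Set.Ioo (t - v) (t + v))ᶜ, rieszKer γ (t - s) ≤
      ENNReal.ofReal (v ^ (-γ)) * volume E := by
    calc _ ≤ ∫⁻ s in E ∩ (Set.Ioo (t - v) (t + v))ᶜ, ENNReal.ofReal (v ^ (-γ)) := by
          refine setLIntegral_mono (by fun_prop) fun s hs => ?_
          refine ENNReal.ofReal_le_ofReal
            (Real.rpow_le_rpow_of_nonpos hvpos ?_ (by linarith))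
          by_contra! hlt
          rw [abs_lt] at hlt
          exact hs.2 ⟨by linarith [hlt.2], by linarith [hlt.1]⟩
      _ ≤ _ := by
          rw [setLIntegral_const]
          gcongr
          exact Set.inter_subset_left
  calc ∫⁻ s in E, rieszKer γ (t - s)
      ≤ _ := lintegral_mono_set hsub
    _ ≤ _ := lintegral_union_le _ _ _
    _ ≤ ENNReal.ofReal (2 * (v ^ (1 - γ) / (1 - γ))) + ENNReal.ofReal (v ^ (-γ)) * volume E :=
        add_le_add hshift hfar
    _ = _ := by
        have h1g : 0 < 1 - γ := by linarith
        rw [hvE, ENNReal.ofReal_rpow_of_pos hvpos, ← ENNReal.ofReal_mul (by positivity),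
          ← ENNReal.ofReal_mul hc.le, ← ENNReal.ofReal_add (by positivity) (by positivity)]
        congr 1
        have : v ^ (1 - γ) = v ^ (-γ) * v := by
          rw [← Real.rpow_add_one hvpos.ne']; congr 1; ring
        rw [← this]; ring

/-- Layer-cake formula with a weight. -/
theorem lintegral_ofReal_mul_eq_lintegral_superlevel {f : ℝ → ℝ} (hf : Measurable f)
    (hf0 : ∀ x, 0 ≤ f x) {h : ℝ → ℝ≥0∞} (hh : Measurable h) :
    ∫⁻ s, ENNReal.ofReal (f s) * h s =
      ∫⁻ a in Set.Ioi (0 : ℝ), ∫⁻ s in {s | a < f s}, h s := by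
  have := lintegral_eq_lintegral_meas_lt (volume.withDensity h) (f := f)
    (Eventually.of_forall hf0) hf.aemeasurable
  rw [lintegral_withDensity_eq_lintegral_mul _ hh (by fun_prop)] at this
  simp only [Pi.mul_apply] at this
  simp_rw [mul_comm (ENNReal.ofReal _)]
  rw [this]
  refine lintegral_congr fun a => ?_
  rw [withDensity_apply _ (measurableSet_lt measurable_const hf)]

/-- Hölder's inequality with exponents `1/(1-γ)` and `1/γ`: the exponent `σ` is chosen so that
`b^{-σγ}` cancels the weight, and `Q (1-γ) < 1` says exactly that `σ < 1`, so that `b^{-σ}` is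
integrable at `0`. -/
theorem lintegral_Ioo_rpow_le_of_weight {γ Q : ℝ} (hγ0 : 0 < γ) (hγ : γ < 1) (hQ : Q * (1 - γ) < 1)
    {W : ℝ → ℝ≥0∞} (hW : Measurable W) {R : ℝ} (hR : 0 < R)
    (h1 : ∫⁻ b in Set.Ioi (0 : ℝ), W b * ENNReal.ofReal (b ^ (Q - 1)) ≤ 1) :
    ∫⁻ b in Set.Ioo 0 R, W b ^ (1 - γ) ≤
      ENNReal.ofReal ((γ / (1 - Q * (1 - γ))) ^ γ) * ENNReal.ofReal (R ^ (1 - Q * (1 - γ))) := by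
  set σ := (Q - 1) * (1 - γ) / γ with hσ
  have hσγ : σ * γ = (Q - 1) * (1 - γ) := by rw [hσ]; field_simp
  have hσ1 : σ < 1 := by rw [hσ, div_lt_one hγ0]; nlinarith
  have h1σ : 1 - σ = (1 - Q * (1 - γ)) / γ := by
    rw [eq_div_iff hγ0.ne', sub_mul, hσγ]; ring
  calc ∫⁻ b in Set.Ioo 0 R, W b ^ (1 - γ)
      = ∫⁻ b in Set.Ioo 0 R, (W b * ENNReal.ofReal (b ^ (Q - 1))) ^ (1 - γ) *
          (ENNReal.ofReal (b ^ (-σ))) ^ γ := by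
        refine setLIntegral_congr_fun measurableSet_Ioo fun b hb => ?_
        have hb0 : 0 < b := hb.1
        rw [ENNReal.mul_rpow_of_nonneg _ _ (by linarith), mul_assoc,
          ENNReal.ofReal_rpow_of_pos (by positivity), ENNReal.ofReal_rpow_of_pos (by positivity),
          ← ENNReal.ofReal_mul (by positivity), ← Real.rpow_mul hb0.le, ← Real.rpow_mul hb0.le,
          ← Real.rpow_add hb0, neg_mul, hσγ, add_neg_cancel, Real.rpow_zero, ENNReal.ofReal_one,
          mul_one]
    _ ≤ (∫⁻ b in Set.Ioo 0 R, W b * ENNReal.ofReal (b ^ (Q - 1))) ^ (1 - γ) *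
          (∫⁻ b in Set.Ioo 0 R, ENNReal.ofReal (b ^ (-σ))) ^ γ :=
        ENNReal.lintegral_mul_norm_pow_le (by fun_prop) (by fun_prop) (by linarith) hγ0.le (by ring)
    _ ≤ 1 ^ (1 - γ) * (ENNReal.ofReal (R ^ (1 - σ) / (1 - σ))) ^ γ := by
        rw [lintegral_Ioo_rpow hσ1 hR]
        gcongr
        exact (lintegral_mono_set Set.Ioo_subset_Ioi_self).trans h1
    _ = _ := by
        have hp : 0 < 1 - Q * (1 - γ) := by linarith
        rw [ENNReal.one_rpow, one_mul, h1σ, ENNReal.ofReal_rpow_of_pos (by positivity),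
          ← ENNReal.ofReal_mul (by positivity)]
        congr 1
        rw [div_eq_mul_inv, Real.mul_rpow (by positivity) (by positivity), ← Real.rpow_mul hR.le,
          inv_div, div_mul_cancel₀ _ hγ0.ne', mul_comm]

theorem lintegral_superlevel_le_one {P : ℝ} (hP : 1 ≤ P) {f : ℝ → ℝ} (hf : Measurable f)
    (hf0 : ∀ x, 0 ≤ f x) (h1 : ∫⁻ s, ENNReal.ofReal (f s ^ P) ≤ 1) :
    ∫⁻ a in Set.Ioi (0 : ℝ), volume {s | a < f s} * ENNReal.ofReal (a ^ (P - 1)) ≤ 1 := by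
  have := lintegral_rpow_eq_lintegral_meas_lt_mul volume (f := f) (Eventually.of_forall hf0)
    hf.aemeasurable (p := P) (by linarith)
  rw [this] at h1
  refine le_trans ?_ h1
  refine le_mul_of_one_le_left zero_le ?_
  simpa using ENNReal.ofReal_le_ofReal hP

theorem measurable_volume_superlevel (f : ℝ → ℝ) : Measurable fun a => volume {s | a < f s} :=
  Antitone.measurable fun _ _ h => measure_mono fun _ hs => lt_of_le_of_lt h hs

/-- The Hardy-Littlewood-Sobolev inequality for normalized functions. -/
theorem hls_normalized {γ P Q : ℝ} (hγ0 : 0 < γ) (hγ : γ < 1) (hP : 1 < P) (hQ : 1 < Q)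
    (hPQ : 1 / P + 1 / Q + γ = 2) : ∃ C : ℝ, 0 < C ∧ ∀ f g : ℝ → ℝ, Measurable f → Measurable g →
      (∀ x, 0 ≤ f x) → (∀ x, 0 ≤ g x) →
      ∫⁻ s, ENNReal.ofReal (f s ^ P) ≤ 1 → ∫⁻ s, ENNReal.ofReal (g s ^ Q) ≤ 1 →
      ∫⁻ t, ENNReal.ofReal (g t) * ∫⁻ s, ENNReal.ofReal (f s) * rieszKer γ (t - s) ≤
        ENNReal.ofReal C := by
  have hQγ : Q * (1 - γ) < 1 := by
    have : 1 - γ = 1 / P + 1 / Q - 1 := by linarith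
    have h2 : 1 / P < 1 := by rw [div_lt_one (by linarith)]; exact hP
    have h3 : 1 - γ < 1 / Q := by linarith
    rwa [lt_div_iff₀ (by linarith), mul_comm] at h3
  have hPγ : P * (1 - γ) < 1 := by
    have h2 : 1 / Q < 1 := by rw [div_lt_one (by linarith)]; exact hQ
    have h3 : 1 - γ < 1 / P := by linarith
    rwa [lt_div_iff₀ (by linarith), mul_comm] at h3
  have hP0 : 0 < P := by linarith
  have hQ0 : 0 < Q := by linarith
  have e1 : P / Q * (1 - Q * (1 - γ)) = P - 1 := by
    have : γ = 2 - 1 / P - 1 / Q := by linarith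
    rw [this]; field_simp; ring
  have e2 : Q / P * (1 - P * (1 - γ)) = Q - 1 := by
    have : γ = 2 - 1 / P - 1 / Q := by linarith
    rw [this]; field_simp; ring
  set c₀ := 2 / (1 - γ) + 1 with hc₀
  have hc₀pos : 0 < c₀ := by
    have : 0 < 1 - γ := by linarith
    positivity
  set cQ := (γ / (1 - Q * (1 - γ))) ^ γ
  set cP := (γ / (1 - P * (1 - γ))) ^ γ
  have hcQ : 0 < cQ := Real.rpow_pos_of_pos (div_pos hγ0 (by linarith)) _
  have hcP : 0 < cP := Real.rpow_pos_of_pos (div_pos hγ0 (by linarith)) _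
  refine ⟨c₀ * cQ + c₀ * cP, by positivity, fun f g hf hg hf0 hg0 hf1 hg1 => ?_⟩
  set v : ℝ → ℝ≥0∞ := fun a => volume {s | a < f s} with hv
  set w : ℝ → ℝ≥0∞ := fun b => volume {s | b < g s} with hw
  have hvm : Measurable v := measurable_volume_superlevel f
  have hwm : Measurable w := measurable_volume_superlevel g
  have hv1 := lintegral_superlevel_le_one hP.le hf hf0 hf1
  have hw1 := lintegral_superlevel_le_one hQ.le hg hg0 hg1
  have hkm : Measurable fun z : ℝ × ℝ => rieszKer γ (z.1 - z.2) :=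
    (measurable_rieszKer γ).comp (measurable_fst.sub measurable_snd)
  have hkt : ∀ t, Measurable fun s => rieszKer γ (t - s) := fun t =>
    (measurable_rieszKer γ).comp (measurable_const.sub measurable_id)
  set Φ : ℝ → ℝ → ℝ≥0∞ := fun a t => ∫⁻ s in {s | a < f s}, rieszKer γ (t - s) with hΦ
  have hEf : ∀ a, MeasurableSet {s | a < f s} := fun a => measurableSet_lt measurable_const hf
  have hEg : ∀ b, MeasurableSet {s | b < g s} := fun a => measurableSet_lt measurable_const hg
  have hΦm : Measurable fun z : ℝ × ℝ => Φ z.2 z.1 := by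
    have : (fun z : ℝ × ℝ => Φ z.2 z.1) = fun z : ℝ × ℝ =>
        ∫⁻ s, Set.indicator {y : (ℝ × ℝ) × ℝ | y.1.2 < f y.2}
          (fun y => rieszKer γ (y.1.1 - y.2)) (z, s) := by
      funext z
      simp only [hΦ]
      rw [← lintegral_indicator (hEf _)]
      rfl
    rw [this]
    refine Measurable.lintegral_prod_right' (f := Set.indicator {y : (ℝ × ℝ) × ℝ | y.1.2 < f y.2}
          (fun y => rieszKer γ (y.1.1 - y.2))) ?_
    refine Measurable.indicator ?_ ?_
    · exact (measurable_rieszKer γ).comp (by fun_prop)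
    · exact measurableSet_lt (by fun_prop) (by fun_prop)
  have hΦa : ∀ a, Measurable (Φ a) := fun a => hΦm.comp (measurable_id.prodMk measurable_const)
  -- On a product of superlevel sets the kernel can be integrated first over either factor. This
  -- gives the two bounds `w v^{1-γ}` and `v w^{1-γ}`.
  have key1 : ∀ a b, ∫⁻ t in {t | b < g t}, Φ a t ≤ ENNReal.ofReal c₀ * (w b * v a ^ (1 - γ)) := by
    intro a b
    calc _ ≤ ∫⁻ t in {t | b < g t}, ENNReal.ofReal c₀ * v a ^ (1 - γ) :=
          lintegral_mono fun t => setLIntegral_rieszKer_le hγ0 hγ t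
      _ = _ := by rw [setLIntegral_const]; ring
  have key2 : ∀ a b, ∫⁻ t in {t | b < g t}, Φ a t ≤ ENNReal.ofReal c₀ * (v a * w b ^ (1 - γ)) := by
    intro a b
    simp only [hΦ]
    rw [lintegral_lintegral_swap (f := fun t s => rieszKer γ (t - s)) hkm.aemeasurable]
    calc _ ≤ ∫⁻ t in {t | a < f t}, ENNReal.ofReal c₀ * w b ^ (1 - γ) := by
          refine lintegral_mono fun t => ?_
          simp_rw [fun x => rieszKer_sub_comm γ t x]
          exact setLIntegral_rieszKer_le hγ0 hγ t
      _ = _ := by rw [setLIntegral_const]; ring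
  have hrep : ∫⁻ t, ENNReal.ofReal (g t) * ∫⁻ s, ENNReal.ofReal (f s) * rieszKer γ (t - s) =
      ∫⁻ a in Set.Ioi (0 : ℝ), ∫⁻ b in Set.Ioi (0 : ℝ), ∫⁻ t in {t | b < g t}, Φ a t := by
    calc _ = ∫⁻ t, ∫⁻ a in Set.Ioi (0 : ℝ), ENNReal.ofReal (g t) * Φ a t := by
          refine lintegral_congr fun t => ?_
          rw [lintegral_ofReal_mul_eq_lintegral_superlevel hf hf0 (hkt t), lintegral_const_mul]
          exact hΦm.comp (measurable_const.prodMk measurable_id)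
      _ = ∫⁻ a in Set.Ioi (0 : ℝ), ∫⁻ t, ENNReal.ofReal (g t) * Φ a t := by
          rw [lintegral_lintegral_swap]
          exact ((by fun_prop : Measurable fun z : ℝ × ℝ => ENNReal.ofReal (g z.1)).mul
            hΦm).aemeasurable
      _ = _ := by
          refine lintegral_congr fun a => ?_
          rw [lintegral_ofReal_mul_eq_lintegral_superlevel hg hg0 (hΦa a)]
  have first : ∀ a ∈ Set.Ioi (0 : ℝ),
      ∫⁻ b in Set.Iio (a ^ (P / Q)) ∩ Set.Ioi 0, ∫⁻ t in {t | b < g t}, Φ a t ≤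
        ENNReal.ofReal (c₀ * cQ) * (v a * ENNReal.ofReal (a ^ (P - 1))) := by
    intro a ha
    have ha0 : 0 < a := ha
    calc _ ≤ ∫⁻ b in Set.Ioo 0 (a ^ (P / Q)), ENNReal.ofReal c₀ * (v a * w b ^ (1 - γ)) := by
          rw [Set.inter_comm, Set.Ioi_inter_Iio]
          exact lintegral_mono fun b => key2 a b
      _ = ENNReal.ofReal c₀ * (v a * ∫⁻ b in Set.Ioo 0 (a ^ (P / Q)), w b ^ (1 - γ)) := by
          rw [lintegral_const_mul _ (by fun_prop), lintegral_const_mul _ (by fun_prop)]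
      _ ≤ ENNReal.ofReal c₀ * (v a * (ENNReal.ofReal cQ *
            ENNReal.ofReal ((a ^ (P / Q)) ^ (1 - Q * (1 - γ))))) := by
          gcongr
          exact lintegral_Ioo_rpow_le_of_weight hγ0 hγ hQγ hwm (by positivity) hw1
      _ = _ := by
          rw [← Real.rpow_mul ha0.le, e1, ENNReal.ofReal_mul hc₀pos.le]; ring
  have second : ∀ b ∈ Set.Ioi (0 : ℝ),
      ∫⁻ a in Set.Ioo 0 (b ^ (Q / P)), ENNReal.ofReal c₀ * (w b * v a ^ (1 - γ)) ≤
        ENNReal.ofReal (c₀ * cP) * (w b * ENNReal.ofReal (b ^ (Q - 1))) := by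
    intro b hb
    have hb0 : 0 < b := hb
    calc _ = ENNReal.ofReal c₀ * (w b * ∫⁻ a in Set.Ioo 0 (b ^ (Q / P)), v a ^ (1 - γ)) := by
          rw [lintegral_const_mul _ (by fun_prop), lintegral_const_mul _ (by fun_prop)]
      _ ≤ ENNReal.ofReal c₀ * (w b * (ENNReal.ofReal cP *
            ENNReal.ofReal ((b ^ (Q / P)) ^ (1 - P * (1 - γ))))) := by
          gcongr
          exact lintegral_Ioo_rpow_le_of_weight hγ0 hγ hPγ hvm (by positivity) hv1
      _ = _ := by
          rw [← Real.rpow_mul hb0.le, e2, ENNReal.ofReal_mul hc₀pos.le]; ring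
  rw [hrep]
  -- The curve `b = a^{P/Q}`, on which `a^P = b^Q`, separates the regions where the two bounds are
  -- used. Below it the integral in `b` is done first, above it the one in `a`; by `e1` and `e2`
  -- what remains is the weight `a^{P-1}` or `b^{Q-1}` of the normalization.
  have split : ∀ a ∈ Set.Ioi (0 : ℝ), ∫⁻ b in Set.Ioi (0 : ℝ), ∫⁻ t in {t | b < g t}, Φ a t ≤
      ENNReal.ofReal (c₀ * cQ) * (v a * ENNReal.ofReal (a ^ (P - 1))) +
      ∫⁻ b in Set.Ioi (0 : ℝ), Set.indicator (Set.Ici (a ^ (P / Q)))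
        (fun b => ENNReal.ofReal c₀ * (w b * v a ^ (1 - γ))) b := by
    intro a ha
    rw [← lintegral_inter_add_sdiff (B := Set.Iio (a ^ (P / Q))) _ _ measurableSet_Iio]
    refine add_le_add ?_ ?_
    · rw [Set.inter_comm]; exact first a ha
    · rw [lintegral_indicator measurableSet_Ici, Measure.restrict_restrict measurableSet_Ici]
      have : Set.Ioi (0 : ℝ) \ Set.Iio (a ^ (P / Q)) = Set.Ici (a ^ (P / Q)) ∩ Set.Ioi 0 := by
        ext x; simp [and_comm]
      rw [this]
      exact lintegral_mono fun b => key1 a b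
  have hind : Measurable fun z : ℝ × ℝ => Set.indicator (Set.Ici (z.1 ^ (P / Q)))
        (fun b => ENNReal.ofReal c₀ * (w b * v z.1 ^ (1 - γ))) z.2 := by
    have : (fun z : ℝ × ℝ => Set.indicator (Set.Ici (z.1 ^ (P / Q)))
        (fun b => ENNReal.ofReal c₀ * (w b * v z.1 ^ (1 - γ))) z.2) =
        Set.indicator {z : ℝ × ℝ | z.1 ^ (P / Q) ≤ z.2}
          (fun z => ENNReal.ofReal c₀ * (w z.2 * v z.1 ^ (1 - γ))) := by
      funext z; simp [Set.indicator]
    rw [this]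
    exact Measurable.indicator (by fun_prop) (measurableSet_le (by fun_prop) (by fun_prop))
  calc _ ≤ ∫⁻ a in Set.Ioi (0 : ℝ), (ENNReal.ofReal (c₀ * cQ) *
          (v a * ENNReal.ofReal (a ^ (P - 1))) +
        ∫⁻ b in Set.Ioi (0 : ℝ), Set.indicator (Set.Ici (a ^ (P / Q)))
        (fun b => ENNReal.ofReal c₀ * (w b * v a ^ (1 - γ))) b) :=
        setLIntegral_mono' measurableSet_Ioi split
    _ = ENNReal.ofReal (c₀ * cQ) *
          (∫⁻ a in Set.Ioi (0 : ℝ), v a * ENNReal.ofReal (a ^ (P - 1))) +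
        ∫⁻ b in Set.Ioi (0 : ℝ), ∫⁻ a in Set.Ioi (0 : ℝ), Set.indicator (Set.Ici (a ^ (P / Q)))
        (fun b => ENNReal.ofReal c₀ * (w b * v a ^ (1 - γ))) b := by
        rw [lintegral_add_left (by fun_prop), lintegral_const_mul _ (by fun_prop),
          lintegral_lintegral_swap hind.aemeasurable]
    _ ≤ ENNReal.ofReal (c₀ * cQ) * 1 +
        ∫⁻ b in Set.Ioi (0 : ℝ), ENNReal.ofReal (c₀ * cP) *
          (w b * ENNReal.ofReal (b ^ (Q - 1))) := by
        refine add_le_add (mul_le_mul_right hv1 _)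
          (setLIntegral_mono' measurableSet_Ioi fun b hb => ?_)
        refine le_trans ?_ (second b hb)
        have hb0 : 0 < b := hb
        have : (fun a => Set.indicator (Set.Ici (a ^ (P / Q)))
            (fun b => ENNReal.ofReal c₀ * (w b * v a ^ (1 - γ))) b) =
            Set.indicator {a | a ^ (P / Q) ≤ b}
              (fun a => ENNReal.ofReal c₀ * (w b * v a ^ (1 - γ))) := by
          funext a; simp [Set.indicator]
        have hset : MeasurableSet {a : ℝ | a ^ (P / Q) ≤ b} :=
          measurableSet_le (by fun_prop) measurable_const
        rw [this, lintegral_indicator hset, Measure.restrict_restrict hset,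
          setLIntegral_congr (Ioo_ae_eq_Ioc (a := (0 : ℝ)) (b := b ^ (Q / P)))]
        refine lintegral_mono_set fun a ha => (⟨ha.2, ?_⟩ : a ∈ Set.Ioc 0 (b ^ (Q / P)))
        have ha0 : 0 < a := ha.2
        have := Real.rpow_le_rpow (by positivity) ha.1 (by positivity : 0 ≤ Q / P)
        rwa [← Real.rpow_mul ha0.le, div_mul_div_comm, mul_comm P Q, div_self (by positivity),
          Real.rpow_one] at this
    _ ≤ ENNReal.ofReal (c₀ * cQ) * 1 + ENNReal.ofReal (c₀ * cP) * 1 := by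
        rw [lintegral_const_mul _ (by fun_prop)]
        gcongr
    _ = _ := by rw [mul_one, mul_one, ← ENNReal.ofReal_add (by positivity) (by positivity)]

theorem lintegral_eq_zero_of_rpow {P : ℝ} (hP : 0 < P) {f h : ℝ → ℝ≥0∞} (hf : Measurable f)
    (h0 : ∫⁻ s, f s ^ P = 0) : ∫⁻ s, f s * h s = 0 := by
  rw [lintegral_eq_zero_iff (by fun_prop)] at h0
  rw [← lintegral_zero (μ := (volume : Measure ℝ))]
  refine lintegral_congr_ae ?_
  filter_upwards [h0] with s hs
  have : f s = 0 := by simpa [ENNReal.rpow_eq_zero_iff, hP, hP.not_gt] using hs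
  simp [this]

/-- The layer-cake argument works with real-valued functions of norm at most one. A finite norm
forces `f` to be finite only almost everywhere, hence the form of the last identity. -/
theorem exists_normalized {P : ℝ} (hP : 0 < P) {f : ℝ → ℝ≥0∞} (hf : Measurable f)
    (h0 : ∫⁻ s, f s ^ P ≠ 0) (h1 : ∫⁻ s, f s ^ P ≠ ⊤) :
    ∃ φ : ℝ → ℝ, Measurable φ ∧ (∀ x, 0 ≤ φ x) ∧ ∫⁻ s, ENNReal.ofReal (φ s ^ P) ≤ 1 ∧
      ∀ᵐ s, f s = (∫⁻ s, f s ^ P) ^ (1 / P) * ENNReal.ofReal (φ s) := by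
  set N := (∫⁻ s, f s ^ P) ^ (1 / P) with hN
  have hN0 : N ≠ 0 := by
    rw [hN, Ne, ENNReal.rpow_eq_zero_iff]; simp [h0, h1]
  have hN1 : N ≠ ⊤ := by
    rw [hN, Ne, ENNReal.rpow_eq_top_iff]; simp [h0, h1]
  have hfin : ∀ᵐ s, f s < ⊤ := by
    filter_upwards [ae_lt_top (by fun_prop) h1] with s hs
    by_contra! h
    simp [top_le_iff.1 h, hP] at hs
  refine ⟨fun s => (f s / N).toReal, by fun_prop, fun x => ENNReal.toReal_nonneg, ?_, ?_⟩
  · calc _ ≤ ∫⁻ s, (N ^ P)⁻¹ * f s ^ P := by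
          refine lintegral_mono fun s => ?_
          rw [ENNReal.toReal_rpow]
          refine ENNReal.ofReal_toReal_le.trans (le_of_eq ?_)
          rw [ENNReal.div_rpow_of_nonneg _ _ hP.le, ENNReal.div_eq_inv_mul]
      _ = 1 := by
          rw [lintegral_const_mul _ (by fun_prop), hN, ← ENNReal.rpow_mul, one_div,
            inv_mul_cancel₀ hP.ne', ENNReal.rpow_one, ENNReal.inv_mul_cancel h0 h1]
  · filter_upwards [hfin] with s hs
    rw [ENNReal.ofReal_toReal (ENNReal.div_ne_top hs.ne hN0), ENNReal.mul_div_cancel hN0 hN1]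

/-- The **Hardy-Littlewood-Sobolev inequality** on the line, bilinear form. -/
theorem hls_bilinear {γ P Q : ℝ} (hγ0 : 0 < γ) (hγ : γ < 1) (hP : 1 < P) (hQ : 1 < Q)
    (hPQ : 1 / P + 1 / Q + γ = 2) : ∃ C : ℝ, 0 < C ∧ ∀ f g : ℝ → ℝ≥0∞,
      Measurable f → Measurable g →
      ∫⁻ t, g t * ∫⁻ s, f s * rieszKer γ (t - s) ≤
        ENNReal.ofReal C * (∫⁻ s, f s ^ P) ^ (1 / P) * (∫⁻ t, g t ^ Q) ^ (1 / Q) := by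
  obtain ⟨C, hC, H⟩ := hls_normalized hγ0 hγ hP hQ hPQ
  have hP0 : 0 < P := by linarith
  have hQ0 : 0 < Q := by linarith
  refine ⟨C, hC, fun f g hf hg => ?_⟩
  rcases eq_or_ne (∫⁻ s, f s ^ P) 0 with hf0 | hf0
  · simp [lintegral_eq_zero_of_rpow hP0 hf hf0]
  rcases eq_or_ne (∫⁻ s, g s ^ Q) 0 with hg0 | hg0
  · simp [lintegral_eq_zero_of_rpow hQ0 hg hg0]
  have hf0' : (∫⁻ s, f s ^ P) ^ (1 / P) ≠ 0 := by simp [ENNReal.rpow_eq_zero_iff, hf0, hP0.le]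
  have hg0' : (∫⁻ s, g s ^ Q) ^ (1 / Q) ≠ 0 := by simp [ENNReal.rpow_eq_zero_iff, hg0, hQ0.le]
  rcases eq_or_ne (∫⁻ s, f s ^ P) ⊤ with hf1 | hf1
  · rw [hf1, ENNReal.top_rpow_of_pos (by positivity), ENNReal.mul_top (by simpa using hC),
      ENNReal.top_mul hg0']
    exact le_top
  rcases eq_or_ne (∫⁻ s, g s ^ Q) ⊤ with hg1 | hg1
  · rw [hg1, ENNReal.top_rpow_of_pos (by positivity), ENNReal.mul_top]
    · exact le_top
    · exact mul_ne_zero (by simpa using hC) hf0'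
  obtain ⟨φ, hφm, hφ0, hφ1, hφ⟩ := exists_normalized hP0 hf hf0 hf1
  obtain ⟨χ, hχm, hχ0, hχ1, hχ⟩ := exists_normalized hQ0 hg hg0 hg1
  have hk : ∀ t, Measurable fun s => rieszKer γ (t - s) := fun t =>
    (measurable_rieszKer γ).comp (measurable_const.sub measurable_id)
  calc _ = ∫⁻ t, ((∫⁻ s, f s ^ P) ^ (1 / P) * (∫⁻ s, g s ^ Q) ^ (1 / Q)) *
        (ENNReal.ofReal (χ t) * ∫⁻ s, ENNReal.ofReal (φ s) * rieszKer γ (t - s)) := by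
        refine lintegral_congr_ae ?_
        filter_upwards [hχ] with t ht
        have : ∫⁻ s, f s * rieszKer γ (t - s) =
            (∫⁻ s, f s ^ P) ^ (1 / P) * ∫⁻ s, ENNReal.ofReal (φ s) * rieszKer γ (t - s) := by
          rw [← lintegral_const_mul _ (by have := hk t; fun_prop)]
          refine lintegral_congr_ae ?_
          filter_upwards [hφ] with s hs
          conv_lhs => rw [hs]
          ring
        rw [this]
        conv_lhs => rw [ht]
        ring
    _ ≤ ((∫⁻ s, f s ^ P) ^ (1 / P) * (∫⁻ s, g s ^ Q) ^ (1 / Q)) * ENNReal.ofReal C := by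
        rw [lintegral_const_mul' _ _ (ENNReal.mul_ne_top
          (ENNReal.rpow_ne_top_of_nonneg (by positivity) hf1)
          (ENNReal.rpow_ne_top_of_nonneg (by positivity) hg1))]
        gcongr
        exact H φ χ hφm hχm hφ0 hχ0 hφ1 hχ1
    _ = _ := by ring

/-- Duality for `L^q` norms on the line. It suffices to test against the truncated powers. -/
theorem lintegral_rpow_le_of_forall_dual {q q' : ℝ} (hq : q.HolderConjugate q')
    {h : ℝ → ℝ≥0∞} (hh : Measurable h) {C : ℝ≥0∞}
    (H : ∀ g : ℝ → ℝ≥0∞, Measurable g → (∃ M : ℝ, ∀ t, g t ≤ ENNReal.ofReal M) →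
      (∃ R : ℝ, ∀ t, t ∉ Set.Icc (-R) R → g t = 0) →
      ∫⁻ t, h t * g t ≤ C * (∫⁻ t, g t ^ q') ^ (1 / q')) :
    (∫⁻ t, h t ^ q) ^ (1 / q) ≤ C := by
  have hq0 := hq.pos
  have hq1 := hq.symm.pos
  set hN : ℕ → ℝ → ℝ≥0∞ := fun N => Set.indicator (Set.Icc (-(N : ℝ)) N) fun t => min (h t) N
    with hhN
  have hNm : ∀ N, Measurable (hN N) := fun N =>
    Measurable.indicator (hh.min measurable_const) measurableSet_Icc
  have hNle : ∀ N t, hN N t ≤ h t := fun N t =>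
    (Set.indicator_le_self' (fun _ _ => zero_le) t).trans (min_le_left _ _)
  have hNle2 : ∀ N t, hN N t ≤ N := fun N t =>
    (Set.indicator_le_self' (fun _ _ => zero_le) t).trans (min_le_right _ _)
  have hNz : ∀ N : ℕ, ∀ t, t ∉ Set.Icc (-(N : ℝ)) N → hN N t = 0 := fun N t ht =>
    Set.indicator_of_notMem ht _
  have bound : ∀ N, ∫⁻ t, hN N t ^ q ≤ C ^ q := by
    intro N
    have hfin : ∫⁻ t, hN N t ^ q ≠ ⊤ := by
      refine ne_of_lt (lt_of_le_of_lt (b := ∫⁻ t in Set.Icc (-(N : ℝ)) N, (N : ℝ≥0∞) ^ q) ?_ ?_)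
      · rw [← lintegral_indicator measurableSet_Icc]
        refine lintegral_mono fun t => ?_
        by_cases ht : t ∈ Set.Icc (-(N : ℝ)) N
        · rw [Set.indicator_of_mem ht]
          exact ENNReal.rpow_le_rpow (hNle2 N t) hq0.le
        · simp [hNz N t ht, hq0]
      · rw [setLIntegral_const]
        refine ENNReal.mul_lt_top (ENNReal.rpow_lt_top_of_nonneg hq0.le (by simp)) (by simp)
    -- Testing with the power `q - 1` of the truncation gives `X ≤ C X^{1/q'}`; the truncation makes
    -- `X` finite, so that one may divide.
    have h1 : ∫⁻ t, hN N t ^ q ≤ C * (∫⁻ t, hN N t ^ q) ^ (1 / q') := by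
      have := H (fun t => hN N t ^ (q - 1)) (by have := hNm N; fun_prop)
        ⟨(N : ℝ) ^ (q - 1), fun t => ?_⟩ ⟨N, fun t ht => ?_⟩
      · refine le_trans (lintegral_mono fun t => ?_) (this.trans (le_of_eq ?_))
        · calc hN N t ^ q = hN N t * hN N t ^ (q - 1) := by
                conv_rhs => rw [← ENNReal.rpow_one (hN N t)]
                rw [← ENNReal.rpow_mul, one_mul,
                  ← ENNReal.rpow_add_of_nonneg _ _ zero_le_one hq.sub_one_pos.le]
                congr 1; ring
            _ ≤ _ := by gcongr; exact hNle N t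
        · congr 3
          funext t
          rw [← ENNReal.rpow_mul, hq.sub_one_mul_conj]
      · rw [← ENNReal.ofReal_rpow_of_nonneg (by positivity) hq.sub_one_pos.le,
          ENNReal.ofReal_natCast]
        exact ENNReal.rpow_le_rpow (hNle2 N t) hq.sub_one_pos.le
      · simp [hNz N t ht, hq.sub_one_pos]
    rcases eq_or_ne (∫⁻ t, hN N t ^ q) 0 with h0 | h0
    · rw [h0]; exact zero_le
    set X := ∫⁻ t, hN N t ^ q
    have hX : X = X ^ (1 / q) * X ^ (1 / q') := by
      rw [← ENNReal.rpow_add _ _ h0 hfin]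
      have : 1 / q + 1 / q' = 1 := by simpa using hq.inv_add_inv_eq_one
      rw [this, ENNReal.rpow_one]
    have hx0 : X ^ (1 / q') ≠ 0 := by simp [ENNReal.rpow_eq_zero_iff, h0, hq1.le]
    have hx1 : X ^ (1 / q') ≠ ⊤ := ENNReal.rpow_ne_top_of_nonneg (by positivity) hfin
    have h2 : X ^ (1 / q) ≤ C := by
      rw [hX] at h1
      rw [← hX] at h1
      exact (ENNReal.mul_le_mul_iff_left hx0 hx1).1 (hX ▸ h1)
    have := ENNReal.rpow_le_rpow h2 hq0.le
    rwa [← ENNReal.rpow_mul, one_div, inv_mul_cancel₀ hq0.ne', ENNReal.rpow_one] at this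
  have hmono : Monotone fun N t => hN N t ^ q := by
    intro N M hNM t
    refine ENNReal.rpow_le_rpow ?_ hq0.le
    by_cases ht : t ∈ Set.Icc (-(N : ℝ)) N
    · have hc : (N : ℝ) ≤ M := by exact_mod_cast hNM
      have ht' : t ∈ Set.Icc (-(M : ℝ)) M := ⟨by linarith [ht.1], by linarith [ht.2]⟩
      simp only [hhN, Set.indicator_of_mem ht, Set.indicator_of_mem ht']
      gcongr
    · rw [hNz N t ht]; exact zero_le
  have hsup : ∀ t, h t ^ q = ⨆ N, hN N t ^ q := by
    intro t
    refine le_antisymm ?_ (iSup_le fun N => ENNReal.rpow_le_rpow (hNle N t) hq0.le)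
    refine le_of_tendsto_of_tendsto' (b := atTop) (f := fun N : ℕ => (min (h t) N) ^ q)
      (g := fun _ => ⨆ N, hN N t ^ q) ?_ tendsto_const_nhds ?_ |>.trans le_rfl
    · have : Tendsto (fun N : ℕ => min (h t) (N : ℝ≥0∞)) atTop (𝓝 (min (h t) ⊤)) :=
        tendsto_const_nhds.min ENNReal.tendsto_nat_nhds_top
      rw [min_top_right] at this
      exact (ENNReal.continuous_rpow_const.tendsto _).comp this
    · intro N
      obtain ⟨M, hM⟩ := exists_nat_ge (max |t| N)
      refine le_trans ?_ (le_iSup _ M)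
      refine ENNReal.rpow_le_rpow ?_ hq0.le
      have ht : t ∈ Set.Icc (-(M : ℝ)) M := abs_le.1 ((le_max_left _ _).trans hM)
      simp only [hhN, Set.indicator_of_mem ht]
      gcongr
      exact_mod_cast (le_max_right _ _).trans hM
  have : ∫⁻ t, h t ^ q ≤ C ^ q := by
    simp_rw [hsup]
    rw [lintegral_iSup (fun N => by have := hNm N; fun_prop) hmono]
    exact iSup_le bound
  have := ENNReal.rpow_le_rpow this (by positivity : 0 ≤ 1 / q)
  rwa [← ENNReal.rpow_mul, mul_one_div_cancel hq0.ne', ENNReal.rpow_one] at this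

/-- The **Hardy-Littlewood-Sobolev inequality** on the line, operator form. -/
theorem hls_operator {γ P q : ℝ} (hγ0 : 0 < γ) (hγ : γ < 1) (hP : 1 < P) (hq : 1 < q)
    (hPq : 1 / P + γ = 1 + 1 / q) : ∃ C : ℝ, 0 < C ∧ ∀ f : ℝ → ℝ≥0∞, AEMeasurable f →
      (∫⁻ t, (∫⁻ s, f s * rieszKer γ (t - s)) ^ q) ^ (1 / q) ≤
        ENNReal.ofReal C * (∫⁻ s, f s ^ P) ^ (1 / P) := by
  have hc := Real.HolderConjugate.conjExponent hq
  obtain ⟨C, hC, H⟩ := hls_bilinear hγ0 hγ hP hc.symm.lt (by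
    have := hc.inv_add_inv_eq_one
    simp only [one_div] at *
    linarith)
  refine ⟨C, hC, fun f hf => ?_⟩
  have key : ∀ f : ℝ → ℝ≥0∞, Measurable f →
      (∫⁻ t, (∫⁻ s, f s * rieszKer γ (t - s)) ^ q) ^ (1 / q) ≤
        ENNReal.ofReal C * (∫⁻ s, f s ^ P) ^ (1 / P) := by
    intro f hf
    refine lintegral_rpow_le_of_forall_dual hc ?_ fun g hg _ _ => ?_
    · refine Measurable.lintegral_prod_right' (f := fun z : ℝ × ℝ => f z.2 * rieszKer γ (z.1 - z.2))
        ((hf.comp measurable_snd).mul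
          ((measurable_rieszKer γ).comp (measurable_fst.sub measurable_snd)))
    · simp_rw [mul_comm _ (g _)]
      exact H f g hf hg
  convert key _ hf.measurable_mk using 2
  · congr 1
    funext t
    congr 1
    refine lintegral_congr_ae ?_
    filter_upwards [hf.ae_eq_mk] with s hs
    rw [hs]
  · congr 1
    refine lintegral_congr_ae ?_
    filter_upwards [hf.ae_eq_mk] with s hs
    rw [hs]

/-! ### An abstract `T T*` estimate -/

theorem enorm_inner_integral_le {H : Type*} [NormedAddCommGroup H] [InnerProductSpace ℂ H]
    [CompleteSpace H] {Θ : ℝ → H} (hΘ : Integrable Θ) (v : H) :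
    ‖inner ℂ v (∫ t, Θ t)‖ₑ ≤ ∫⁻ t, ‖inner ℂ v (Θ t)‖ₑ := by
  rw [← integral_inner hΘ v]
  exact enorm_integral_le_lintegral_enorm _

/-- The square is expanded as a double integral. The diagonal is null, so a kernel bound is needed
only off it. -/
theorem enorm_integral_sq_le_of_inner_le {H : Type*} [NormedAddCommGroup H]
    [InnerProductSpace ℂ H] [CompleteSpace H] {Θ : ℝ → H} (hΘ : Integrable Θ)
    {K : ℝ → ℝ → ℝ≥0∞} (hK : ∀ s t, s ≠ t → ‖inner ℂ (Θ s) (Θ t)‖ₑ ≤ K s t) :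
    ‖∫ t, Θ t‖ₑ ^ 2 ≤ ∫⁻ s, ∫⁻ t, K s t := by
  have h1 : ‖∫ t, Θ t‖ₑ ^ 2 = ‖inner ℂ (∫ t, Θ t) (∫ t, Θ t)‖ₑ := by
    rw [inner_self_eq_norm_sq_to_K, enorm_pow]
    simp [enorm_eq_nnnorm]
  rw [h1]
  refine (enorm_inner_integral_le hΘ _).trans (lintegral_mono fun s => ?_)
  rw [← enorm_norm, norm_inner_symm, enorm_norm]
  refine (enorm_inner_integral_le hΘ _).trans (lintegral_mono_ae ?_)
  have : ∀ᵐ t : ℝ, t ≠ s := by simp [ae_iff]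
  filter_upwards [this] with t ht using hK s t ht.symm

/-- By duality in time it suffices to bound `‖∫ a Ψ‖` for scalar `a`, whose square is a double
integral of inner products, controlled by the Hardy-Littlewood-Sobolev inequality with kernel
exponent `2/q`. The bound `B` serves only integrability and does not enter the constant. -/
theorem lintegral_inner_rpow_le_of_inner_le {H : Type*} [NormedAddCommGroup H]
    [InnerProductSpace ℂ H] [CompleteSpace H] {q : ℝ} (hq : 2 < q) :
    ∃ C : ℝ, 0 < C ∧ ∀ (κ B : ℝ) (Ψ : ℝ → H), 0 ≤ κ → StronglyMeasurable Ψ →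
      (∀ t, ‖Ψ t‖ ≤ B) →
      (∀ s t, s ≠ t → ‖inner ℂ (Ψ s) (Ψ t)‖ ≤ κ * |t - s| ^ (-(2 / q))) → ∀ w : H,
      (∫⁻ t, ‖inner ℂ (Ψ t) w‖ₑ ^ q) ^ (1 / q) ≤ ENNReal.ofReal (C * √κ) * ‖w‖ₑ := by
  have hc := Real.HolderConjugate.conjExponent (by linarith : 1 < q)
  set q' := q.conjExponent
  have hq0 : 0 < q := by linarith
  obtain ⟨C, hC, hls⟩ := hls_bilinear (γ := 2 / q) (P := q') (Q := q') (by positivity)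
    (by rw [div_lt_one hq0]; exact hq) hc.symm.lt hc.symm.lt (by
      have := hc.inv_add_inv_eq_one
      simp only [div_eq_mul_inv] at *
      linarith)
  refine ⟨√C, by positivity, fun κ B Ψ hκ hΨ hB hin w => ?_⟩
  refine lintegral_rpow_le_of_forall_dual hc ?_ fun g hg ⟨M, hM⟩ ⟨R, hR⟩ => ?_
  · exact (hΨ.inner stronglyMeasurable_const).measurable.enorm
  have hgtop : ∀ t, g t ≠ ⊤ := fun t => ne_top_of_le_ne_top ENNReal.ofReal_ne_top (hM t)
  set z : ℝ → ℂ := fun t => inner ℂ (Ψ t) w with hz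
  have hzm : StronglyMeasurable z := hΨ.inner stronglyMeasurable_const
  -- The phase of `z` makes `⟨w, Θ(t)⟩` equal to `g |z|`. Where `z = 0` the quotient is `0` by
  -- convention, which is harmless.
  set a : ℝ → ℂ := fun t => ((g t).toReal : ℂ) * (z t / (‖z t‖ : ℂ)) with ha
  set Θ : ℝ → H := fun t => a t • Ψ t with hΘ
  have hgm : Measurable fun t => (g t).toReal := hg.ennreal_toReal
  have ham : StronglyMeasurable a := by
    have := hzm.measurable
    exact Measurable.stronglyMeasurable (by fun_prop)
  have hnorm : ∀ t, ‖a t‖ ≤ (g t).toReal := by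
    intro t
    rw [ha]
    simp only [norm_mul, Complex.norm_real, norm_div, norm_norm]
    rw [Real.norm_of_nonneg ENNReal.toReal_nonneg]
    exact mul_le_of_le_one_right ENNReal.toReal_nonneg (div_self_le_one _)
  have hnorme : ∀ t, ‖a t‖ₑ ≤ g t := by
    intro t
    rw [← ofReal_norm, ← ENNReal.ofReal_toReal (hgtop t)]
    exact ENNReal.ofReal_le_ofReal (hnorm t)
  have hint : Integrable Θ := by
    have hB0 : 0 ≤ B := (norm_nonneg _).trans (hB 0)
    have hon : IntegrableOn Θ (Set.Icc (-R) R) := by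
      refine IntegrableOn.of_bound (by simp) (ham.smul hΨ).aestronglyMeasurable
        (max M 0 * B) (Eventually.of_forall fun t => ?_)
      rw [hΘ]
      simp only [norm_smul]
      gcongr
      · refine (hnorm t).trans ?_
        have := ENNReal.toReal_mono ENNReal.ofReal_ne_top (hM t)
        rwa [ENNReal.toReal_ofReal'] at this
      · exact hB t
    refine (integrableOn_iff_integrable_of_support_subset ?_).1 hon
    intro t ht
    by_contra h
    apply ht
    have : a t = 0 := by simp [ha, hR t h]
    simp [hΘ, this]
  have hΘw : ∀ t, ‖inner ℂ (Ψ t) w‖ₑ * g t = ENNReal.ofReal (inner ℂ w (Θ t)).re ∧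
      0 ≤ (inner ℂ w (Θ t)).re := by
    intro t
    have h1 : inner ℂ w (Θ t) = (((g t).toReal * ‖z t‖ : ℝ) : ℂ) := by
      rw [hΘ]
      simp only [inner_smul_right, ha]
      rw [← inner_conj_symm, show inner ℂ (Ψ t) w = z t from rfl]
      rcases eq_or_ne (z t) 0 with h0 | h0
      · simp [h0]
      · have hn : (‖z t‖ : ℂ) ≠ 0 := by simpa using h0
        have h2 : z t * (starRingEnd ℂ) (z t) = (‖z t‖ : ℂ) ^ 2 := by
          rw [Complex.mul_conj, Complex.normSq_eq_norm_sq]; push_cast; rfl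
        have : ((g t).toReal : ℂ) * (z t / (‖z t‖ : ℂ)) * (starRingEnd ℂ) (z t) =
            (g t).toReal * (z t * (starRingEnd ℂ) (z t)) / ‖z t‖ := by ring
        rw [this, h2]; push_cast; field_simp
    rw [h1, Complex.ofReal_re]
    refine ⟨?_, by positivity⟩
    rw [ENNReal.ofReal_mul ENNReal.toReal_nonneg, ENNReal.ofReal_toReal (hgtop t), ofReal_norm,
      mul_comm]
  have h1 : ∫⁻ t, ‖inner ℂ (Ψ t) w‖ₑ * g t ≤ ‖w‖ₑ * ‖∫ t, Θ t‖ₑ := by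
    have hi : Integrable fun t => inner ℂ w (Θ t) := hint.const_inner w
    calc _ = ∫⁻ t, ENNReal.ofReal (inner ℂ w (Θ t)).re := lintegral_congr fun t => (hΘw t).1
      _ = ENNReal.ofReal (∫ t, (inner ℂ w (Θ t)).re) :=
          (ofReal_integral_eq_lintegral_ofReal hi.re
            (Eventually.of_forall fun t => (hΘw t).2)).symm
      _ = ENNReal.ofReal (inner ℂ w (∫ t, Θ t)).re := by
          congr 1
          rw [← integral_inner hint w]
          exact integral_re hi
      _ ≤ ENNReal.ofReal (‖w‖ * ‖∫ t, Θ t‖) :=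
          ENNReal.ofReal_le_ofReal ((Complex.re_le_norm _).trans (norm_inner_le_norm _ _))
      _ = _ := by rw [ENNReal.ofReal_mul (norm_nonneg _), ofReal_norm, ofReal_norm]
  -- Both exponents are `q'`: the scaling condition `2/q' + 2/q = 2` holds for every conjugate pair.
  have h2 : ‖∫ t, Θ t‖ₑ ^ 2 ≤ ENNReal.ofReal κ *
      (ENNReal.ofReal C * (∫⁻ t, g t ^ q') ^ (1 / q') * (∫⁻ t, g t ^ q') ^ (1 / q')) := by
    refine (enorm_integral_sq_le_of_inner_le hint (K := fun s t =>
      ENNReal.ofReal κ * (g s * (g t * rieszKer (2 / q) (s - t)))) fun s t hst => ?_).trans ?_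
    · rw [hΘ]
      simp only [inner_smul_left, inner_smul_right]
      rw [enorm_mul (a t), enorm_mul ((starRingEnd ℂ) (a s)), RCLike.enorm_conj]
      have h3 : ‖inner ℂ (Ψ s) (Ψ t)‖ₑ ≤ ENNReal.ofReal κ * rieszKer (2 / q) (s - t) := by
        rw [← ofReal_norm, rieszKer, ← ENNReal.ofReal_mul hκ, abs_sub_comm]
        exact ENNReal.ofReal_le_ofReal (hin s t hst)
      calc _ ≤ g s * (g t * (ENNReal.ofReal κ * rieszKer (2 / q) (s - t))) := by
            rw [mul_left_comm]
            gcongr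
            · exact hnorme _
            · exact hnorme _
        _ = _ := by ring
    · refine le_trans (le_of_eq ?_) (mul_le_mul_right (hls g g hg hg) _)
      have hk : ∀ t, Measurable fun s => rieszKer (2 / q) (t - s) := fun t =>
        (measurable_rieszKer _).comp (measurable_const.sub measurable_id)
      rw [← lintegral_const_mul']
      · refine lintegral_congr fun s => ?_
        rw [lintegral_const_mul' _ _ ENNReal.ofReal_ne_top, lintegral_const_mul' _ _ (hgtop s)]
      · exact ENNReal.ofReal_ne_top
  have h3 : ‖∫ t, Θ t‖ₑ ≤ ENNReal.ofReal (√C * √κ) * (∫⁻ t, g t ^ q') ^ (1 / q') := by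
    refine (ENNReal.pow_le_pow_left_iff two_ne_zero).1 (h2.trans (le_of_eq ?_))
    rw [mul_pow, ← ENNReal.ofReal_pow (by positivity), mul_pow, Real.sq_sqrt hC.le,
      Real.sq_sqrt hκ, ENNReal.ofReal_mul hC.le]
    ring
  calc _ ≤ ‖w‖ₑ * ‖∫ t, Θ t‖ₑ := h1
    _ ≤ ‖w‖ₑ * (ENNReal.ofReal (√C * √κ) * (∫⁻ t, g t ^ q') ^ (1 / q')) := by gcongr
    _ = _ := by ring

/-- A selection `Ψ_N(t)` among `Φ_0(t), …, Φ_N(t)` that maximizes `|⟨Ψ_N(t), w⟩|`. -/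
def maxSelect {H : Type*} [NormedAddCommGroup H] [InnerProductSpace ℂ H] (Φ : ℕ → ℝ → H) (w : H) :
    ℕ → ℝ → H
  | 0 => Φ 0
  | N + 1 => fun t =>
      if ‖inner ℂ (maxSelect Φ w N t) w‖ < ‖inner ℂ (Φ (N + 1) t) w‖ then Φ (N + 1) t
      else maxSelect Φ w N t

section MaxSelect

variable {H : Type*} [NormedAddCommGroup H] [InnerProductSpace ℂ H] (Φ : ℕ → ℝ → H) (w : H)

theorem maxSelect_mem (N : ℕ) (t : ℝ) : ∃ n ≤ N, maxSelect Φ w N t = Φ n t := by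
  induction N with
  | zero => exact ⟨0, le_rfl, rfl⟩
  | succ N ih =>
    simp only [maxSelect]
    split_ifs
    · exact ⟨N + 1, le_rfl, rfl⟩
    · obtain ⟨n, hn, h⟩ := ih
      exact ⟨n, by omega, h⟩

theorem stronglyMeasurable_maxSelect (hΦ : ∀ n, StronglyMeasurable (Φ n)) (N : ℕ) :
    StronglyMeasurable (maxSelect Φ w N) := by
  induction N with
  | zero => exact hΦ 0
  | succ N ih =>
    refine StronglyMeasurable.ite ?_ (hΦ _) ih
    exact measurableSet_lt (ih.inner stronglyMeasurable_const).norm.measurable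
      ((hΦ _).inner stronglyMeasurable_const).norm.measurable

theorem norm_inner_maxSelect_le_succ (N : ℕ) (t : ℝ) :
    ‖inner ℂ (maxSelect Φ w N t) w‖ ≤ ‖inner ℂ (maxSelect Φ w (N + 1) t) w‖ := by
  simp only [maxSelect]
  split_ifs with h
  · exact h.le
  · exact le_rfl

theorem norm_inner_le_maxSelect (N : ℕ) (t : ℝ) :
    ‖inner ℂ (Φ N t) w‖ ≤ ‖inner ℂ (maxSelect Φ w N t) w‖ := by
  cases N with
  | zero => exact le_rfl
  | succ N =>
    simp only [maxSelect]
    split_ifs with h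
    · exact le_rfl
    · exact not_lt.1 h

end MaxSelect

/-- Maximal version of the `T T*` estimate. -/
theorem lintegral_iSup_inner_rpow_le_of_inner_le {H : Type*} [NormedAddCommGroup H]
    [InnerProductSpace ℂ H] [CompleteSpace H] {q : ℝ} (hq : 2 < q) :
    ∃ C : ℝ, 0 < C ∧ ∀ (κ : ℝ) (B : ℕ → ℝ) (Φ : ℕ → ℝ → H), 0 ≤ κ →
      (∀ n, StronglyMeasurable (Φ n)) → (∀ n t, ‖Φ n t‖ ≤ B n) →
      (∀ n m s t, s ≠ t → ‖inner ℂ (Φ n s) (Φ m t)‖ ≤ κ * |t - s| ^ (-(2 / q))) → ∀ w : H,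
      (∫⁻ t, (⨆ n, ‖inner ℂ (Φ n t) w‖ₑ) ^ q) ^ (1 / q) ≤ ENNReal.ofReal (C * √κ) * ‖w‖ₑ := by
  obtain ⟨C, hC, H⟩ := lintegral_inner_rpow_le_of_inner_le (H := H) hq
  have hq0 : 0 < q := by linarith
  refine ⟨C, hC, fun κ B Φ hκ hΦ hB hin w => ?_⟩
  have hΨm := stronglyMeasurable_maxSelect Φ w hΦ
  have hN : ∀ N, (∫⁻ t, ‖inner ℂ (maxSelect Φ w N t) w‖ₑ ^ q) ^ (1 / q) ≤
      ENNReal.ofReal (C * √κ) * ‖w‖ₑ := by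
    intro N
    -- The selected family inherits the decay because the hypothesis covers all pairs `n`, `m`. Its
    -- norm bound may grow with `N`, as the constant does not see it.
    refine H κ (∑ n ∈ Finset.range (N + 1), |B n|) _ hκ (hΨm N) (fun t => ?_)
      (fun s t hst => ?_) w
    · obtain ⟨n, hn, h⟩ := maxSelect_mem Φ w N t
      rw [h]
      exact ((hB n t).trans (le_abs_self _)).trans (Finset.single_le_sum (f := fun n => |B n|)
        (fun _ _ => abs_nonneg _) (Finset.mem_range.2 (by omega)))
    · obtain ⟨n, -, h⟩ := maxSelect_mem Φ w N t
      obtain ⟨m, -, h'⟩ := maxSelect_mem Φ w N s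
      rw [h, h']
      exact hin m n s t hst
  have hmono : Monotone fun N t => ‖inner ℂ (maxSelect Φ w N t) w‖ₑ ^ q := by
    refine monotone_nat_of_le_succ fun N t => ?_
    refine ENNReal.rpow_le_rpow ?_ hq0.le
    rw [← ofReal_norm, ← ofReal_norm]
    exact ENNReal.ofReal_le_ofReal (norm_inner_maxSelect_le_succ Φ w N t)
  have hle : ∀ t, (⨆ n, ‖inner ℂ (Φ n t) w‖ₑ) ^ q ≤
      ⨆ N, ‖inner ℂ (maxSelect Φ w N t) w‖ₑ ^ q := by
    intro t
    rw [ENNReal.monotone_rpow_of_nonneg hq0.le |>.map_iSup_of_continuousAt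
      ENNReal.continuous_rpow_const.continuousAt (by simp [hq0])]
    refine iSup_mono fun n => ENNReal.rpow_le_rpow ?_ hq0.le
    rw [← ofReal_norm, ← ofReal_norm]
    exact ENNReal.ofReal_le_ofReal (norm_inner_le_maxSelect Φ w n t)
  set D := ENNReal.ofReal (C * √κ) * ‖w‖ₑ
  have : ∫⁻ t, (⨆ n, ‖inner ℂ (Φ n t) w‖ₑ) ^ q ≤ D ^ q := by
    refine (lintegral_mono hle).trans ?_
    rw [lintegral_iSup (fun N => ?_) hmono]
    · refine iSup_le fun N => ?_
      have := ENNReal.rpow_le_rpow (hN N) hq0.le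
      rwa [← ENNReal.rpow_mul, one_div, inv_mul_cancel₀ hq0.ne', ENNReal.rpow_one] at this
    · exact ((hΨm N).inner stronglyMeasurable_const).measurable.enorm.pow_const q
  have := ENNReal.rpow_le_rpow this (by positivity : 0 ≤ 1 / q)
  rwa [← ENNReal.rpow_mul, mul_one_div_cancel hq0.ne', ENNReal.rpow_one] at this

/-! ### Norms over subsets of the line -/

/-- The `L^q` norm over the set `S ⊆ ℝ` of an extended nonnegative function. -/
def lnorm (q : ℝ) (S : Set ℝ) (f : ℝ → ℝ≥0∞) : ℝ≥0∞ := (∫⁻ t in S, f t ^ q) ^ (1 / q)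

theorem lnorm_rpow {q : ℝ} (hq : 0 < q) (S : Set ℝ) (f : ℝ → ℝ≥0∞) :
    lnorm q S f ^ q = ∫⁻ t in S, f t ^ q := by
  rw [lnorm, ← ENNReal.rpow_mul, one_div, inv_mul_cancel₀ hq.ne', ENNReal.rpow_one]

theorem lnorm_mono_set {q : ℝ} (hq : 0 < q) {S T : Set ℝ} (h : S ⊆ T) (f : ℝ → ℝ≥0∞) :
    lnorm q S f ≤ lnorm q T f :=
  ENNReal.rpow_le_rpow (lintegral_mono_set h) (by positivity)

theorem lnorm_mono_ae {q : ℝ} (hq : 0 < q) {S : Set ℝ} {f g : ℝ → ℝ≥0∞}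
    (h : ∀ᵐ t ∂volume.restrict S, f t ≤ g t) : lnorm q S f ≤ lnorm q S g := by
  refine ENNReal.rpow_le_rpow (lintegral_mono_ae ?_) (by positivity)
  filter_upwards [h] with t ht using ENNReal.rpow_le_rpow ht hq.le

theorem lnorm_add_le {q : ℝ} (hq : 1 ≤ q) {S : Set ℝ} {f g : ℝ → ℝ≥0∞}
    (hf : AEMeasurable f (volume.restrict S)) (hg : AEMeasurable g (volume.restrict S)) :
    lnorm q S (fun t => f t + g t) ≤ lnorm q S f + lnorm q S g :=
  ENNReal.lintegral_Lp_add_le hf hg hq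

theorem lnorm_const_mul {q : ℝ} (hq : 0 < q) (S : Set ℝ) {c : ℝ≥0∞} (hc : c ≠ ⊤)
    (f : ℝ → ℝ≥0∞) : lnorm q S (fun t => c * f t) = c * lnorm q S f := by
  unfold lnorm
  simp_rw [ENNReal.mul_rpow_of_nonneg _ _ hq.le]
  rw [lintegral_const_mul' _ _ (ENNReal.rpow_ne_top_of_nonneg hq.le hc),
    ENNReal.mul_rpow_of_nonneg _ _ (by positivity), ← ENNReal.rpow_mul, mul_one_div_cancel hq.ne',
    ENNReal.rpow_one]

theorem lnorm_union_le {q : ℝ} (hq : 1 ≤ q) (S T : Set ℝ) (f : ℝ → ℝ≥0∞) :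
    lnorm q (S ∪ T) f ≤ lnorm q S f + lnorm q T f := by
  have hq0 : 0 < q := by linarith
  have h1 : 0 ≤ 1 / q := by positivity
  have h2 : 1 / q ≤ 1 := by rw [div_le_one hq0]; exact hq
  exact (ENNReal.rpow_le_rpow (lintegral_union_le _ _ _) h1).trans
    (ENNReal.rpow_add_le_add_rpow _ _ h1 h2)

theorem lnorm_indicator {q : ℝ} (hq : 0 < q) {S : Set ℝ} (hS : MeasurableSet S)
    (f : ℝ → ℝ≥0∞) : (∫⁻ t, (S.indicator f t) ^ q) ^ (1 / q) = lnorm q S f := by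
  unfold lnorm
  rw [← lintegral_indicator hS]
  congr 2
  funext t
  by_cases h : t ∈ S <;> simp [h, hq]

/-- Hölder's inequality for the product `k^p m`. -/
theorem lnorm_rpow_mul_le {p q : ℝ} (hp : 0 < p) (hq : 0 < q) {S : Set ℝ} {k m : ℝ → ℝ≥0∞}
    (hk : AEMeasurable k (volume.restrict S)) (hm : AEMeasurable m (volume.restrict S)) :
    lnorm (q / (p + 1)) S (fun t => k t ^ p * m t) ≤ lnorm q S k ^ p * lnorm q S m := by
  have hp1 : 0 < p + 1 := by linarith
  have hα : 0 < q / (p + 1) := by positivity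
  calc lnorm (q / (p + 1)) S (fun t => k t ^ p * m t)
      = (∫⁻ t in S, (k t ^ q) ^ (p / (p + 1)) * (m t ^ q) ^ (1 / (p + 1))) ^
          (1 / (q / (p + 1))) := by
        unfold lnorm
        congr 2
        funext t
        rw [ENNReal.mul_rpow_of_nonneg _ _ hα.le, ← ENNReal.rpow_mul, ← ENNReal.rpow_mul,
          ← ENNReal.rpow_mul]
        congr 2 <;> field_simp
    _ ≤ ((∫⁻ t in S, k t ^ q) ^ (p / (p + 1)) * (∫⁻ t in S, m t ^ q) ^ (1 / (p + 1))) ^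
          (1 / (q / (p + 1))) := by
        gcongr
        exact ENNReal.lintegral_mul_norm_pow_le (hk.pow_const q) (hm.pow_const q) (by positivity)
          (by positivity) (by field_simp)
    _ = _ := by
        unfold lnorm
        rw [ENNReal.mul_rpow_of_nonneg _ _ (by positivity), ← ENNReal.rpow_mul,
          ← ENNReal.rpow_mul, ← ENNReal.rpow_mul]
        congr 2 <;> field_simp

/-- Continuity of integrals over expanding intervals. -/
theorem continuous_lintegral_inter_Icc {S : Set ℝ} {f : ℝ → ℝ≥0∞} (t₀ : ℝ)
    (hf : AEMeasurable f (volume.restrict S))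
    (hfin : ∀ τ, ∫⁻ t in S ∩ Set.Icc (t₀ - τ) (t₀ + τ), f t ≠ ⊤) :
    Continuous fun τ => ∫⁻ t in S ∩ Set.Icc (t₀ - τ) (t₀ + τ), f t := by
  have hrw : ∀ τ, ∫⁻ t in S ∩ Set.Icc (t₀ - τ) (t₀ + τ), f t =
      ∫⁻ t in S, (Set.Icc (t₀ - τ) (t₀ + τ)).indicator f t := by
    intro τ
    rw [lintegral_indicator measurableSet_Icc, Measure.restrict_restrict measurableSet_Icc,
      Set.inter_comm]
  rw [continuous_iff_continuousAt]
  intro τ₀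
  unfold ContinuousAt
  simp_rw [hrw]
  refine tendsto_lintegral_filter_of_dominated_convergence'
    ((Set.Icc (t₀ - (τ₀ + 1)) (t₀ + (τ₀ + 1))).indicator f) ?_ ?_ ?_ ?_
  · exact Eventually.of_forall fun τ => hf.indicator measurableSet_Icc
  · filter_upwards [Iio_mem_nhds (lt_add_one τ₀)] with τ hτ
    refine Eventually.of_forall fun t => ?_
    refine Set.indicator_le_indicator_of_subset ?_ (fun _ => zero_le) t
    have : τ < τ₀ + 1 := hτ
    exact Set.Icc_subset_Icc (by linarith) (by linarith)
  · rw [← hrw]; exact hfin _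
  · have hae : ∀ᵐ t ∂volume.restrict S, t ≠ t₀ - τ₀ ∧ t ≠ t₀ + τ₀ := by
      refine ae_restrict_of_ae ?_
      refine Filter.Eventually.and ?_ ?_ <;> simp [ae_iff]
    filter_upwards [hae] with t ht
    refine tendsto_const_nhds.congr' ?_
    by_cases hin : |t - t₀| < τ₀
    · filter_upwards [lt_mem_nhds hin] with τ hτ
      have h1 := abs_lt.1 hin
      have h2 := abs_lt.1 hτ
      rw [Set.indicator_of_mem, Set.indicator_of_mem]
      · exact ⟨by linarith, by linarith⟩
      · exact ⟨by linarith, by linarith⟩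
    · have hout : τ₀ < |t - t₀| := by
        refine lt_of_le_of_ne (not_lt.1 hin) fun h => ?_
        rcases abs_choice (t - t₀) with h' | h' <;> rw [h'] at h
        · exact ht.2 (by linarith)
        · exact ht.1 (by linarith)
      have key : ∀ τ < |t - t₀|, t ∉ Set.Icc (t₀ - τ) (t₀ + τ) := by
        intro τ hτ h
        have : |t - t₀| ≤ τ := abs_le.2 ⟨by linarith [h.1], by linarith [h.2]⟩
        linarith
      filter_upwards [gt_mem_nhds hout] with τ hτ
      rw [Set.indicator_of_notMem (key _ hout), Set.indicator_of_notMem (key _ hτ)]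

/-! ### The scalar stability argument -/

/-- The scalar inequalities satisfied by the norms `m = ‖u - v‖`, `n = ‖v‖`, `g = ‖F(u) - F(v)‖`
at fixed times, where `e` is the norm of the error and `h` that of the free evolution of the
difference of the data. -/
structure ScalarData (p q γ κ A L B ε : ℝ) (I : Set ℝ) (t₀ : ℝ)
    (m n g e h : ℝ → ℝ≥0∞) : Prop where
  ordConnected : I.OrdConnected
  mem : t₀ ∈ I
  measurable_m : AEMeasurable m (volume.restrict I)
  measurable_n : AEMeasurable n (volume.restrict I)
  measurable_g : AEMeasurable g (volume.restrict I)
  measurable_e : AEMeasurable e (volume.restrict I)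
  measurable_h : AEMeasurable h (volume.restrict I)
  duhamel : ∀ᵐ t ∂volume.restrict I,
    m t ≤ h t + ENNReal.ofReal κ * ∫⁻ s in Set.uIoc t₀ t, (g s + e s) * rieszKer γ (t - s)
  nonlinear : ∀ᵐ t ∂volume.restrict I, g t ≤ ENNReal.ofReal A * ((n t + m t) ^ p * m t)
  norm_n : lnorm q I n ≤ ENNReal.ofReal L
  finite : ∀ τ, lnorm q (I ∩ Set.Icc (t₀ - τ) (t₀ + τ)) m ≠ ⊤
  norm_h : lnorm q I h ≤ ENNReal.ofReal (B * ε)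
  norm_e : lnorm (q / (p + 1)) I e ≤ ENNReal.ofReal ε

namespace ScalarData

variable {p q γ κ A L B ε : ℝ} {I : Set ℝ} {t₀ : ℝ} {m n g e h : ℝ → ℝ≥0∞}

/-- Hölder's inequality in time for `(n+m)^p m`. One factor of `m` keeps its own norm, to be
absorbed or to carry the smallness. -/
theorem lnorm_g_le (D : ScalarData p q γ κ A L B ε I t₀ m n g e h) (hp : 0 < p) (hq : 1 ≤ q)
    {S : Set ℝ} (hS : S ⊆ I) {x y : ℝ} (hx : 0 ≤ x) (hA : 0 ≤ A)
    (hn : lnorm q S n ≤ ENNReal.ofReal x) (hy : 0 ≤ y) (hm : lnorm q S m ≤ ENNReal.ofReal y) :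
    lnorm (q / (p + 1)) S g ≤ ENNReal.ofReal (A * (x + y) ^ p) * lnorm q S m := by
  have hq0 : 0 < q := by linarith
  have hα : 0 < q / (p + 1) := by positivity
  have hmS := D.measurable_m.mono_set hS
  have hnS := D.measurable_n.mono_set hS
  calc lnorm (q / (p + 1)) S g
      ≤ lnorm (q / (p + 1)) S (fun t => ENNReal.ofReal A * ((n t + m t) ^ p * m t)) :=
        lnorm_mono_ae hα (ae_restrict_of_ae_restrict_of_subset hS D.nonlinear)
    _ = ENNReal.ofReal A * lnorm (q / (p + 1)) S (fun t => (n t + m t) ^ p * m t) :=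
        lnorm_const_mul hα _ ENNReal.ofReal_ne_top _
    _ ≤ ENNReal.ofReal A * (lnorm q S (fun t => n t + m t) ^ p * lnorm q S m) := by
        gcongr
        exact lnorm_rpow_mul_le hp hq0 (hnS.add hmS) hmS
    _ ≤ ENNReal.ofReal A * ((ENNReal.ofReal x + ENNReal.ofReal y) ^ p * lnorm q S m) := by
        gcongr
        exact (lnorm_add_le hq hnS hmS).trans (add_le_add hn hm)
    _ = _ := by
        rw [← ENNReal.ofReal_add hx hy, ENNReal.ofReal_rpow_of_nonneg (by positivity) hp.le,
          ← mul_assoc, ← ENNReal.ofReal_mul hA]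

/-- One step of the bootstrap: the bound on `m` is propagated over a set of times on which the
norm of `n` is small. -/
theorem extend (D : ScalarData p q γ κ A L B ε I t₀ m n g e h) (hp : 0 < p) (hq : 1 ≤ q)
    (hα : 1 ≤ q / (p + 1)) (hA : 0 ≤ A) (hκ : 0 ≤ κ) (hL : 0 ≤ L) (hB : 0 ≤ B) (hε : 0 < ε)
    {K : ℝ} (hK : 0 ≤ K)
    (hls : ∀ f : ℝ → ℝ≥0∞, AEMeasurable f →
      (∫⁻ t, (∫⁻ s, f s * rieszKer γ (t - s)) ^ q) ^ (1 / q) ≤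
        ENNReal.ofReal K * (∫⁻ s, f s ^ (q / (p + 1))) ^ (1 / (q / (p + 1))))
    {η : ℝ} (hη : 0 < η) (hη2 : κ * K * (A * (η + η) ^ p) ≤ 1 / 2)
    {M c τ' τ : ℝ} (hM : 0 ≤ M) (hMε : M * ε ≤ 1)
    (hc : c = 2 * (B + κ * K + κ * K * (A * (L + 1) ^ p * M))) (hcη : c * ε < η)
    (hτ' : τ' ≤ τ)
    (hm : lnorm q (I ∩ Set.Icc (t₀ - τ') (t₀ + τ')) m ≤ ENNReal.ofReal (M * ε))
    (hn : lnorm q ((I \ Set.Icc (t₀ - τ') (t₀ + τ')) ∩ Set.Icc (t₀ - τ) (t₀ + τ)) n ≤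
      ENNReal.ofReal η) :
    lnorm q (I ∩ Set.Icc (t₀ - τ) (t₀ + τ)) m ≤ ENNReal.ofReal ((M + c) * ε) := by
  have hq0 : 0 < q := by linarith
  have hα0 : 0 < q / (p + 1) := by positivity
  have hc0 : 0 ≤ c := by rw [hc]; positivity
  set J : ℝ → Set ℝ := fun σ => I ∩ Set.Icc (t₀ - σ) (t₀ + σ) with hJ
  set S : ℝ → Set ℝ := fun σ => (I \ Set.Icc (t₀ - τ') (t₀ + τ')) ∩ Set.Icc (t₀ - σ) (t₀ + σ)
    with hS
  have hIm : MeasurableSet I := D.ordConnected.measurableSet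
  have hJm : ∀ σ, MeasurableSet (J σ) := fun σ => hIm.inter measurableSet_Icc
  have hJI : ∀ σ, J σ ⊆ I := fun σ => Set.inter_subset_left
  have hSI : ∀ σ, S σ ⊆ I := fun σ => Set.inter_subset_left.trans Set.sdiff_subset
  have hSJ : ∀ σ, S σ ⊆ J σ := fun σ t ht => ⟨hSI σ ht, ht.2⟩
  have hJS : ∀ σ, J σ ⊆ J τ' ∪ S σ := by
    intro σ t ht
    by_cases h' : t ∈ Set.Icc (t₀ - τ') (t₀ + τ')
    · exact Or.inl ⟨ht.1, h'⟩
    · exact Or.inr ⟨⟨ht.1, h'⟩, ht.2⟩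
  have hnJ : ∀ σ, lnorm q (J σ) n ≤ ENNReal.ofReal L := fun σ =>
    (lnorm_mono_set hq0 (hJI σ) n).trans D.norm_n
  have hgJ' : lnorm (q / (p + 1)) (J τ') g ≤ ENNReal.ofReal (A * (L + 1) ^ p * (M * ε)) := by
    refine (D.lnorm_g_le hp hq (hJI τ') hL hA (hnJ τ') zero_le_one
      (hm.trans (ENNReal.ofReal_le_ofReal hMε))).trans ?_
    rw [ENNReal.ofReal_mul (p := A * (L + 1) ^ p) (by positivity)]
    exact mul_le_mul_right hm _
  -- The bootstrap implication: on the shell `S σ`, the a priori bound `η` improves to `c ε < η`.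
  have core : ∀ σ ≤ τ, lnorm q (S σ) m ≤ ENNReal.ofReal η →
      lnorm q (S σ) m ≤ ENNReal.ofReal (c * ε) := by
    intro σ hσ hX
    have hnS : lnorm q (S σ) n ≤ ENNReal.ofReal η := by
      refine (lnorm_mono_set hq0 ?_ n).trans hn
      exact Set.inter_subset_inter_right _ (Set.Icc_subset_Icc (by linarith) (by linarith))
    have hgS := D.lnorm_g_le hp hq (hSI σ) hη.le hA hnS hη.le hX
    have hge : lnorm (q / (p + 1)) (J σ) (fun s => g s + e s) ≤
        ENNReal.ofReal (A * (L + 1) ^ p * (M * ε)) +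
          ENNReal.ofReal (A * (η + η) ^ p) * lnorm q (S σ) m + ENNReal.ofReal ε := by
      refine (lnorm_add_le hα (D.measurable_g.mono_set (hJI σ))
        (D.measurable_e.mono_set (hJI σ))).trans (add_le_add ?_ ?_)
      · exact ((lnorm_mono_set hα0 (hJS σ) g).trans (lnorm_union_le hα _ _ _)).trans
          (add_le_add hgJ' hgS)
      · exact (lnorm_mono_set hα0 (hJI σ) e).trans D.norm_e
    set f : ℝ → ℝ≥0∞ := (J σ).indicator (fun s => g s + e s) with hf
    have hfm : AEMeasurable f :=
      (aemeasurable_indicator_iff (hJm σ)).2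
        ((D.measurable_g.add D.measurable_e).mono_set (hJI σ))
    have hT := hls f hfm
    rw [hf, lnorm_indicator hα0 (hJm σ), ← hf] at hT
    -- For `t` in the shell the Duhamel integral sees only times in `J σ`, an interval containing
    -- `t₀`; this allows the source to be cut off to `J σ`.
    have hmain : ∀ᵐ t ∂volume.restrict (S σ),
        m t ≤ h t + ENNReal.ofReal κ * ∫⁻ s, f s * rieszKer γ (t - s) := by
      filter_upwards [ae_restrict_of_ae_restrict_of_subset (hSI σ) D.duhamel,
        ae_restrict_mem ((hIm.diff measurableSet_Icc).inter measurableSet_Icc)] with t ht htS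
      refine ht.trans (add_le_add le_rfl (mul_le_mul_right ?_ _))
      rw [← lintegral_indicator measurableSet_uIoc]
      refine lintegral_mono fun s => ?_
      by_cases hs : s ∈ Set.uIoc t₀ t
      · have hsI : s ∈ I := D.ordConnected.uIcc_subset D.mem (hSI σ htS) (Set.uIoc_subset_uIcc hs)
        have hsJ : s ∈ J σ := by
          refine ⟨hsI, ?_⟩
          have h1 := htS.2
          have hσ0 : 0 ≤ σ := by linarith [h1.1, h1.2]
          exact (Set.ordConnected_Icc.uIcc_subset ⟨by linarith, by linarith⟩ h1)
            (Set.uIoc_subset_uIcc hs)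
        rw [Set.indicator_of_mem hs, hf, Set.indicator_of_mem hsJ]
      · rw [Set.indicator_of_notMem hs]; exact zero_le
    have hTm : AEMeasurable (fun t => ∫⁻ s, f s * rieszKer γ (t - s)) := by
      have : AEMeasurable (fun z : ℝ × ℝ => f z.2 * rieszKer γ (z.1 - z.2))
          (volume.prod volume) :=
        hfm.comp_snd.mul
          ((measurable_rieszKer γ).comp (measurable_fst.sub measurable_snd)).aemeasurable
      exact this.lintegral_prod_right'
    have hX1 : lnorm q (S σ) m ≤ ENNReal.ofReal (B * ε) + ENNReal.ofReal κ *
        (ENNReal.ofReal K * (ENNReal.ofReal (A * (L + 1) ^ p * (M * ε)) +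
          ENNReal.ofReal (A * (η + η) ^ p) * lnorm q (S σ) m + ENNReal.ofReal ε)) := by
      refine (lnorm_mono_ae hq0 hmain).trans ?_
      refine (lnorm_add_le hq (D.measurable_h.mono_set (hSI σ))
        ((hTm.restrict).const_mul _)).trans (add_le_add ?_ ?_)
      · exact (lnorm_mono_set hq0 (hSI σ) h).trans D.norm_h
      · rw [lnorm_const_mul hq0 _ ENNReal.ofReal_ne_top]
        gcongr
        refine le_trans ?_ (hT.trans (mul_le_mul_right hge _))
        refine (lnorm_mono_set hq0 (Set.subset_univ _) _).trans ?_
        rw [lnorm, Measure.restrict_univ]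
    have hXtop : lnorm q (S σ) m ≠ ⊤ := ne_top_of_le_ne_top ENNReal.ofReal_ne_top hX
    set x := (lnorm q (S σ) m).toReal with hx
    have hxe : lnorm q (S σ) m = ENNReal.ofReal x := (ENNReal.ofReal_toReal hXtop).symm
    have hx0 : 0 ≤ x := ENNReal.toReal_nonneg
    rw [hxe] at hX1 ⊢
    rw [← ENNReal.ofReal_mul (by positivity), ← ENNReal.ofReal_add (by positivity) (by positivity),
      ← ENNReal.ofReal_add (by positivity) (by positivity), ← ENNReal.ofReal_mul (by positivity),
      ← ENNReal.ofReal_mul (by positivity), ← ENNReal.ofReal_add (by positivity) (by positivity),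
      ENNReal.ofReal_le_ofReal_iff (by positivity)] at hX1
    refine ENNReal.ofReal_le_ofReal ?_
    -- By the choice of `η` the shell contributes at most half of its own norm, which moves to the
    -- left side; this is the factor `2` in `c`.
    have h1 : κ * K * (A * (η + η) ^ p) * x ≤ 1 / 2 * x := by gcongr
    have h2 : c * ε = 2 * (B * ε + κ * K * ε + κ * K * (A * (L + 1) ^ p * (M * ε))) := by
      rw [hc]; ring
    rw [h2]
    linarith
  have hfinS : ∀ σ, ∫⁻ t in S σ, m t ^ q ≠ ⊤ := by
    intro σ
    rw [← lnorm_rpow hq0]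
    exact ENNReal.rpow_ne_top_of_nonneg hq0.le
      (ne_top_of_le_ne_top (D.finite σ) (lnorm_mono_set hq0 (hSJ σ) m))
  have hcont : Continuous fun σ => lnorm q (S σ) m := by
    unfold lnorm
    refine ENNReal.continuous_rpow_const.comp ?_
    exact continuous_lintegral_inter_Icc t₀
      ((D.measurable_m.mono_set Set.sdiff_subset).pow_const q) hfinS
  have hS0 : lnorm q (S τ') m = 0 := by
    have : S τ' = ∅ := by
      ext t
      simp only [hS, Set.mem_inter_iff, Set.mem_sdiff, Set.mem_empty_iff_false, iff_false]
      tauto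
    rw [this, lnorm]
    simp [hq0]
  -- Were the bound to fail, the norm, which is `0` at `τ'` and continuous in `σ`, would take the
  -- value `min η (lnorm q (S τ) m)`. This lies above `c ε` and does not exceed `η`, against `core`.
  have hfinal : lnorm q (S τ) m ≤ ENNReal.ofReal (c * ε) := by
    by_contra! hlt
    have hlt2 : ENNReal.ofReal (c * ε) < min (ENNReal.ofReal η) (lnorm q (S τ) m) :=
      lt_min ((ENNReal.ofReal_lt_ofReal_iff hη).2 hcη) hlt
    obtain ⟨σ, hσ, hσe⟩ := intermediate_value_Icc hτ' hcont.continuousOn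
      (show min (ENNReal.ofReal η) (lnorm q (S τ) m) ∈ Set.Icc _ _ from
        ⟨by simp only [hS0]; exact zero_le, min_le_right _ _⟩)
    have := core σ hσ.2 (hσe.le.trans (min_le_left _ _))
    simp only at hσe
    rw [hσe] at this
    exact absurd this (not_le.2 hlt2)
  calc lnorm q (J τ) m ≤ lnorm q (J τ') m + lnorm q (S τ) m :=
        (lnorm_mono_set hq0 (hJS τ) m).trans (lnorm_union_le hq _ _ _)
    _ ≤ ENNReal.ofReal (M * ε) + ENNReal.ofReal (c * ε) := add_le_add hm hfinal
    _ = _ := by rw [← ENNReal.ofReal_add (by positivity) (by positivity), add_mul]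

/-- The bounds on `m` over sets of times on which the norm of `n` is at most `N η`. -/
theorem lnorm_m_le (D : ScalarData p q γ κ A L B ε I t₀ m n g e h) (hp : 0 < p) (hq : 1 ≤ q)
    (hα : 1 ≤ q / (p + 1)) (hA : 0 ≤ A) (hκ : 0 ≤ κ) (hL : 0 ≤ L) (hB : 0 ≤ B) (hε : 0 < ε)
    {K : ℝ} (hK : 0 ≤ K)
    (hls : ∀ f : ℝ → ℝ≥0∞, AEMeasurable f →
      (∫⁻ t, (∫⁻ s, f s * rieszKer γ (t - s)) ^ q) ^ (1 / q) ≤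
        ENNReal.ofReal K * (∫⁻ s, f s ^ (q / (p + 1))) ^ (1 / (q / (p + 1))))
    {η : ℝ} (hη : 0 < η) (hη2 : κ * K * (A * (η + η) ^ p) ≤ 1 / 2)
    {M : ℕ → ℝ} (hM0 : M 0 = 0)
    (hM : ∀ N, M (N + 1) = M N + 2 * (B + κ * K + κ * K * (A * (L + 1) ^ p * M N)))
    (hMnn : ∀ N, 0 ≤ M N) (N : ℕ) (hMε : M (N + 1) * ε ≤ 1) (hMη : M (N + 1) * ε < η) (τ : ℝ)
    (hτ : 0 ≤ τ)
    (hn : ∫⁻ t in I ∩ Set.Icc (t₀ - τ) (t₀ + τ), n t ^ q ≤ N * ENNReal.ofReal η ^ q) :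
    lnorm q (I ∩ Set.Icc (t₀ - τ) (t₀ + τ)) m ≤ ENNReal.ofReal (M (N + 1) * ε) := by
  have hq0 : 0 < q := by linarith
  have hstep : ∀ N, M N ≤ M (N + 1) := by
    intro N
    have := hMnn N
    rw [hM]
    have : 0 ≤ 2 * (B + κ * K + κ * K * (A * (L + 1) ^ p * M N)) := by positivity
    linarith
  have hcle : ∀ N, 2 * (B + κ * K + κ * K * (A * (L + 1) ^ p * M N)) * ε ≤ M (N + 1) * ε := by
    intro N
    rw [hM]
    have := hMnn N
    gcongr
    linarith
  induction N generalizing τ with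
  | zero =>
    have h0 : ∫⁻ t in I ∩ Set.Icc (t₀ - τ) (t₀ + τ), n t ^ q = 0 := by simpa using hn
    rw [hM]
    -- Here `n` has norm `0` on the whole window, so one step from the null window `τ' = 0`
    -- suffices.
    refine D.extend hp hq hα hA hκ hL hB hε hK hls hη hη2 (hMnn 0) (by simp [hM0]) rfl
      ((hcle 0).trans_lt hMη) (τ' := 0) hτ ?_ ?_
    · have : (volume : Measure ℝ).restrict (I ∩ Set.Icc (t₀ - 0) (t₀ + 0)) = 0 := by
        rw [Measure.restrict_eq_zero]
        exact measure_mono_null Set.inter_subset_right (by simp)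
      rw [lnorm, this]
      simp [hq0]
    · refine (lnorm_mono_set hq0 (T := I ∩ Set.Icc (t₀ - τ) (t₀ + τ)) ?_ n).trans ?_
      · exact Set.inter_subset_inter_left _ Set.sdiff_subset
      · rw [lnorm, h0]
        simp [hq0]
  | succ N ih =>
    have hMε' : M (N + 1) * ε ≤ 1 :=
      (mul_le_mul_of_nonneg_right (hstep _) hε.le).trans hMε
    have hMη' : M (N + 1) * ε < η :=
      (mul_le_mul_of_nonneg_right (hstep _) hε.le).trans_lt hMη
    by_cases hcase : ∫⁻ t in I ∩ Set.Icc (t₀ - τ) (t₀ + τ), n t ^ q ≤ N * ENNReal.ofReal η ^ q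
    · exact (ih hMε' hMη' τ hτ hcase).trans
        (ENNReal.ofReal_le_ofReal (mul_le_mul_of_nonneg_right (hstep _) hε.le))
    have hfin : ∀ σ, ∫⁻ t in I ∩ Set.Icc (t₀ - σ) (t₀ + σ), n t ^ q ≠ ⊤ := by
      intro σ
      rw [← lnorm_rpow hq0]
      exact ENNReal.rpow_ne_top_of_nonneg hq0.le (ne_top_of_le_ne_top ENNReal.ofReal_ne_top
        ((lnorm_mono_set hq0 Set.inter_subset_left n).trans D.norm_n))
    have hcont := continuous_lintegral_inter_Icc t₀ (D.measurable_n.pow_const q) hfin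
    have h0 : ∫⁻ t in I ∩ Set.Icc (t₀ - 0) (t₀ + 0), n t ^ q = 0 := by
      refine setLIntegral_measure_zero _ _ (measure_mono_null Set.inter_subset_right (by simp))
    -- The smaller window is the one that carries exactly `N η^q`, so that at most `η^q` is left for
    -- the shell.
    obtain ⟨τ', hτ', hτe⟩ := intermediate_value_Icc hτ hcont.continuousOn
      (show (N : ℝ≥0∞) * ENNReal.ofReal η ^ q ∈ Set.Icc _ _ from
        ⟨by simp only [h0]; exact zero_le, (not_le.1 hcase).le⟩)
    simp only at hτe
    rw [hM (N + 1)]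
    refine D.extend hp hq hα hA hκ hL hB hε hK hls hη hη2 (hMnn _) hMε' rfl
      ((hcle _).trans_lt hMη) (τ' := τ') hτ'.2 (ih hMε' hMη' τ' hτ'.1 hτe.le) ?_
    have hsplit := lintegral_inter_add_sdiff (μ := volume) (fun t => n t ^ q)
      (I ∩ Set.Icc (t₀ - τ) (t₀ + τ)) (B := Set.Icc (t₀ - τ') (t₀ + τ')) measurableSet_Icc
    have e1 : I ∩ Set.Icc (t₀ - τ) (t₀ + τ) ∩ Set.Icc (t₀ - τ') (t₀ + τ') =
        I ∩ Set.Icc (t₀ - τ') (t₀ + τ') := by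
      rw [Set.inter_assoc]
      congr 1
      refine Set.inter_eq_right.2 (Set.Icc_subset_Icc ?_ ?_) <;> linarith [hτ'.2]
    have e2 : (I ∩ Set.Icc (t₀ - τ) (t₀ + τ)) \ Set.Icc (t₀ - τ') (t₀ + τ') =
        (I \ Set.Icc (t₀ - τ') (t₀ + τ')) ∩ Set.Icc (t₀ - τ) (t₀ + τ) := by
      ext t; simp only [Set.mem_sdiff, Set.mem_inter_iff]; tauto
    rw [e1, e2, hτe] at hsplit
    rw [← hsplit, Nat.cast_succ, add_mul, one_mul] at hn
    have hη' : ENNReal.ofReal η ^ q ≠ ⊤ :=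
      ENNReal.rpow_ne_top_of_nonneg hq0.le ENNReal.ofReal_ne_top
    have := (ENNReal.add_le_add_iff_left
      (ENNReal.mul_ne_top (ENNReal.natCast_ne_top N) hη')).1 hn
    have := ENNReal.rpow_le_rpow this (by positivity : 0 ≤ 1 / q)
    rwa [← ENNReal.rpow_mul, mul_one_div_cancel hq0.ne', ENNReal.rpow_one] at this

end ScalarData

theorem lintegral_le_of_forall_inter_Icc {I : Set ℝ} (t₀ : ℝ) (f : ℝ → ℝ≥0∞)
    {c : ℝ≥0∞} (h : ∀ τ, 0 ≤ τ → ∫⁻ t in I ∩ Set.Icc (t₀ - τ) (t₀ + τ), f t ≤ c) :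
    ∫⁻ t in I, f t ≤ c := by
  have hU : I = ⋃ k : ℕ, I ∩ Set.Icc (t₀ - k) (t₀ + k) := by
    rw [← Set.inter_iUnion]
    refine (Set.inter_eq_left.2 fun t _ => Set.mem_iUnion.2 ?_).symm
    obtain ⟨k, hk⟩ := exists_nat_ge |t - t₀|
    have := abs_le.1 hk
    exact ⟨k, by linarith, by linarith⟩
  have hmono : Monotone fun k : ℕ => I ∩ Set.Icc (t₀ - k) (t₀ + k) := by
    intro k l hkl
    have : (k : ℝ) ≤ l := by exact_mod_cast hkl
    exact Set.inter_subset_inter_right _ (Set.Icc_subset_Icc (by linarith) (by linarith))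
  rw [hU, setLIntegral_iUnion_of_directed _ hmono.directed_le]
  exact iSup_le fun k => h k (by positivity)

/-- Stability for the scalar inequalities. -/
theorem scalar_stability {p q γ κ A L B : ℝ} (hp : 0 < p) (hq : 1 < q) (hα : 1 < q / (p + 1))
    (hγ0 : 0 < γ) (hγ1 : γ < 1) (hγ : 1 / (q / (p + 1)) + γ = 1 + 1 / q) (hA : 0 ≤ A)
    (hκ : 0 ≤ κ) (hL : 0 ≤ L) (hB : 0 ≤ B) :
    ∃ ε₁ > (0 : ℝ), ∃ C > (0 : ℝ), ∀ (ε : ℝ) (I : Set ℝ) (t₀ : ℝ) (m n g e h : ℝ → ℝ≥0∞),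
      0 < ε → ε ≤ ε₁ → ScalarData p q γ κ A L B ε I t₀ m n g e h →
      lnorm q I m + lnorm (q / (p + 1)) I g ≤ ENNReal.ofReal (C * ε) := by
  obtain ⟨K, hK, hls⟩ := hls_operator hγ0 hγ1 hα hq hγ
  have hq0 : 0 < q := by linarith
  -- Chosen so that `(2η)^p = 1 / (2 (κ K A + 1))`; the added `1` covers `κ K A = 0`.
  set η : ℝ := (1 / (2 * (κ * K * A + 1))) ^ (1 / p) / 2 with hηdef
  have hbase : 0 < 1 / (2 * (κ * K * A + 1)) := by positivity
  have hη : 0 < η := by positivity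
  have hη2 : κ * K * (A * (η + η) ^ p) ≤ 1 / 2 := by
    have : (η + η) ^ p = 1 / (2 * (κ * K * A + 1)) := by
      rw [hηdef, add_halves, ← Real.rpow_mul hbase.le, one_div_mul_cancel hp.ne', Real.rpow_one]
    rw [this, ← mul_assoc, mul_one_div, div_le_div_iff₀ (by positivity) (by norm_num)]
    linarith
  -- `M N` is the accumulated constant after `N` steps: each step adds the `c` of
  -- `ScalarData.extend`.
  set M : ℕ → ℝ := fun N =>
    Nat.rec (motive := fun _ => ℝ) 0
      (fun _ x => x + 2 * (B + κ * K + κ * K * (A * (L + 1) ^ p * x))) N with hMdef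
  have hM0 : M 0 = 0 := rfl
  have hM : ∀ N, M (N + 1) = M N + 2 * (B + κ * K + κ * K * (A * (L + 1) ^ p * M N)) :=
    fun N => rfl
  have hMnn : ∀ N, 0 ≤ M N := by
    intro N
    induction N with
    | zero => exact hM0.ge
    | succ N ih => rw [hM]; positivity
  -- Since `L^q ≤ N η^q`, the induction over multiples of `η^q` covers every window with the same
  -- constant.
  obtain ⟨N, hN⟩ := exists_nat_ge ((L / η) ^ q)
  have hMN := hMnn (N + 1)
  set Z := M (N + 1) with hZ
  have hδ : 0 < min 1 (η / 2) := lt_min one_pos (by positivity)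
  -- The threshold keeps `Z ε` at most `1`, which bounds `m` in the nonlinear term, and strictly
  -- below `η`, as the bootstrap demands.
  refine ⟨min 1 (η / 2) / (Z + 1), by positivity, Z + A * (L + 1) ^ p * Z + 1, by positivity,
    fun ε I t₀ m n g e h hε hε₁ D => ?_⟩
  have hZε : Z * ε ≤ min 1 (η / 2) := by
    rw [le_div_iff₀ (by positivity)] at hε₁
    nlinarith
  have hZ1 : Z * ε ≤ 1 := hZε.trans (min_le_left _ _)
  have hZη : Z * ε < η := (hZε.trans (min_le_right _ _)).trans_lt (by linarith)
  have hmI : lnorm q I m ≤ ENNReal.ofReal (Z * ε) := by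
    have hall : ∀ τ, 0 ≤ τ → lnorm q (I ∩ Set.Icc (t₀ - τ) (t₀ + τ)) m ≤
        ENNReal.ofReal (Z * ε) := by
      intro τ hτ
      refine D.lnorm_m_le hp hq.le hα.le hA hκ hL hB hε hK.le hls hη hη2 hM0 hM hMnn N hZ1 hZη τ
        hτ ?_
      rw [← lnorm_rpow hq0]
      calc _ ≤ ENNReal.ofReal L ^ q := ENNReal.rpow_le_rpow
            ((lnorm_mono_set hq0 Set.inter_subset_left n).trans D.norm_n) hq0.le
        _ ≤ _ := by
            rw [ENNReal.ofReal_rpow_of_nonneg hL hq0.le, ENNReal.ofReal_rpow_of_nonneg hη.le hq0.le,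
              ← ENNReal.ofReal_natCast, ← ENNReal.ofReal_mul (by positivity)]
            refine ENNReal.ofReal_le_ofReal ?_
            rwa [Real.div_rpow hL hη.le, div_le_iff₀ (by positivity)] at hN
    have : ∫⁻ t in I, m t ^ q ≤ ENNReal.ofReal (Z * ε) ^ q := by
      refine lintegral_le_of_forall_inter_Icc t₀ _ fun τ hτ => ?_
      rw [← lnorm_rpow hq0]
      exact ENNReal.rpow_le_rpow (hall τ hτ) hq0.le
    rw [← lnorm_rpow hq0] at this
    exact (ENNReal.rpow_le_rpow_iff hq0).1 this
  have hgI : lnorm (q / (p + 1)) I g ≤ ENNReal.ofReal (A * (L + 1) ^ p * (Z * ε)) := by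
    refine (D.lnorm_g_le hp hq.le subset_rfl hL hA D.norm_n zero_le_one
      (hmI.trans (ENNReal.ofReal_le_ofReal hZ1))).trans ?_
    rw [ENNReal.ofReal_mul (p := A * (L + 1) ^ p) (by positivity)]
    exact mul_le_mul_right hmI _
  refine (add_le_add hmI hgI).trans ?_
  rw [← ENNReal.ofReal_add (by positivity) (by positivity)]
  refine ENNReal.ofReal_le_ofReal ?_
  nlinarith

/-! ### Duality with test functions -/

/-- Bounded functions with bounded support are boundedly approximated by test functions. -/
theorem exists_testFunction_approx {f : Plane → ℂ} (hf : Measurable f) {b R : ℝ}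
    (hb : ∀ x, ‖f x‖ ≤ b) (hR : ∀ x, x ∉ Metric.closedBall (0 : Plane) R → f x = 0) :
    ∃ g : ℕ → Plane → ℂ, (∀ n, ContDiff ℝ ∞ (g n)) ∧ (∀ n, HasCompactSupport (g n)) ∧
      (∀ n x, ‖g n x‖ ≤ b) ∧ (∀ n x, x ∉ Metric.closedBall (0 : Plane) (R + 1) → g n x = 0) ∧
      ∀ᵐ x, Tendsto (fun n => g n x) atTop (𝓝 (f x)) := by
  have hint : Integrable f := by
    refine (integrableOn_iff_integrable_of_support_subset
      (s := Metric.closedBall (0 : Plane) R) ?_).1 ?_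
    · intro x hx
      by_contra h
      exact hx (hR x h)
    · exact IntegrableOn.of_bound measure_closedBall_lt_top hf.aestronglyMeasurable b
        (Eventually.of_forall hb)
  -- The ratio of the radii is fixed at `2`, which gives almost everywhere convergence of the
  -- mollifications.
  let φ : ℕ → ContDiffBump (0 : Plane) := fun n =>
    ⟨1 / (2 * ((n : ℝ) + 1)), 1 / ((n : ℝ) + 1), by positivity, by
      apply one_div_lt_one_div_of_lt <;> [positivity; linarith [(Nat.cast_nonneg n : (0 : ℝ) ≤ n)]]⟩
  have hφ : ∀ n, (φ n).rOut = 1 / ((n : ℝ) + 1) := fun n => rfl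
  have hφi : ∀ n, (φ n).rIn = 1 / (2 * ((n : ℝ) + 1)) := fun n => rfl
  have hφ1 : ∀ n, (φ n).rOut ≤ 1 := fun n => by
    rw [hφ, div_le_one (by positivity)]; linarith [(Nat.cast_nonneg n : (0 : ℝ) ≤ n)]
  have hcf : HasCompactSupport f :=
    HasCompactSupport.intro (isCompact_closedBall (0 : Plane) R) hR
  refine ⟨fun n => MeasureTheory.convolution ((φ n).normed volume) f
    (ContinuousLinearMap.lsmul ℝ ℝ) volume, fun n => ?_, fun n => ?_, fun n x => ?_,
    fun n x hx => ?_, ?_⟩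
  · exact (φ n).hasCompactSupport_normed.contDiff_convolution_left _ (φ n).contDiff_normed
      hint.locallyIntegrable
  · exact (φ n).hasCompactSupport_normed.convolution _ hcf
  · simp only [MeasureTheory.convolution_def]
    calc _ ≤ ∫ t, (φ n).normed volume t * b := by
          refine norm_integral_le_of_norm_le ((φ n).integrable_normed.mul_const b)
            (Eventually.of_forall fun t => ?_)
          rw [ContinuousLinearMap.lsmul_apply, norm_smul,
            Real.norm_of_nonneg ((φ n).nonneg_normed t)]
          exact mul_le_mul_of_nonneg_left (hb _) ((φ n).nonneg_normed t)
      _ = b := by rw [integral_mul_const, (φ n).integral_normed, one_mul]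
  · by_contra hne
    have h1 := support_convolution_subset _ (Function.mem_support.2 hne)
    obtain ⟨y, hy, z, hz, hyz⟩ := Set.mem_add.1 h1
    rw [(φ n).support_normed_eq, mem_ball_zero_iff] at hy
    have hz' : z ∈ Metric.closedBall (0 : Plane) R := by
      by_contra h
      exact hz (hR z h)
    rw [mem_closedBall_zero_iff] at hz' hx
    refine hx ?_
    rw [← hyz]
    linarith [norm_add_le y z, hφ1 n]
  · refine ContDiffBump.ae_convolution_tendsto_right_of_locallyIntegrable (K := 2) ?_ ?_
      hint.locallyIntegrable
    · exact tendsto_one_div_add_atTop_nhds_zero_nat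
    · refine Eventually.of_forall fun n => ?_
      rw [hφ, hφi]
      field_simp
      exact le_rfl

/-- The extremal function `|w|^{r-2} w̄` is truncated to bounded `x` and bounded `w`, then
approximated by test functions. The limit is `X ≤ M X^{1/r'}` with `X` finite, although `w` is not
known to be in `L^r`. If `r < 2`, the zeros of `w` cause no harm because the factor `w̄` vanishes
there. -/
theorem setLIntegral_enorm_rpow_le_of_testFunction {r r' : ℝ} (hr : r.HolderConjugate r')
    {w : Plane → ℂ} (hwm : Measurable w) (hw : LocallyIntegrable w) {M : ℝ≥0∞} (hMtop : M ≠ ⊤)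
    (H : ∀ g : Plane → ℂ, ContDiff ℝ ∞ g → HasCompactSupport g →
      ‖∫ x, w x * g x‖ₑ ≤ M * eLpNorm g (ENNReal.ofReal r') volume) (N : ℕ) :
    ∫⁻ x in {x | ‖x‖ ≤ N ∧ ‖w x‖ ≤ N}, ‖w x‖ₑ ^ r ≤ M ^ r := by
  have hr0 := hr.pos
  have hr1 := hr.sub_one_pos
  have hr'0 := hr.symm.pos
  set E : Set Plane := {x | ‖x‖ ≤ N ∧ ‖w x‖ ≤ N} with hE
  have hEm : MeasurableSet E :=
    (measurableSet_le measurable_norm measurable_const).inter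
      (measurableSet_le hwm.norm measurable_const)
  set f : Plane → ℂ := E.indicator fun x => ((‖w x‖ ^ (r - 2) : ℝ) : ℂ) * (starRingEnd ℂ) (w x)
    with hf
  have hfm : Measurable f := by
    refine Measurable.indicator ?_ hEm
    have := hwm.norm
    have h2 : Measurable fun x => (starRingEnd ℂ) (w x) := Complex.continuous_conj.measurable.comp hwm
    exact ((Complex.continuous_ofReal.measurable.comp (this.pow_const (r - 2)))).mul h2
  have hfn : ∀ x ∈ E, ‖f x‖ = ‖w x‖ ^ (r - 1) := by
    intro x hx
    rw [hf, Set.indicator_of_mem hx, norm_mul, RCLike.norm_conj, Complex.norm_real,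
      Real.norm_of_nonneg (by positivity)]
    rcases eq_or_ne (w x) 0 with h0 | h0
    · simp [h0, hr1.ne']
    · rw [← Real.rpow_add_one (norm_ne_zero_iff.2 h0)]
      congr 1; ring
  have hwf : ∀ x, w x * f x = ((E.indicator (fun x => ‖w x‖ ^ r) x : ℝ) : ℂ) := by
    intro x
    by_cases hx : x ∈ E
    · rw [hf, Set.indicator_of_mem hx, Set.indicator_of_mem hx, mul_left_comm, Complex.mul_conj,
        Complex.normSq_eq_norm_sq, ← Complex.ofReal_mul]
      congr 1
      rcases eq_or_ne (w x) 0 with h0 | h0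
      · simp [h0, hr0.ne']
      · rw [← Real.rpow_add_natCast (norm_ne_zero_iff.2 h0)]
        congr 1; push_cast; ring
    · simp [hf, hx]
  have hfb : ∀ x, ‖f x‖ ≤ (N : ℝ) ^ (r - 1) := by
    intro x
    by_cases hx : x ∈ E
    · rw [hfn x hx]
      exact Real.rpow_le_rpow (norm_nonneg _) hx.2 hr1.le
    · rw [hf, Set.indicator_of_notMem hx, norm_zero]; positivity
  have hfR : ∀ x, x ∉ Metric.closedBall (0 : Plane) N → f x = 0 := by
    intro x hx
    refine Set.indicator_of_notMem (fun h => hx ?_) _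
    simpa using h.1
  obtain ⟨g, hgc, hgs, hgb, hgR, hgt⟩ := exists_testFunction_approx hfm hfb hfR
  set K := Metric.closedBall (0 : Plane) (N + 1) with hK
  have hKm : MeasurableSet K := measurableSet_closedBall
  have hwK : IntegrableOn w K := hw.integrableOn_isCompact (isCompact_closedBall _ _)
  set X := ∫⁻ x in E, ‖w x‖ₑ ^ r with hX
  have hXtop : X ≠ ⊤ := by
    refine ne_of_lt (lt_of_le_of_lt (b := ∫⁻ x in E, ENNReal.ofReal (N ^ r)) ?_ ?_)
    · refine setLIntegral_mono' hEm fun x hx => ?_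
      rw [← ofReal_norm, ENNReal.ofReal_rpow_of_nonneg (norm_nonneg _) hr0.le]
      exact ENNReal.ofReal_le_ofReal (Real.rpow_le_rpow (norm_nonneg _) hx.2 hr0.le)
    · rw [setLIntegral_const]
      refine ENNReal.mul_lt_top ENNReal.ofReal_lt_top ?_
      refine lt_of_le_of_lt (measure_mono ?_)
        (measure_closedBall_lt_top (x := (0 : Plane)) (r := N))
      intro x hx
      simpa using hx.1
  have lim1 : Tendsto (fun n => ‖∫ x, w x * g n x‖ₑ) atTop (𝓝 X) := by
    have hlim : Tendsto (fun n => ∫ x, w x * g n x) atTop (𝓝 (∫ x, w x * f x)) := by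
      refine tendsto_integral_of_dominated_convergence
        (K.indicator fun x => ‖w x‖ * (N : ℝ) ^ (r - 1)) (fun n => ?_) ?_ (fun n => ?_) ?_
      · exact hwm.aestronglyMeasurable.mul (hgc n).continuous.aestronglyMeasurable
      · rw [integrable_indicator_iff hKm]
        exact hwK.norm.mul_const _
      · refine Eventually.of_forall fun x => ?_
        by_cases hx : x ∈ K
        · rw [Set.indicator_of_mem hx, norm_mul]
          exact mul_le_mul_of_nonneg_left (hgb n x) (norm_nonneg _)
        · rw [Set.indicator_of_notMem hx, hgR n x hx, mul_zero, norm_zero]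
      · filter_upwards [hgt] with x hx using hx.const_mul _
    have hval : ‖∫ x, w x * f x‖ₑ = X := by
      simp_rw [hwf]
      rw [integral_complex_ofReal, ← ofReal_norm]
      have h0 : 0 ≤ ∫ x, E.indicator (fun x => ‖w x‖ ^ r) x :=
        integral_nonneg fun x => Set.indicator_nonneg (fun _ _ => by positivity) x
      rw [Complex.norm_real, Real.norm_eq_abs]
      rw [abs_of_nonneg h0, integral_indicator hEm,
        integral_eq_lintegral_of_nonneg_ae (Eventually.of_forall fun x => by positivity)
          (hwm.norm.pow_const r).aestronglyMeasurable]
      have : ∫⁻ x in E, ENNReal.ofReal (‖w x‖ ^ r) = X := by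
        refine lintegral_congr fun x => ?_
        rw [← ENNReal.ofReal_rpow_of_nonneg (norm_nonneg _) hr0.le, ofReal_norm]
      rw [this, ENNReal.ofReal_toReal hXtop]
    rw [← hval]
    exact (continuous_enorm.tendsto _).comp hlim
  have hnorm : ∀ u : Plane → ℂ, eLpNorm u (ENNReal.ofReal r') volume =
      (∫⁻ x, ‖u x‖ₑ ^ r') ^ (1 / r') := by
    intro u
    rw [eLpNorm_eq_lintegral_rpow_enorm_toReal (by simpa using hr'0) ENNReal.ofReal_ne_top,
      ENNReal.toReal_ofReal hr'0.le]
  have hfr' : ∫⁻ x, ‖f x‖ₑ ^ r' = X := by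
    rw [hX, ← lintegral_indicator hEm]
    refine lintegral_congr fun x => ?_
    by_cases hx : x ∈ E
    · rw [Set.indicator_of_mem hx, ← ofReal_norm, hfn x hx,
        ← ENNReal.ofReal_rpow_of_nonneg (norm_nonneg _) hr1.le, ← ENNReal.rpow_mul,
        hr.sub_one_mul_conj, ofReal_norm]
    · simp [hf, hx, hr'0]
  have lim2 : Tendsto (fun n => M * eLpNorm (g n) (ENNReal.ofReal r') volume) atTop
      (𝓝 (M * X ^ (1 / r'))) := by
    refine ENNReal.Tendsto.const_mul ?_ (Or.inr hMtop)
    simp_rw [hnorm]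
    refine (ENNReal.continuous_rpow_const.tendsto _).comp ?_
    rw [← hfr']
    refine tendsto_lintegral_of_dominated_convergence
      (K.indicator fun x => ENNReal.ofReal ((N : ℝ) ^ (r - 1)) ^ r') (fun n => ?_) (fun n => ?_) ?_ ?_
    · exact (hgc n).continuous.measurable.enorm.pow_const r'
    · refine Eventually.of_forall fun x => ?_
      by_cases hx : x ∈ K
      · simp only [Set.indicator_of_mem hx]
        refine ENNReal.rpow_le_rpow ?_ hr'0.le
        rw [← ofReal_norm]
        exact ENNReal.ofReal_le_ofReal (hgb n x)
      · simp [hgR n x hx, hr'0]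
    · rw [lintegral_indicator hKm, setLIntegral_const]
      exact ENNReal.mul_ne_top (ENNReal.rpow_ne_top_of_nonneg hr'0.le ENNReal.ofReal_ne_top)
        measure_closedBall_lt_top.ne
    · filter_upwards [hgt] with x hx
      exact (ENNReal.continuous_rpow_const.tendsto _).comp ((continuous_enorm.tendsto _).comp hx)
  have hle : X ≤ M * X ^ (1 / r') :=
    le_of_tendsto_of_tendsto' lim1 lim2 fun n => H (g n) (hgc n) (hgs n)
  rcases eq_or_ne X 0 with h0 | h0
  · rw [h0]; exact zero_le
  have hXX : X = X ^ (1 / r) * X ^ (1 / r') := by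
    rw [← ENNReal.rpow_add _ _ h0 hXtop]
    have : 1 / r + 1 / r' = 1 := by simpa using hr.inv_add_inv_eq_one
    rw [this, ENNReal.rpow_one]
  have hx0 : X ^ (1 / r') ≠ 0 := by simp [ENNReal.rpow_eq_zero_iff, h0, hr'0.le]
  have hx1 : X ^ (1 / r') ≠ ⊤ := ENNReal.rpow_ne_top_of_nonneg (by positivity) hXtop
  have h2 : X ^ (1 / r) ≤ M := (ENNReal.mul_le_mul_iff_left hx0 hx1).1 (hXX ▸ hle)
  have := ENNReal.rpow_le_rpow h2 hr0.le
  rwa [← ENNReal.rpow_mul, one_div, inv_mul_cancel₀ hr0.ne', ENNReal.rpow_one] at this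

/-- The `L^r` norm is determined by the pairings with test functions. -/
theorem eLpNorm_le_of_forall_testFunction {r r' : ℝ} (hr : r.HolderConjugate r')
    {w : Plane → ℂ} (hw : LocallyIntegrable w) {M : ℝ≥0∞}
    (H : ∀ g : Plane → ℂ, ContDiff ℝ ∞ g → HasCompactSupport g →
      ‖∫ x, w x * g x‖ₑ ≤ M * eLpNorm g (ENNReal.ofReal r') volume) :
    eLpNorm w (ENNReal.ofReal r) volume ≤ M := by
  rcases eq_or_ne M ⊤ with rfl | hM
  · exact le_top
  have hwm := hw.aestronglyMeasurable
  set w' := hwm.mk w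
  have hww' : w =ᵐ[volume] w' := hwm.ae_eq_mk
  have hw' : LocallyIntegrable w' := hw.congr hww'
  have hr0 := hr.pos
  rw [eLpNorm_congr_ae hww', eLpNorm_eq_lintegral_rpow_enorm_toReal (by simpa using hr0)
    ENNReal.ofReal_ne_top, ENNReal.toReal_ofReal hr0.le]
  have hall := setLIntegral_enorm_rpow_le_of_testFunction hr
    hwm.stronglyMeasurable_mk.measurable hw' hM (fun g hg hg' => by
      have : ∫ x, w x * g x = ∫ x, w' x * g x :=
        integral_congr_ae (hww'.mul (EventuallyEq.refl _ g))
      exact this ▸ H g hg hg')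
  have hU : (⋃ N : ℕ, {x : Plane | ‖x‖ ≤ N ∧ ‖w' x‖ ≤ N}) = Set.univ := by
    refine Set.eq_univ_of_forall fun x => Set.mem_iUnion.2 ?_
    obtain ⟨N, hN⟩ := exists_nat_ge (max ‖x‖ ‖w' x‖)
    exact ⟨N, (le_max_left _ _).trans hN, (le_max_right _ _).trans hN⟩
  have hmono : Monotone fun N : ℕ => {x : Plane | ‖x‖ ≤ N ∧ ‖w' x‖ ≤ N} := by
    intro N N' h x hx
    have : (N : ℝ) ≤ N' := by exact_mod_cast h
    exact ⟨hx.1.trans this, hx.2.trans this⟩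
  have : ∫⁻ x, ‖w' x‖ₑ ^ r ≤ M ^ r := by
    rw [← setLIntegral_univ, ← hU, setLIntegral_iUnion_of_directed _ hmono.directed_le]
    exact iSup_le hall
  have := ENNReal.rpow_le_rpow this (by positivity : 0 ≤ 1 / r)
  rwa [← ENNReal.rpow_mul, mul_one_div_cancel hr0.ne', ENNReal.rpow_one] at this

/-! ### Interpolation between `L¹ → L^∞` and `L² → L²` for bilinear forms -/

/-- Supplies the holomorphy for the three lines theorem. A bounded exponent `l` lets one
differentiate under the integral. -/
theorem differentiable_integral_mul_cexp {X : Type*} [MeasurableSpace X] {μ : Measure X}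
    {h : X → ℂ} (hh : Integrable h μ) {l : X → ℝ} (hl : Measurable l) {Λ : ℝ}
    (hΛ : ∀ x, |l x| ≤ Λ) :
    Differentiable ℂ fun ζ : ℂ => ∫ x, h x * Complex.exp (ζ * l x) ∂μ := by
  intro ζ₀
  have hexp : ∀ ζ : ℂ, Measurable fun x => Complex.exp (ζ * l x) := fun ζ => by fun_prop
  have hbound : ∀ (ζ : ℂ) x, ‖Complex.exp (ζ * l x)‖ ≤ Real.exp (‖ζ‖ * Λ) := by
    intro ζ x
    rw [Complex.norm_exp]
    refine Real.exp_le_exp.2 ((Complex.re_le_norm _).trans ?_)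
    rw [norm_mul, Complex.norm_real]
    exact mul_le_mul_of_nonneg_left (hΛ x) (norm_nonneg _)
  refine (hasDerivAt_integral_of_dominated_loc_of_deriv_le (𝕜 := ℂ)
    (F := fun ζ x => h x * Complex.exp (ζ * l x))
    (F' := fun ζ x => h x * (Complex.exp (ζ * l x) * l x)) (s := Metric.ball ζ₀ 1)
    (bound := fun x => ‖h x‖ * (Real.exp ((‖ζ₀‖ + 1) * Λ) * Λ)) (Metric.ball_mem_nhds _ one_pos)
    (Eventually.of_forall fun ζ => hh.aestronglyMeasurable.mul (hexp ζ).aestronglyMeasurable)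
    ?_ ?_ ?_ ?_ ?_).2.differentiableAt
  · exact hh.mul_bdd (c := Real.exp (‖ζ₀‖ * Λ)) (hexp ζ₀).aestronglyMeasurable
      (Eventually.of_forall (hbound ζ₀))
  · refine hh.aestronglyMeasurable.mul (Measurable.aestronglyMeasurable ?_)
    exact (hexp ζ₀).mul (by fun_prop)
  · refine Eventually.of_forall fun x ζ hζ => ?_
    have hΛ0 : 0 ≤ Λ := (abs_nonneg _).trans (hΛ x)
    rw [norm_mul, norm_mul, Complex.norm_real]
    gcongr
    · refine (hbound ζ x).trans (Real.exp_le_exp.2 ?_)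
      have : ‖ζ‖ ≤ ‖ζ₀‖ + 1 := by
        have h1 := norm_sub_norm_le ζ ζ₀
        rw [mem_ball_iff_norm] at hζ
        linarith
      gcongr
    · exact hΛ x
  · exact hh.norm.mul_const _
  · refine Eventually.of_forall fun x ζ _ => ?_
    have h1 : HasDerivAt (fun ζ : ℂ => ζ * (l x : ℂ)) (l x : ℂ) ζ := by
      simpa using (hasDerivAt_id ζ).mul_const (l x : ℂ)
    exact (h1.cexp).const_mul (h x)

/-- The regularized logarithm `log (|f|² + δ²)^{1/2}` of the modulus of `f`. -/
def logMod (δ : ℝ) (f : Plane → ℂ) (x : Plane) : ℝ := Real.log (‖f x‖ ^ 2 + δ ^ 2) / 2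

/-- The analytic family `f (|f|² + δ²)^{a/2}`. -/
def analyticFamily (δ : ℝ) (f : Plane → ℂ) (a : ℂ) (x : Plane) : ℂ :=
  f x * Complex.exp (a * logMod δ f x)

/-- The regularization `∫_{f ≠ 0} (|f|² + δ²)^{s/2}` of `‖f‖_s^s`. -/
def regPow (δ s : ℝ) (f : Plane → ℂ) : ℝ :=
  ∫ x, (Function.support f).indicator (fun x => (‖f x‖ ^ 2 + δ ^ 2) ^ (s / 2)) x

section AnalyticFamily

variable {δ : ℝ} {f : Plane → ℂ}

theorem contDiff_logMod (hδ : 0 < δ) (hf : ContDiff ℝ ∞ f) : ContDiff ℝ ∞ (logMod δ f) := by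
  unfold logMod
  refine ContDiff.div_const (ContDiff.log ?_ fun x => ?_) _
  · exact (hf.norm_sq ℝ).add contDiff_const
  · positivity

theorem contDiff_analyticFamily (hδ : 0 < δ) (hf : ContDiff ℝ ∞ f) (a : ℂ) :
    ContDiff ℝ ∞ (analyticFamily δ f a) := by
  unfold analyticFamily
  refine hf.mul (ContDiff.cexp (contDiff_const.mul ?_))
  exact Complex.ofRealCLM.contDiff.comp (contDiff_logMod hδ hf)

theorem hasCompactSupport_analyticFamily (hf : HasCompactSupport f) (a : ℂ) :
    HasCompactSupport (analyticFamily δ f a) := hf.mul_right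

theorem norm_analyticFamily (hδ : 0 < δ) (a : ℂ) (x : Plane) :
    ‖analyticFamily δ f a x‖ = ‖f x‖ * (‖f x‖ ^ 2 + δ ^ 2) ^ (a.re / 2) := by
  rw [analyticFamily, norm_mul, Complex.norm_exp, Complex.re_mul_ofReal, logMod,
    Real.rpow_def_of_pos (by positivity)]
  congr 2; ring

theorem exists_norm_bound (hf : ContDiff ℝ ∞ f) (hf' : HasCompactSupport f) :
    ∃ b, 0 ≤ b ∧ ∀ x, ‖f x‖ ≤ b := by
  obtain ⟨b, hb⟩ := hf.continuous.bounded_above_of_compact_support hf'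
  exact ⟨b, (norm_nonneg _).trans (hb 0), hb⟩

theorem exists_logMod_bound (hδ : 0 < δ) (hf : ContDiff ℝ ∞ f) (hf' : HasCompactSupport f) :
    ∃ Λ, ∀ x, |logMod δ f x| ≤ Λ := by
  obtain ⟨b, hb0, hb⟩ := exists_norm_bound hf hf'
  refine ⟨max |Real.log (δ ^ 2) / 2| |Real.log (b ^ 2 + δ ^ 2) / 2|, fun x => ?_⟩
  refine abs_le_max_abs_abs ?_ ?_
  · unfold logMod
    have : δ ^ 2 ≤ ‖f x‖ ^ 2 + δ ^ 2 := by nlinarith [norm_nonneg (f x)]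
    have := Real.log_le_log (by positivity) this
    linarith
  · unfold logMod
    have h1 : ‖f x‖ ^ 2 + δ ^ 2 ≤ b ^ 2 + δ ^ 2 := by
      have := pow_le_pow_left₀ (norm_nonneg _) (hb x) 2
      linarith
    have := Real.log_le_log (by positivity) h1
    linarith

theorem measurableSet_support (hf : ContDiff ℝ ∞ f) : MeasurableSet (Function.support f) :=
  hf.continuous.isOpen_support.measurableSet

theorem integrable_indicator_regPow {s : ℝ} (hs : 0 ≤ s) (hf : ContDiff ℝ ∞ f)
    (hf' : HasCompactSupport f) :
    Integrable ((Function.support f).indicator fun x => (‖f x‖ ^ 2 + δ ^ 2) ^ (s / 2)) := by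
  rw [integrable_indicator_iff (measurableSet_support hf)]
  obtain ⟨b, hb0, hb⟩ := exists_norm_bound hf hf'
  refine IntegrableOn.of_bound
    ((measure_mono subset_closure).trans_lt hf'.isCompact.measure_lt_top) ?_
    ((b ^ 2 + δ ^ 2) ^ (s / 2)) (Eventually.of_forall fun x => ?_)
  · have := hf.continuous
    exact Measurable.aestronglyMeasurable (by fun_prop)
  · rw [Real.norm_of_nonneg (by positivity)]
    refine Real.rpow_le_rpow (by positivity) ?_ (by positivity)
    have := pow_le_pow_left₀ (norm_nonneg _) (hb x) 2
    linarith

theorem regPow_nonneg (s : ℝ) : 0 ≤ regPow δ s f :=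
  integral_nonneg fun x => Set.indicator_nonneg (fun _ _ => by positivity) x

theorem integrable_analyticFamily (hδ : 0 < δ) (hf : ContDiff ℝ ∞ f) (hf' : HasCompactSupport f)
    (a : ℂ) : Integrable (analyticFamily δ f a) :=
  (contDiff_analyticFamily hδ hf a).continuous.integrable_of_hasCompactSupport
    (hasCompactSupport_analyticFamily hf' a)

/-- Used on the edge of the strip where the form is bounded on `L¹ × L¹`: the factor `|f|` is at
most `(|f|² + δ²)^{1/2}`, which completes the exponent to `s/2`. -/
theorem integral_norm_analyticFamily_le {s : ℝ} (hs : 0 ≤ s) (hδ : 0 < δ) (hf : ContDiff ℝ ∞ f)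
    (hf' : HasCompactSupport f) {a : ℂ} (ha : a.re = s - 1) :
    ∫ x, ‖analyticFamily δ f a x‖ ≤ regPow δ s f := by
  refine integral_mono (integrable_analyticFamily hδ hf hf' a).norm
    (integrable_indicator_regPow hs hf hf') fun x => ?_
  simp only [norm_analyticFamily hδ]
  by_cases hx : x ∈ Function.support f
  · rw [Set.indicator_of_mem hx, ha]
    have h1 : ‖f x‖ ≤ (‖f x‖ ^ 2 + δ ^ 2) ^ (1 / 2 : ℝ) := by
      rw [← Real.sqrt_eq_rpow]
      exact Real.le_sqrt_of_sq_le (by nlinarith)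
    calc _ ≤ (‖f x‖ ^ 2 + δ ^ 2) ^ (1 / 2 : ℝ) * (‖f x‖ ^ 2 + δ ^ 2) ^ ((s - 1) / 2) := by gcongr
      _ = _ := by
          rw [← Real.rpow_add (by positivity)]
          congr 1; ring
  · rw [Set.indicator_of_notMem hx, Function.notMem_support.1 hx]
    simp

/-- The counterpart on the `L² × L²` edge; the same regularized power bounds both edges. -/
theorem integral_norm_sq_analyticFamily_le {s : ℝ} (hs : 0 ≤ s) (hδ : 0 < δ)
    (hf : ContDiff ℝ ∞ f) (hf' : HasCompactSupport f) {a : ℂ} (ha : a.re = s / 2 - 1) :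
    ∫ x, ‖analyticFamily δ f a x‖ ^ 2 ≤ regPow δ s f := by
  have hc := (contDiff_analyticFamily hδ hf a).continuous
  have hcs := hasCompactSupport_analyticFamily (δ := δ) hf' a
  refine integral_mono ?_ (integrable_indicator_regPow hs hf hf') fun x => ?_
  · refine (hc.norm.pow 2).integrable_of_hasCompactSupport ?_
    refine hcs.mono fun x hx => Function.mem_support.2 fun h0 => hx ?_
    simp [h0]
  simp only [norm_analyticFamily hδ]
  by_cases hx : x ∈ Function.support f
  · rw [Set.indicator_of_mem hx, ha, mul_pow, ← Real.rpow_natCast (_ ^ _) 2,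
      ← Real.rpow_mul (by positivity)]
    calc _ ≤ (‖f x‖ ^ 2 + δ ^ 2) * (‖f x‖ ^ 2 + δ ^ 2) ^ ((s / 2 - 1) / 2 * (2 : ℕ)) := by
          gcongr
          nlinarith
      _ = _ := by
          rw [mul_comm, ← Real.rpow_add_one (by positivity)]
          congr 1; push_cast; ring
  · rw [Set.indicator_of_notMem hx, Function.notMem_support.1 hx]
    simp

/-- Dominated by the case `δ = 1`, which is integrable because only the support of `f` is counted;
over the whole plane the power of `δ` would not be integrable. -/
theorem tendsto_regPow {s : ℝ} (hs : 0 < s) (hf : ContDiff ℝ ∞ f) (hf' : HasCompactSupport f) :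
    Tendsto (fun n : ℕ => regPow (1 / ((n : ℝ) + 1)) s f) atTop (𝓝 (∫ x, ‖f x‖ ^ s)) := by
  refine tendsto_integral_of_dominated_convergence
    ((Function.support f).indicator fun x => (‖f x‖ ^ 2 + 1 ^ 2) ^ (s / 2)) (fun n => ?_)
    (integrable_indicator_regPow hs.le hf hf') (fun n => ?_) ?_
  · exact (integrable_indicator_regPow hs.le hf hf').aestronglyMeasurable
  · refine Eventually.of_forall fun x => ?_
    rw [Real.norm_of_nonneg (Set.indicator_nonneg (fun _ _ => by positivity) x)]
    refine Set.indicator_le_indicator ?_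
    gcongr
    rw [div_le_one (by positivity)]
    linarith [(Nat.cast_nonneg n : (0 : ℝ) ≤ n)]
  · refine Eventually.of_forall fun x => ?_
    by_cases hx : x ∈ Function.support f
    · simp only [Set.indicator_of_mem hx]
      have h1 : Tendsto (fun n : ℕ => ‖f x‖ ^ 2 + (1 / ((n : ℝ) + 1)) ^ 2) atTop
          (𝓝 (‖f x‖ ^ 2 + 0 ^ 2)) :=
        tendsto_const_nhds.add (tendsto_one_div_add_atTop_nhds_zero_nat.pow 2)
      have h2 := h1.rpow_const (p := s / 2) (Or.inr (by positivity))
      convert h2 using 2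
      rw [zero_pow two_ne_zero, add_zero, ← Real.rpow_natCast, ← Real.rpow_mul (norm_nonneg _)]
      congr 1; push_cast; ring
    · simp only [Set.indicator_of_notMem hx, Function.notMem_support.1 hx, norm_zero,
        Real.zero_rpow hs.ne']
      exact tendsto_const_nhds

end AnalyticFamily

/-- The bilinear form with the kernel `k`. -/
def kernelForm (k : Plane × Plane → ℂ) (f g : Plane → ℂ) : ℂ := ∫ z, k z * (f z.1 * g z.2)

theorem norm_kernelForm_le {k : Plane × Plane → ℂ} {M : ℝ}
    (hM : ∀ z, ‖k z‖ ≤ M) {f g : Plane → ℂ} (hf : Integrable f) (hg : Integrable g) :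
    ‖kernelForm k f g‖ ≤ M * ((∫ x, ‖f x‖) * ∫ x, ‖g x‖) := by
  rw [kernelForm, Measure.volume_eq_prod, ← integral_prod_mul, ← integral_const_mul]
  refine norm_integral_le_of_norm_le ((hf.norm.mul_prod hg.norm).const_mul M)
    (Eventually.of_forall fun z => ?_)
  rw [norm_mul, norm_mul]
  exact mul_le_mul_of_nonneg_right (hM z) (by positivity)

/-- The three lines theorem for the form evaluated at the analytic families of `f` and `g`. For `δ >
0` the logarithm is bounded, so the resulting function is entire and bounded on the strip. -/
theorem norm_kernelForm_le_regPow {r r' : ℝ} (hr : 2 < r) (hrr' : r.HolderConjugate r')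
    {k : Plane × Plane → ℂ} (hk : Measurable k) {M : ℝ} (hM : ∀ z, ‖k z‖ ≤ M)
    (h2 : ∀ f g : Plane → ℂ, ContDiff ℝ ∞ f → HasCompactSupport f → ContDiff ℝ ∞ g →
      HasCompactSupport g → ‖kernelForm k f g‖ ≤ √(∫ x, ‖f x‖ ^ 2) * √(∫ x, ‖g x‖ ^ 2))
    {f g : Plane → ℂ} (hf : ContDiff ℝ ∞ f) (hf' : HasCompactSupport f) (hg : ContDiff ℝ ∞ g)
    (hg' : HasCompactSupport g) {δ : ℝ} (hδ : 0 < δ) :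
    ‖kernelForm k f g‖ ≤ (M * (regPow δ r' f * regPow δ r' g)) ^ (1 - 2 / r) *
      (√(regPow δ r' f) * √(regPow δ r' g)) ^ (2 / r) := by
  have hr0 : 0 < r := by linarith
  have hr'0 := hrr'.symm.pos
  have hM0 : 0 ≤ M := (norm_nonneg _).trans (hM 0)
  obtain ⟨Λf, hΛf⟩ := exists_logMod_bound hδ hf hf'
  obtain ⟨Λg, hΛg⟩ := exists_logMod_bound hδ hg hg'
  set l : Plane × Plane → ℝ := fun z => logMod δ f z.1 + logMod δ g z.2 with hl
  have hlm : Measurable l :=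
    ((contDiff_logMod hδ hf).continuous.measurable.comp measurable_fst).add
      ((contDiff_logMod hδ hg).continuous.measurable.comp measurable_snd)
  have hΛ : ∀ z, |l z| ≤ Λf + Λg := fun z =>
    (abs_add_le _ _).trans (add_le_add (hΛf _) (hΛg _))
  have hfi : Integrable f := hf.continuous.integrable_of_hasCompactSupport hf'
  have hgi : Integrable g := hg.continuous.integrable_of_hasCompactSupport hg'
  set h : Plane × Plane → ℂ := fun z => k z * (f z.1 * g z.2) with hh
  have hhi : Integrable h := by
    rw [Measure.volume_eq_prod]
    exact (hfi.mul_prod hgi).bdd_mul (c := M) hk.aestronglyMeasurable (Eventually.of_forall hM)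
  -- The affine exponent with real part `r' - 1` on `Re ζ = 0`, real part `r'/2 - 1` on `Re ζ = 1`,
  -- and value `0` at `ζ = 2/r`, where the original `f` and `g` reappear.
  set a : ℂ → ℂ := fun ζ => r' * (1 - ζ / 2) - 1 with ha
  have hare : ∀ ζ : ℂ, (a ζ).re = r' * (1 - ζ.re / 2) - 1 := by
    intro ζ
    simp only [ha]
    rw [Complex.sub_re, Complex.re_ofReal_mul]
    simp
  set F : ℂ → ℂ := fun ζ => ∫ z, h z * Complex.exp (a ζ * l z) with hF
  have hFB : ∀ ζ, F ζ = kernelForm k (analyticFamily δ f (a ζ)) (analyticFamily δ g (a ζ)) := by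
    intro ζ
    simp only [hF, kernelForm]
    congr 1
    funext z
    simp only [hh, hl, analyticFamily]
    rw [Complex.ofReal_add, mul_add, Complex.exp_add]
    ring
  have hdiff : Differentiable ℂ F := by
    have hda : Differentiable ℂ a := by simp only [ha]; fun_prop
    exact (differentiable_integral_mul_cexp hhi hlm hΛ).comp hda
  have hmem : ((2 / r : ℝ) : ℂ) ∈ Complex.HadamardThreeLines.verticalClosedStrip 0 1 := by
    refine ⟨?_, ?_⟩
    · rw [Complex.ofReal_re]; positivity
    · rw [Complex.ofReal_re, div_le_one hr0]; exact hr.le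
  have hthree := Complex.HadamardThreeLines.norm_le_interp_of_mem_verticalClosedStrip₀₁' F
    (a := M * (regPow δ r' f * regPow δ r' g)) (b := √(regPow δ r' f) * √(regPow δ r' g))
    hmem hdiff.diffContOnCl ?_ ?_ ?_
  · have ha0 : a ((2 / r : ℝ) : ℂ) = 0 := by
      have h1 : r' * (1 - 1 / r) = 1 := by
        have := hrr'.inv_add_inv_eq_one
        have h2 : 1 - 1 / r = r'⁻¹ := by rw [one_div]; linarith
        rw [h2, mul_inv_cancel₀ hr'0.ne']
      have h3 : (((r' * (1 - 1 / r) : ℝ)) : ℂ) = 1 := by rw [h1]; simp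
      simp only [ha]
      push_cast at h3 ⊢
      linear_combination h3
    have hFθ : F ((2 / r : ℝ) : ℂ) = kernelForm k f g := by
      rw [hFB, ha0]
      simp [analyticFamily, kernelForm]
    rwa [hFθ, Complex.ofReal_re] at hthree
  · refine ⟨(∫ z, ‖h z‖) * Real.exp ((r' + 1) * (Λf + Λg)), ?_⟩
    rintro _ ⟨ζ, hζ, rfl⟩
    simp only [Function.comp]
    rw [← integral_mul_const]
    refine norm_integral_le_of_norm_le (hhi.norm.mul_const _) (Eventually.of_forall fun z => ?_)
    rw [norm_mul, Complex.norm_exp, Complex.re_mul_ofReal, hare]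
    refine mul_le_mul_of_nonneg_left (Real.exp_le_exp.2 ?_) (norm_nonneg _)
    refine (le_abs_self _).trans ?_
    rw [abs_mul]
    have hζ0 : 0 ≤ ζ.re := hζ.1
    have hζ1 : ζ.re ≤ 1 := hζ.2
    refine mul_le_mul (abs_le.2 ⟨?_, ?_⟩) (hΛ z) (abs_nonneg _) (by linarith)
    · nlinarith
    · nlinarith
  · intro ζ hζ
    have hζ0 : ζ.re = 0 := hζ
    rw [hFB]
    have hre : (a ζ).re = r' - 1 := by rw [hare, hζ0]; ring
    refine (norm_kernelForm_le hM (integrable_analyticFamily hδ hf hf' _)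
      (integrable_analyticFamily hδ hg hg' _)).trans ?_
    gcongr
    · exact regPow_nonneg _
    · exact integral_norm_analyticFamily_le hr'0.le hδ hf hf' hre
    · exact integral_norm_analyticFamily_le hr'0.le hδ hg hg' hre
  · intro ζ hζ
    have hζ1 : ζ.re = 1 := hζ
    rw [hFB]
    have hre : (a ζ).re = r' / 2 - 1 := by rw [hare, hζ1]; ring
    refine (h2 _ _ (contDiff_analyticFamily hδ hf _) (hasCompactSupport_analyticFamily hf' _)
      (contDiff_analyticFamily hδ hg _) (hasCompactSupport_analyticFamily hg' _)).trans ?_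
    gcongr
    · exact integral_norm_sq_analyticFamily_le hr'0.le hδ hf hf' hre
    · exact integral_norm_sq_analyticFamily_le hr'0.le hδ hg hg' hre

/-- Riesz-Thorin interpolation for a bilinear form with bounded kernel which is bounded on
`L² × L²`. -/
theorem norm_kernelForm_le_interp {r r' : ℝ} (hr : 2 < r) (hrr' : r.HolderConjugate r')
    {k : Plane × Plane → ℂ} (hk : Measurable k) {M : ℝ} (hM : ∀ z, ‖k z‖ ≤ M)
    (h2 : ∀ f g : Plane → ℂ, ContDiff ℝ ∞ f → HasCompactSupport f → ContDiff ℝ ∞ g →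
      HasCompactSupport g → ‖kernelForm k f g‖ ≤ √(∫ x, ‖f x‖ ^ 2) * √(∫ x, ‖g x‖ ^ 2))
    {f g : Plane → ℂ} (hf : ContDiff ℝ ∞ f) (hf' : HasCompactSupport f) (hg : ContDiff ℝ ∞ g)
    (hg' : HasCompactSupport g) :
    ‖kernelForm k f g‖ ≤ M ^ (1 - 2 / r) * ((∫ x, ‖f x‖ ^ r') ^ (1 / r') *
      (∫ x, ‖g x‖ ^ r') ^ (1 / r')) := by
  have hr0 : 0 < r := by linarith
  have hr'0 := hrr'.symm.pos
  have hM0 : 0 ≤ M := (norm_nonneg _).trans (hM 0)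
  have hθ : 0 ≤ 1 - 2 / r := by
    rw [sub_nonneg, div_le_one hr0]; exact hr.le
  -- The exponents of `S` and `T` add up to `(1 - 2/r) + 1/r = 1/r'`.
  have heq : ∀ S T : ℝ, 0 ≤ S → 0 ≤ T → (M * (S * T)) ^ (1 - 2 / r) * (√S * √T) ^ (2 / r) =
      M ^ (1 - 2 / r) * (S ^ (1 / r') * T ^ (1 / r')) := by
    intro S T hS hT
    have h1 : 1 / r' = (1 - 2 / r) + 1 / r := by
      have := hrr'.inv_add_inv_eq_one
      simp only [div_eq_mul_inv] at *
      linarith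
    have h1pos : 0 < 1 / r' := by positivity
    rw [← Real.sqrt_mul hS, Real.sqrt_eq_rpow, ← Real.rpow_mul (by positivity),
      Real.mul_rpow hM0 (by positivity), mul_assoc, ← Real.mul_rpow hS hT,
      ← Real.rpow_add_of_nonneg (by positivity) hθ (by positivity)]
    congr 2
    rw [h1]; ring
  have hlim : ∀ {f : Plane → ℂ}, ContDiff ℝ ∞ f → HasCompactSupport f →
      Tendsto (fun n : ℕ => regPow (1 / ((n : ℝ) + 1)) r' f ^ (1 / r')) atTop
        (𝓝 ((∫ x, ‖f x‖ ^ r') ^ (1 / r'))) := fun hf hf' =>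
    (tendsto_regPow hr'0 hf hf').rpow_const (Or.inr (by positivity))
  refine ge_of_tendsto' (((hlim hf hf').mul (hlim hg hg')).const_mul (M ^ (1 - 2 / r)))
    fun n => ?_
  rw [← heq _ _ (regPow_nonneg _) (regPow_nonneg _)]
  exact norm_kernelForm_le_regPow hr hrr' hk hM h2 hf hf' hg hg' (by positivity)

/-! ### The Schrödinger and heat semigroups as bilinear forms -/

/-- The symbol of `e^{zΔ}`. -/
def gaussSymbol (z : ℂ) (ξ : Plane) : ℂ := Complex.exp (-z * ((2 * Real.pi * ‖ξ‖ : ℝ) : ℂ) ^ 2)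

theorem freeSymbol_eq_gaussSymbol (t : ℝ) (ξ : Plane) :
    freeSymbol t ξ = gaussSymbol (t * Complex.I) ξ := by
  rw [freeSymbol, gaussSymbol]
  congr 1
  push_cast
  ring

theorem continuous_gaussSymbol : Continuous fun x : ℂ × Plane => gaussSymbol x.1 x.2 := by
  unfold gaussSymbol; fun_prop

theorem norm_gaussSymbol_le {z : ℂ} (hz : 0 ≤ z.re) (ξ : Plane) : ‖gaussSymbol z ξ‖ ≤ 1 := by
  rw [gaussSymbol, Complex.norm_exp, ← Complex.ofReal_pow, Complex.re_mul_ofReal, Complex.neg_re,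
    Real.exp_le_one_iff]
  have : 0 ≤ z.re * (2 * Real.pi * ‖ξ‖) ^ 2 := by positivity
  linarith

theorem integrable_fourier_mul_fourierInv (f g : 𝓢(Plane, ℂ)) :
    Integrable fun ξ => 𝓕 f ξ * 𝓕⁻ g ξ :=
  ((𝓕 f).memLp 2 volume).integrable_mul ((𝓕⁻ g).memLp 2 volume)

/-- The bilinear form `⟨e^{zΔ} f, g⟩`. -/
def gaussForm (z : ℂ) (f g : 𝓢(Plane, ℂ)) : ℂ := ∫ ξ, gaussSymbol z ξ * (𝓕 f ξ * 𝓕⁻ g ξ)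

/-- The kernel of `e^{zΔ}`. -/
def gaussKernel (z : ℂ) (w : Plane × Plane) : ℂ :=
  (1 / (4 * Real.pi * z)) * Complex.exp (-((‖w.2 - w.1‖ : ℝ) : ℂ) ^ 2 / (4 * z))

theorem measurable_gaussKernel (z : ℂ) : Measurable (gaussKernel z) := by
  unfold gaussKernel; fun_prop

theorem norm_gaussKernel_le {z : ℂ} (hz : 0 < z.re) (w : Plane × Plane) :
    ‖gaussKernel z w‖ ≤ 1 / (4 * Real.pi * ‖z‖) := by
  rw [gaussKernel, norm_mul]
  have h1 : ‖(1 / (4 * Real.pi * z) : ℂ)‖ = 1 / (4 * Real.pi * ‖z‖) := by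
    simp [abs_of_pos Real.pi_pos]
  rw [h1]
  refine mul_le_of_le_one_right (by positivity) ?_
  rw [Complex.norm_exp, Real.exp_le_one_iff]
  have : -((‖w.2 - w.1‖ : ℝ) : ℂ) ^ 2 / (4 * z) = ((-(‖w.2 - w.1‖ ^ 2 / 4) : ℝ) : ℂ) * z⁻¹ := by
    push_cast
    rw [div_eq_mul_inv, mul_inv]
    ring
  rw [this, Complex.re_ofReal_mul, Complex.inv_re]
  have : 0 ≤ ‖w.2 - w.1‖ ^ 2 / 4 * (z.re / Complex.normSq z) := by
    have := Complex.normSq_nonneg z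
    positivity
  linarith

theorem integral_gaussSymbol_mul_exp {z : ℂ} (hz : 0 < z.re) (w : Plane × Plane) :
    ∫ ξ, gaussSymbol z ξ * Complex.exp ((2 * Real.pi * inner ℝ (w.2 - w.1) ξ : ℝ) * Complex.I) =
      gaussKernel z w := by
  have hb : 0 < ((4 * Real.pi ^ 2 : ℝ) * z : ℂ).re := by
    rw [Complex.re_ofReal_mul]; positivity
  have h := GaussianFourier.integral_cexp_neg_mul_sq_norm_add hb (2 * Real.pi * Complex.I)
    (w.2 - w.1)
  have hz0 : z ≠ 0 := fun h => by simp [h] at hz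
  have hpi : (Real.pi : ℂ) ≠ 0 := by exact_mod_cast Real.pi_ne_zero
  have hfin : ((Module.finrank ℝ Plane : ℕ) : ℂ) / 2 = 1 := by
    simp
  rw [hfin, Complex.cpow_one] at h
  calc _ = _ := ?_
    _ = _ := h
    _ = _ := ?_
  · congr 1
    funext ξ
    rw [gaussSymbol, ← Complex.exp_add]
    congr 1
    push_cast
    ring
  · rw [gaussKernel]
    congr 1
    · push_cast
      field_simp
    · congr 1
      push_cast
      field_simp
      rw [Complex.I_sq]
      ring

theorem integrable_gaussSymbol {z : ℂ} (hz : 0 < z.re) : Integrable (gaussSymbol z) := by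
  have hb : 0 < ((4 * Real.pi ^ 2 : ℝ) * z : ℂ).re := by
    rw [Complex.re_ofReal_mul]; positivity
  have h := GaussianFourier.integrable_cexp_neg_mul_sq_norm_add hb 0 (0 : Plane)
  refine h.congr (Eventually.of_forall fun ξ => ?_)
  simp only [gaussSymbol]
  congr 1
  push_cast
  ring

/-- For `Re z > 0` the Gaussian symbol is integrable, so Fubini's theorem applies and the kernel is
its explicit transform. The kernel bound `1/(4π|z|)` stays uniform near nonzero imaginary `z`, where
the integral defining the kernel no longer converges absolutely. -/
theorem gaussForm_eq_kernelForm {z : ℂ} (hz : 0 < z.re) (f g : 𝓢(Plane, ℂ)) :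
    gaussForm z f g = kernelForm (gaussKernel z) f g := by
  have hfi : Integrable (f : Plane → ℂ) := f.integrable
  have hgi : Integrable (g : Plane → ℂ) := g.integrable
  have hprod : ∀ ξ, 𝓕 f ξ * 𝓕⁻ g ξ = ∫ w : Plane × Plane,
      Complex.exp ((2 * Real.pi * inner ℝ (w.2 - w.1) ξ : ℝ) * Complex.I) * (f w.1 * g w.2) := by
    intro ξ
    rw [SchwartzMap.fourier_coe, SchwartzMap.fourierInv_coe, Real.fourier_eq', Real.fourierInv_eq',
      ← integral_prod_mul, ← Measure.volume_eq_prod]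
    congr 1
    funext w
    rw [inner_sub_left]
    simp only [smul_eq_mul]
    rw [mul_mul_mul_comm, ← Complex.exp_add]
    congr 2
    push_cast
    ring
  rw [gaussForm, kernelForm]
  simp_rw [hprod, ← integral_const_mul]
  rw [integral_integral_swap]
  · congr 1
    funext w
    rw [← integral_gaussSymbol_mul_exp hz w, ← integral_mul_const]
    congr 1
    funext ξ
    ring
  · have h1 : Integrable (fun x : Plane × (Plane × Plane) =>
        gaussSymbol z x.1 * (f x.2.1 * g x.2.2)) (volume.prod volume) := by
      refine (integrable_gaussSymbol hz).mul_prod (g := fun w : Plane × Plane => f w.1 * g w.2) ?_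
      rw [Measure.volume_eq_prod]
      exact hfi.mul_prod hgi
    refine (h1.bdd_mul (c := 1) (f := fun x : Plane × (Plane × Plane) =>
      Complex.exp ((2 * Real.pi * inner ℝ (x.2.2 - x.2.1) x.1 : ℝ) * Complex.I)) ?_ ?_).congr ?_
    · exact Continuous.aestronglyMeasurable (by fun_prop)
    · exact Eventually.of_forall fun x => (Complex.norm_exp_ofReal_mul_I _).le
    · refine Eventually.of_forall fun x => ?_
      simp only [Function.uncurry]
      ring

/-- Plancherel and a symbol of modulus at most one. One factor carries `𝓕⁻` because the pairing is
bilinear, without conjugation. -/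
theorem norm_gaussForm_le {z : ℂ} (hz : 0 ≤ z.re) (f g : 𝓢(Plane, ℂ)) :
    ‖gaussForm z f g‖ ≤ √(∫ x, ‖f x‖ ^ 2) * √(∫ x, ‖g x‖ ^ 2) := by
  have h2 : ∀ h : 𝓢(Plane, ℂ), MemLp (fun ξ => ‖h ξ‖) (ENNReal.ofReal 2) := fun h => by
    have : ENNReal.ofReal 2 = 2 := by simp
    rw [this]
    exact (h.memLp 2 volume).norm
  have hcs := integral_mul_le_Lp_mul_Lq_of_nonneg (μ := (volume : Measure Plane))
    (p := 2) (q := 2) (by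
      rw [Real.holderConjugate_iff]; norm_num) (f := fun ξ => ‖𝓕 f ξ‖) (g := fun ξ => ‖𝓕⁻ g ξ‖)
    (Eventually.of_forall fun _ => norm_nonneg _) (Eventually.of_forall fun _ => norm_nonneg _)
    (h2 _) (h2 _)
  have hg : ∫ ξ, ‖𝓕⁻ g ξ‖ ^ 2 = ∫ x, ‖g x‖ ^ 2 := by
    rw [← SchwartzMap.integral_norm_sq_fourier (𝓕⁻ g), FourierTransform.fourier_fourierInv_eq]
  simp only [Real.rpow_two] at hcs
  rw [SchwartzMap.integral_norm_sq_fourier, hg, ← Real.sqrt_eq_rpow, ← Real.sqrt_eq_rpow] at hcs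
  refine le_trans ?_ hcs
  refine norm_integral_le_of_norm_le ((integrable_fourier_mul_fourierInv f g).norm.congr
    (Eventually.of_forall fun ξ => norm_mul _ _)) (Eventually.of_forall fun ξ => ?_)
  rw [norm_mul, norm_mul]
  exact mul_le_of_le_one_left (by positivity) (norm_gaussSymbol_le hz ξ)

/-- The `L^s` norm of a function, as a real number. -/
def realNorm (s : ℝ) (f : Plane → ℂ) : ℝ := (∫ x, ‖f x‖ ^ s) ^ (1 / s)

theorem realNorm_nonneg (s : ℝ) (f : Plane → ℂ) : 0 ≤ realNorm s f :=
  Real.rpow_nonneg (integral_nonneg fun _ => by positivity) _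

theorem ofReal_realNorm {s : ℝ} (hs : 0 < s) {f : Plane → ℂ}
    (hf : MemLp f (ENNReal.ofReal s)) :
    ENNReal.ofReal (realNorm s f) = eLpNorm f (ENNReal.ofReal s) volume := by
  rw [hf.eLpNorm_eq_integral_rpow_norm (by simpa using hs) ENNReal.ofReal_ne_top,
    ENNReal.toReal_ofReal hs.le, realNorm, one_div]

/-- Interpolation of the kernel bound with the `L²` bound; the factor `(4π)^{-(1-2/r)} ≤ 1` is
dropped. Both `e^{itΔ}`, as a limit, and the resolvent, as an average, are estimated from here. -/
theorem norm_gaussForm_le_of_re_pos {r r' : ℝ} (hr : 2 < r) (hrr' : r.HolderConjugate r')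
    {f g : 𝓢(Plane, ℂ)} (hf : HasCompactSupport f) (hg : HasCompactSupport g) {z : ℂ}
    (hz : 0 < z.re) :
    ‖gaussForm z f g‖ ≤ ‖z‖ ^ (-(1 - 2 / r)) * (realNorm r' f * realNorm r' g) := by
  rw [gaussForm_eq_kernelForm hz]
  have h1r : 0 ≤ 1 - 2 / r := by rw [sub_nonneg, div_le_one (by linarith)]; exact hr.le
  have hz0 : 0 < ‖z‖ := norm_pos_iff.2 fun h => by simp [h] at hz
  refine (norm_kernelForm_le_interp hr hrr' (measurable_gaussKernel z) (norm_gaussKernel_le hz)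
    (fun f g hf hf' hg hg' => ?_) (f.smooth ⊤) hf (g.smooth ⊤) hg).trans ?_
  · have := norm_gaussForm_le hz.le (hf'.toSchwartzMap hf) (hg'.toSchwartzMap hg)
    rwa [gaussForm_eq_kernelForm hz] at this
  · refine mul_le_mul_of_nonneg_right ?_
      (mul_nonneg (realNorm_nonneg r' f) (realNorm_nonneg r' g))
    rw [Real.rpow_neg hz0.le, ← Real.inv_rpow hz0.le]
    refine Real.rpow_le_rpow (by positivity) ?_ h1r
    rw [one_div, mul_inv]
    refine mul_le_of_le_one_left (by positivity) (inv_le_one_of_one_le₀ ?_)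
    linarith [Real.pi_gt_three]

theorem tendsto_gaussForm (f g : 𝓢(Plane, ℂ)) (t : ℝ) :
    Tendsto (fun l : ℝ => gaussForm (l + t * Complex.I) f g) (𝓝[>] 0)
      (𝓝 (gaussForm (t * Complex.I) f g)) := by
  refine tendsto_integral_filter_of_dominated_convergence (fun ξ => ‖𝓕 f ξ * 𝓕⁻ g ξ‖) ?_ ?_
    (integrable_fourier_mul_fourierInv f g).norm ?_
  · refine Eventually.of_forall fun l => ?_
    refine Continuous.aestronglyMeasurable ?_
    exact (continuous_gaussSymbol.comp (continuous_const.prodMk continuous_id)).mul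
      ((𝓕 f).continuous.mul (𝓕⁻ g).continuous)
  · filter_upwards [self_mem_nhdsWithin] with l hl
    refine Eventually.of_forall fun ξ => ?_
    rw [norm_mul]
    refine mul_le_of_le_one_left (norm_nonneg _) (norm_gaussSymbol_le ?_ ξ)
    simpa using (Set.mem_Ioi.1 hl).le
  · refine Eventually.of_forall fun ξ => ?_
    refine Tendsto.mul_const _ ?_
    refine Tendsto.mono_left ?_ nhdsWithin_le_nhds
    have : Continuous fun l : ℝ => gaussSymbol (l + t * Complex.I) ξ := by
      unfold gaussSymbol; fun_prop
    simpa using this.tendsto 0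

/-- The dispersive estimate in bilinear form. -/
theorem norm_gaussForm_mul_I_le {r r' : ℝ} (hr : 2 < r) (hrr' : r.HolderConjugate r')
    {f g : 𝓢(Plane, ℂ)} (hf : HasCompactSupport f) (hg : HasCompactSupport g) {t : ℝ}
    (ht : t ≠ 0) :
    ‖gaussForm (t * Complex.I) f g‖ ≤ |t| ^ (-(1 - 2 / r)) * (realNorm r' f * realNorm r' g) := by
  have h1 := (tendsto_gaussForm f g t).norm
  have h2 : Tendsto (fun l : ℝ => ‖(l + t * Complex.I : ℂ)‖ ^ (-(1 - 2 / r)) *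
      (realNorm r' f * realNorm r' g)) (𝓝[>] 0)
      (𝓝 (|t| ^ (-(1 - 2 / r)) * (realNorm r' f * realNorm r' g))) := by
    refine Tendsto.mul_const _ ?_
    have h3 : Tendsto (fun l : ℝ => ‖(l + t * Complex.I : ℂ)‖) (𝓝[>] 0) (𝓝 |t|) := by
      refine Tendsto.mono_left ?_ nhdsWithin_le_nhds
      have : Continuous fun l : ℝ => ‖(l + t * Complex.I : ℂ)‖ := by fun_prop
      simpa using this.tendsto 0
    exact h3.rpow_const (Or.inl (abs_ne_zero.2 ht))
  refine le_of_tendsto_of_tendsto h1 h2 ?_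
  filter_upwards [self_mem_nhdsWithin] with l hl
  exact norm_gaussForm_le_of_re_pos hr hrr' hf hg (by simpa using hl)

/-- The symbol `1 + |2πξ|²` of `1 - Δ`. -/
def besselSymbol (ξ : Plane) : ℝ := 1 + (2 * Real.pi * ‖ξ‖) ^ 2

theorem one_le_besselSymbol (ξ : Plane) : 1 ≤ besselSymbol ξ := by
  unfold besselSymbol; nlinarith [sq_nonneg (2 * Real.pi * ‖ξ‖)]

theorem besselSymbol_pos (ξ : Plane) : 0 < besselSymbol ξ :=
  zero_lt_one.trans_le (one_le_besselSymbol ξ)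

theorem continuous_besselSymbol : Continuous besselSymbol := by unfold besselSymbol; fun_prop

/-- The bilinear form `⟨(1 - Δ)⁻¹ e^{itΔ} f, g⟩`. -/
def besselForm (t : ℝ) (f g : 𝓢(Plane, ℂ)) : ℂ :=
  ∫ ξ, ((besselSymbol ξ)⁻¹ : ℝ) * (freeSymbol t ξ * (𝓕 f ξ * 𝓕⁻ g ξ))

/-- The resolvent is the Laplace transform of the heat semigroup, so the Bessel potential inherits
the bounds at complex times. -/
theorem integral_exp_mul_gaussSymbol (t : ℝ) (ξ : Plane) :
    ∫ l in Set.Ioi (0 : ℝ), (Real.exp (-l) : ℂ) * gaussSymbol (l + t * Complex.I) ξ =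
      ((besselSymbol ξ)⁻¹ : ℝ) * freeSymbol t ξ := by
  have h := integral_exp_mul_complex_Ioi (a := -(besselSymbol ξ : ℂ))
    (by simpa using besselSymbol_pos ξ) 0
  have h2 : ∀ l : ℝ, (Real.exp (-l) : ℂ) * gaussSymbol (l + t * Complex.I) ξ =
      Complex.exp (-(besselSymbol ξ : ℂ) * l) * freeSymbol t ξ := by
    intro l
    rw [freeSymbol_eq_gaussSymbol, gaussSymbol, gaussSymbol, Complex.ofReal_exp, ← Complex.exp_add,
      ← Complex.exp_add, besselSymbol]
    congr 1
    push_cast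
    ring
  simp_rw [h2]
  rw [integral_mul_const, h]
  simp

theorem besselForm_eq_integral (t : ℝ) (f g : 𝓢(Plane, ℂ)) :
    besselForm t f g =
      ∫ l in Set.Ioi (0 : ℝ), (Real.exp (-l) : ℂ) * gaussForm (l + t * Complex.I) f g := by
  have hexp : IntegrableOn (fun l : ℝ => (Real.exp (-l) : ℂ)) (Set.Ioi 0) :=
    (integrableOn_exp_neg_Ioi 0).ofReal
  rw [besselForm]
  simp_rw [← mul_assoc, ← integral_exp_mul_gaussSymbol, mul_assoc, gaussForm,
    ← integral_const_mul, ← integral_mul_const]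
  rw [integral_integral_swap]
  · congr 1
    funext l
    congr 1
    funext ξ
    ring
  · have h1 : Integrable (fun x : Plane × ℝ => (𝓕 f x.1 * 𝓕⁻ g x.1) * (Real.exp (-x.2) : ℂ))
        (volume.prod (volume.restrict (Set.Ioi 0))) :=
      (integrable_fourier_mul_fourierInv f g).mul_prod hexp
    -- Replacing `l` by `max l 0` changes nothing on the domain of integration and makes the symbol
    -- bounded by one everywhere.
    refine (h1.mul_bdd (c := 1) (g := fun x : Plane × ℝ =>
      gaussSymbol (max x.2 0 + t * Complex.I) x.1) ?_ ?_).congr ?_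
    · refine Continuous.aestronglyMeasurable ?_
      refine continuous_gaussSymbol.comp (Continuous.prodMk ?_ continuous_fst)
      have : Continuous fun x : Plane × ℝ => ((max x.2 0 : ℝ) : ℂ) :=
        Complex.continuous_ofReal.comp (continuous_snd.max continuous_const)
      exact this.add continuous_const
    · refine Eventually.of_forall fun x => norm_gaussSymbol_le ?_ _
      simp
    · have : ∀ᵐ x : Plane × ℝ ∂(volume.prod (volume.restrict (Set.Ioi 0))), x.2 ∈ Set.Ioi (0 : ℝ) :=
        Measure.quasiMeasurePreserving_snd.ae (ae_restrict_mem measurableSet_Ioi)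
      filter_upwards [this] with x hx
      simp only [Function.uncurry]
      rw [max_eq_left (Set.mem_Ioi.1 hx).le]
      ring

/-- The decay `|l+it|^{-γ}` is divided: the part `s` becomes decay in `t`, the rest is an integrable
singularity at `l = 0` because `γ - s < 1`. This is where one derivative of smoothing buys the
weaker decay `|t|^{-s}`. For `s = 0` no decay is asked for, so `t = 0` is allowed. -/
theorem norm_besselForm_le {r r' : ℝ} (hr : 2 < r) (hrr' : r.HolderConjugate r') {s : ℝ}
    (hs0 : 0 ≤ s) (hs : s ≤ 1 - 2 / r) :
    ∃ κ : ℝ, 0 ≤ κ ∧ ∀ (f g : 𝓢(Plane, ℂ)), HasCompactSupport f → HasCompactSupport g →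
      ∀ t : ℝ, (t ≠ 0 ∨ s = 0) →
      ‖besselForm t f g‖ ≤ κ * |t| ^ (-s) * (realNorm r' f * realNorm r' g) := by
  set γ := 1 - 2 / r with hγ
  have hγ1 : γ < 1 := by
    have : 0 < 2 / r := by positivity
    linarith
  have hI : IntegrableOn (fun l : ℝ => Real.exp (-l) * l ^ (-(γ - s))) (Set.Ioi 0) := by
    have := Real.GammaIntegral_convergent (s := 1 - (γ - s)) (by linarith)
    refine this.congr_fun (fun l _ => ?_) measurableSet_Ioi
    simp only
    congr 2; ring
  refine ⟨∫ l in Set.Ioi (0 : ℝ), Real.exp (-l) * l ^ (-(γ - s)), ?_, ?_⟩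
  · refine setIntegral_nonneg measurableSet_Ioi fun l hl => ?_
    have : (0 : ℝ) < l := hl
    positivity
  intro f g hf hg t ht
  rw [besselForm_eq_integral, ← integral_mul_const, ← integral_mul_const]
  refine norm_integral_le_of_norm_le ((hI.mul_const _).mul_const _) ?_
  filter_upwards [ae_restrict_mem measurableSet_Ioi] with l hl
  have hl0 : (0 : ℝ) < l := hl
  rw [norm_mul, Complex.norm_real, Real.norm_of_nonneg (Real.exp_pos _).le]
  have hre : (l + t * Complex.I : ℂ).re = l := by simp
  have him : (l + t * Complex.I : ℂ).im = t := by simp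
  have hN := realNorm_nonneg r' f
  have hN' := realNorm_nonneg r' g
  have hzl : l ≤ ‖(l + t * Complex.I : ℂ)‖ := by
    have := Complex.abs_re_le_norm (l + t * Complex.I : ℂ)
    rw [hre] at this
    exact (le_abs_self _).trans this
  have hzt : |t| ≤ ‖(l + t * Complex.I : ℂ)‖ := by
    have := Complex.abs_im_le_norm (l + t * Complex.I : ℂ)
    rwa [him] at this
  have hz0 : 0 < ‖(l + t * Complex.I : ℂ)‖ := hl0.trans_le hzl
  have key : ‖(l + t * Complex.I : ℂ)‖ ^ (-γ) ≤ l ^ (-(γ - s)) * |t| ^ (-s) := by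
    have hsplit : ‖(l + t * Complex.I : ℂ)‖ ^ (-γ) =
        ‖(l + t * Complex.I : ℂ)‖ ^ (-(γ - s)) * ‖(l + t * Complex.I : ℂ)‖ ^ (-s) := by
      rw [← Real.rpow_add hz0]; congr 1; ring
    rw [hsplit]
    refine mul_le_mul (Real.rpow_le_rpow_of_nonpos hl0 hzl (by linarith)) ?_ (by positivity)
      (by positivity)
    rcases ht with ht | ht
    · exact Real.rpow_le_rpow_of_nonpos (abs_pos.2 ht) hzt (by linarith)
    · simp [ht]
  calc _ ≤ Real.exp (-l) * (‖(l + t * Complex.I : ℂ)‖ ^ (-γ) *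
        (realNorm r' f * realNorm r' g)) := by
        gcongr
        exact norm_gaussForm_le_of_re_pos hr hrr' hf hg (by rw [hre]; exact hl0)
    _ ≤ Real.exp (-l) * (l ^ (-(γ - s)) * |t| ^ (-s) * (realNorm r' f * realNorm r' g)) := by
        gcongr
    _ = _ := by ring

/-! ### Dispersive estimate -/

theorem gaussForm_mul_I_eq (t : ℝ) (ψ g : 𝓢(Plane, ℂ)) :
    ∫ x, freeProp t ψ x * g x = gaussForm (t * Complex.I) ψ g := by
  rw [freeProp, SchwartzMap.fourierMultiplierCLM_apply, SchwartzMap.integral_fourierInv_mul_eq,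
    gaussForm]
  congr 1
  funext ξ
  rw [SchwartzMap.smulLeftCLM_apply_apply (hasTemperateGrowth_freeSymbol t), smul_eq_mul,
    freeSymbol_eq_gaussSymbol, mul_assoc]

/-- The dispersive estimate for test functions. -/
theorem eLpNorm_freeProp_le {r r' : ℝ} (hr : 2 < r) (hrr' : r.HolderConjugate r')
    {ψ : 𝓢(Plane, ℂ)} (hψ : HasCompactSupport ψ) {t : ℝ} (ht : t ≠ 0) :
    eLpNorm (freeProp t ψ) (ENNReal.ofReal r) volume ≤
      rieszKer (1 - 2 / r) t * eLpNorm ψ (ENNReal.ofReal r') volume := by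
  have hr'0 := hrr'.symm.pos
  refine eLpNorm_le_of_forall_testFunction hrr' (freeProp t ψ).continuous.locallyIntegrable
    fun g hg hg' => ?_
  set G := hg'.toSchwartzMap hg with hG
  have hGg : (G : Plane → ℂ) = g := rfl
  have h1 := norm_gaussForm_mul_I_le hr hrr' hψ (g := G) hg' ht
  rw [← gaussForm_mul_I_eq, hGg] at h1
  rw [← ofReal_realNorm hr'0 (ψ.memLp _ volume), ← hGg, ← ofReal_realNorm hr'0 (G.memLp _ volume),
    ← ofReal_norm, rieszKer, mul_assoc, ← ENNReal.ofReal_mul (realNorm_nonneg _ _),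
    ← ENNReal.ofReal_mul (by positivity)]
  exact ENNReal.ofReal_le_ofReal h1

/-! ### The free evolution of data in `H¹` -/

/-- The symbol is even, so the multiplier acts in the same way on the inverse transform. -/
theorem fourierInv_freeProp (t : ℝ) (ψ : 𝓢(Plane, ℂ)) (ξ : Plane) :
    𝓕⁻ (freeProp t ψ) ξ = freeSymbol t ξ * 𝓕⁻ ψ ξ := by
  have hneg : ∀ (h : 𝓢(Plane, ℂ)), 𝓕⁻ h ξ = 𝓕 h (-ξ) := by
    intro h
    rw [SchwartzMap.fourierInv_coe, SchwartzMap.fourier_coe, Real.fourierInv_eq_fourier_neg]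
  rw [hneg, hneg, freeProp, SchwartzMap.fourierMultiplierCLM_apply,
    FourierTransform.fourier_fourierInv_eq,
    SchwartzMap.smulLeftCLM_apply_apply (hasTemperateGrowth_freeSymbol t), smul_eq_mul]
  simp [freeSymbol]

theorem integral_mul_eq_integral_fourier_mul {f : Plane → ℂ} (hf : MemLp f 2 volume)
    (ψ : 𝓢(Plane, ℂ)) :
    ∫ x, f x * ψ x = ∫ ξ, (𝓕 (hf.toLp f) : Lp ℂ 2 volume) ξ * 𝓕⁻ ψ ξ := by
  have h := congrArg (fun T => T (𝓕⁻ ψ)) (Lp.fourier_toTemperedDistribution_eq (hf.toLp f))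
  simp only [TemperedDistribution.fourier_apply, FourierTransform.fourier_fourierInv_eq] at h
  rw [Lp.toTemperedDistribution_apply, Lp.toTemperedDistribution_apply] at h
  simp only [smul_eq_mul] at h
  simp_rw [mul_comm _ (𝓕⁻ ψ _)]
  rw [← h]
  refine integral_congr_ae ?_
  filter_upwards [hf.coeFn_toLp] with x hx
  rw [hx, mul_comm]

/-- The function whose pairing with `(1 - Δ)^{1/2} f` on the Fourier side is
`⟨f, e^{itΔ} ψ⟩`. -/
def dualFun (ψ : 𝓢(Plane, ℂ)) (t : ℝ) (ξ : Plane) : ℂ :=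
  ((√(besselSymbol ξ))⁻¹ : ℝ) * (starRingEnd ℂ) (freeSymbol t ξ * 𝓕⁻ ψ ξ)

theorem norm_freeSymbol (t : ℝ) (ξ : Plane) : ‖freeSymbol t ξ‖ = 1 :=
  Complex.norm_exp_ofReal_mul_I _

theorem continuous_freeSymbol : Continuous fun x : ℝ × Plane => freeSymbol x.1 x.2 := by
  unfold freeSymbol; fun_prop

theorem inv_sqrt_besselSymbol_le_one (ξ : Plane) : (√(besselSymbol ξ))⁻¹ ≤ 1 :=
  inv_le_one_of_one_le₀ (Real.one_le_sqrt.2 (one_le_besselSymbol ξ))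

theorem norm_dualFun_sub_le (ψ φ : 𝓢(Plane, ℂ)) (t : ℝ) (ξ : Plane) :
    ‖dualFun ψ t ξ - dualFun φ t ξ‖ ≤ ‖𝓕⁻ ψ ξ - 𝓕⁻ φ ξ‖ := by
  rw [dualFun, dualFun, ← mul_sub, ← map_sub, ← mul_sub, norm_mul, RCLike.norm_conj, norm_mul,
    norm_freeSymbol, one_mul, Complex.norm_real, Real.norm_of_nonneg (by positivity)]
  exact mul_le_of_le_one_left (norm_nonneg _) (inv_sqrt_besselSymbol_le_one ξ)

theorem norm_dualFun_le (ψ : 𝓢(Plane, ℂ)) (t : ℝ) (ξ : Plane) :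
    ‖dualFun ψ t ξ‖ ≤ ‖𝓕⁻ ψ ξ‖ := by
  rw [dualFun, norm_mul, RCLike.norm_conj, norm_mul,
    norm_freeSymbol, one_mul, Complex.norm_real, Real.norm_of_nonneg (by positivity)]
  exact mul_le_of_le_one_left (norm_nonneg _) (inv_sqrt_besselSymbol_le_one ξ)

theorem continuous_dualFun (ψ : 𝓢(Plane, ℂ)) :
    Continuous fun x : ℝ × Plane => dualFun ψ x.1 x.2 := by
  unfold dualFun
  refine Continuous.mul ?_ ?_
  · refine Complex.continuous_ofReal.comp (Continuous.inv₀ ?_ fun x => ?_)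
    · exact (continuous_besselSymbol.comp continuous_snd).sqrt
    · exact (Real.sqrt_pos.2 (besselSymbol_pos _)).ne'
  · exact Complex.continuous_conj.comp
      (continuous_freeSymbol.mul ((𝓕⁻ ψ).continuous.comp continuous_snd))

theorem memLp_dualFun (ψ : 𝓢(Plane, ℂ)) (t : ℝ) : MemLp (dualFun ψ t) 2 volume :=
  ((𝓕⁻ ψ).memLp 2 volume).mono
    ((continuous_dualFun ψ).comp (continuous_const.prodMk continuous_id)).aestronglyMeasurable
    (Eventually.of_forall fun ξ => norm_dualFun_le ψ t ξ)

/-- `dualFun` as an element of `L²`. -/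
def dualVec (ψ : 𝓢(Plane, ℂ)) (t : ℝ) : Lp ℂ 2 (volume : Measure Plane) :=
  (memLp_dualFun ψ t).toLp _

/-- The bound is uniform in `t`, so a single dense sequence of test functions serves all times. -/
theorem norm_dualVec_sub_le (ψ φ : 𝓢(Plane, ℂ)) (t : ℝ) :
    ‖dualVec ψ t - dualVec φ t‖ ≤ ‖(𝓕⁻ ψ).toLp 2 volume - (𝓕⁻ φ).toLp 2 volume‖ := by
  refine Lp.norm_le_norm_of_ae_le ?_
  filter_upwards [Lp.coeFn_sub (dualVec ψ t) (dualVec φ t),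
    Lp.coeFn_sub ((𝓕⁻ ψ).toLp 2 volume) ((𝓕⁻ φ).toLp 2 volume), (memLp_dualFun ψ t).coeFn_toLp,
    (memLp_dualFun φ t).coeFn_toLp, (𝓕⁻ ψ).coeFn_toLp 2, (𝓕⁻ φ).coeFn_toLp 2]
    with ξ h1 h2 h3 h4 h5 h6
  rw [h1, h2, Pi.sub_apply, Pi.sub_apply, h5, h6, dualVec, dualVec, h3, h4]
  exact norm_dualFun_sub_le ψ φ t ξ

theorem norm_dualVec_le (ψ : 𝓢(Plane, ℂ)) (t : ℝ) : ‖dualVec ψ t‖ ≤ ‖(𝓕⁻ ψ).toLp 2‖ := by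
  refine Lp.norm_le_norm_of_ae_le ?_
  filter_upwards [(memLp_dualFun ψ t).coeFn_toLp, (𝓕⁻ ψ).coeFn_toLp 2] with ξ h1 h2
  rw [dualVec, h1, h2]
  exact norm_dualFun_le ψ t ξ

/-- Dominated convergence with the majorant `2 |𝓕⁻ ψ|`. Continuity provides the strong measurability
that the `T T*` estimate asks for. -/
theorem continuous_dualVec (ψ : 𝓢(Plane, ℂ)) : Continuous (dualVec ψ) := by
  rw [continuous_iff_continuousAt]
  intro t₀
  unfold ContinuousAt dualVec
  rw [Lp.tendsto_Lp_iff_tendsto_eLpNorm'' _ (memLp_dualFun ψ) _ (memLp_dualFun ψ t₀)]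
  have hb : ∀ t ξ, ‖(dualFun ψ t - dualFun ψ t₀) ξ‖ₑ ≤ ‖(2 : ℂ) * 𝓕⁻ ψ ξ‖ₑ := by
    intro t ξ
    rw [← ofReal_norm, ← ofReal_norm, Pi.sub_apply]
    refine ENNReal.ofReal_le_ofReal ((norm_sub_le _ _).trans ?_)
    rw [norm_mul, Complex.norm_ofNat]
    linarith [norm_dualFun_le ψ t ξ, norm_dualFun_le ψ t₀ ξ]
  have hrw : ∀ f : Plane → ℂ, eLpNorm f 2 volume = (∫⁻ ξ, ‖f ξ‖ₑ ^ (2 : ℝ)) ^ (1 / (2 : ℝ)) := by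
    intro f
    rw [eLpNorm_eq_lintegral_rpow_enorm_toReal two_ne_zero ENNReal.ofNat_ne_top]
    simp
  simp_rw [hrw]
  have h0 : (0 : ℝ≥0∞) = (0 : ℝ≥0∞) ^ (1 / (2 : ℝ)) := by simp
  rw [h0]
  refine (ENNReal.continuous_rpow_const.tendsto _).comp ?_
  have hmeas : ∀ t, Measurable fun ξ => ‖(dualFun ψ t - dualFun ψ t₀) ξ‖ₑ ^ (2 : ℝ) := by
    intro t
    have hc : ∀ t, Measurable (dualFun ψ t) := fun t =>
      ((continuous_dualFun ψ).comp (continuous_const.prodMk continuous_id)).measurable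
    exact ((hc t).sub (hc t₀)).enorm.pow_const (2 : ℝ)
  suffices Tendsto (fun t => ∫⁻ ξ, ‖(dualFun ψ t - dualFun ψ t₀) ξ‖ₑ ^ (2 : ℝ)) (𝓝 t₀)
      (𝓝 (∫⁻ _ : Plane, 0)) by simpa only [lintegral_zero] using this
  refine tendsto_lintegral_filter_of_dominated_convergence
    (fun ξ => ‖(2 : ℂ) * 𝓕⁻ ψ ξ‖ₑ ^ (2 : ℝ)) (Eventually.of_forall hmeas) ?_ ?_ ?_
  · exact Eventually.of_forall fun t => Eventually.of_forall fun ξ =>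
      ENNReal.rpow_le_rpow (hb t ξ) (by norm_num)
  · have hm : MemLp (fun ξ => (2 : ℂ) * 𝓕⁻ ψ ξ) 2 volume := ((𝓕⁻ ψ).memLp 2 volume).const_mul 2
    have := hm.eLpNorm_lt_top
    rw [hrw] at this
    intro h
    rw [h] at this
    simp at this
  · refine Eventually.of_forall fun ξ => ?_
    have hc : Continuous fun t => (dualFun ψ t - dualFun ψ t₀) ξ := by
      simp only [Pi.sub_apply]
      exact ((continuous_dualFun ψ).comp (continuous_id.prodMk continuous_const)).sub
        continuous_const
    have h1 : Tendsto (fun t => ‖(dualFun ψ t - dualFun ψ t₀) ξ‖ₑ ^ (2 : ℝ)) (𝓝 t₀)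
        (𝓝 (‖(dualFun ψ t₀ - dualFun ψ t₀) ξ‖ₑ ^ (2 : ℝ))) :=
      (ENNReal.continuous_rpow_const.comp (continuous_enorm.comp hc)).tendsto t₀
    simpa using h1

/-- Complex conjugation of Schwartz functions with compact support. -/
theorem exists_conj {φ : 𝓢(Plane, ℂ)} (hφ : HasCompactSupport φ) : ∃ χ : 𝓢(Plane, ℂ),
    HasCompactSupport χ ∧ (∀ x, χ x = (starRingEnd ℂ) (φ x)) ∧
      (∀ s, realNorm s χ = realNorm s φ) ∧
      ∀ ξ, 𝓕 χ ξ = (starRingEnd ℂ) (𝓕⁻ φ ξ) := by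
  have h1 : ContDiff ℝ ∞ fun x => (starRingEnd ℂ) (φ x) :=
    Complex.conjCLE.contDiff.comp (φ.smooth ⊤)
  have h2 : HasCompactSupport fun x => (starRingEnd ℂ) (φ x) :=
    hφ.comp_left (g := starRingEnd ℂ) (map_zero _)
  refine ⟨h2.toSchwartzMap h1, h2, fun x => rfl, fun s => ?_, fun ξ => ?_⟩
  · unfold realNorm
    congr 2
    funext x
    rw [HasCompactSupport.toSchwartzMap_toFun, RCLike.norm_conj]
  · rw [SchwartzMap.fourier_coe, SchwartzMap.fourierInv_coe, Real.fourier_eq', Real.fourierInv_eq',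
      ← integral_conj]
    congr 1
    funext x
    rw [smul_eq_mul, smul_eq_mul, map_mul, ← Complex.exp_conj, HasCompactSupport.toSchwartzMap_toFun]
    congr 2
    rw [map_mul, Complex.conj_I, Complex.conj_ofReal]
    push_cast
    ring

/-- The two factors `(1-Δ)^{-1/2}` combine to `(1-Δ)⁻¹`, and the conjugated symbol turns the two
times into their difference. Conjugating `φ` to `χ` passes from the sesquilinear product to the
bilinear form. -/
theorem inner_dualVec_dualVec (ψ φ χ : 𝓢(Plane, ℂ))
    (hχ : ∀ ξ, 𝓕 χ ξ = (starRingEnd ℂ) (𝓕⁻ φ ξ)) (s t : ℝ) :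
    inner ℂ (dualVec ψ s) (dualVec φ t) = besselForm (s - t) χ ψ := by
  rw [L2.inner_def, besselForm]
  refine integral_congr_ae ?_
  filter_upwards [(memLp_dualFun ψ s).coeFn_toLp, (memLp_dualFun φ t).coeFn_toLp] with ξ h1 h2
  rw [dualVec, dualVec, h1, h2, hχ, dualFun, dualFun, RCLike.inner_apply]
  simp only [map_mul, Complex.conj_conj, Complex.conj_ofReal]
  have hfs : freeSymbol (s - t) ξ = freeSymbol s ξ * (starRingEnd ℂ) (freeSymbol t ξ) := by
    simp only [freeSymbol]
    rw [← Complex.exp_conj, ← Complex.exp_add, map_mul, Complex.conj_I, Complex.conj_ofReal]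
    congr 1
    push_cast
    ring
  have hb : ((besselSymbol ξ)⁻¹ : ℝ) = (√(besselSymbol ξ))⁻¹ * (√(besselSymbol ξ))⁻¹ := by
    rw [← mul_inv, Real.mul_self_sqrt (besselSymbol_pos ξ).le]
  rw [hfs, hb]
  push_cast
  ring

theorem norm_inner_dualVec_le {r r' : ℝ} (hr : 2 < r) (hrr' : r.HolderConjugate r') {σ : ℝ}
    (hs0 : 0 ≤ σ) (hs : σ ≤ 1 - 2 / r) :
    ∃ κ : ℝ, 0 ≤ κ ∧ ∀ (ψ φ : 𝓢(Plane, ℂ)), HasCompactSupport ψ → HasCompactSupport φ →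
      ∀ s t : ℝ, (s ≠ t ∨ σ = 0) →
      ‖inner ℂ (dualVec ψ s) (dualVec φ t)‖ ≤
        κ * |t - s| ^ (-σ) * (realNorm r' ψ * realNorm r' φ) := by
  obtain ⟨κ, hκ, H⟩ := norm_besselForm_le hr hrr' hs0 hs
  refine ⟨κ, hκ, fun ψ φ hψ hφ s t hst => ?_⟩
  obtain ⟨χ, hχ, -, hχn, hχF⟩ := exists_conj hφ
  rw [inner_dualVec_dualVec ψ φ χ hχF, abs_sub_comm, ← hχn, mul_comm (realNorm r' ψ)]
  exact H χ ψ hχ hψ (s - t) (hst.imp_left sub_ne_zero.2)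

theorem memLp_of_normH1_lt_top {f : Plane → ℂ} (hf : normH1 f < ⊤) : MemLp f 2 volume := by
  by_contra h
  simp [normH1, h] at hf

/-- The representation of `⟨f, e^{itΔ} ψ⟩` in terms of an element of `L²` whose norm is the `H¹`
norm of `f`. -/
theorem exists_H1_vector {f : Plane → ℂ} (hf : normH1 f < ⊤) :
    ∃ W : Lp ℂ 2 (volume : Measure Plane), ‖W‖ₑ = normH1 f ∧
      (∀ (ψ : 𝓢(Plane, ℂ)) (t : ℝ), ∫ x, f x * freeProp t ψ x = inner ℂ (dualVec ψ t) W) ∧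
      ∀ ψ : 𝓢(Plane, ℂ), ∫ x, f x * ψ x = inner ℂ (dualVec ψ 0) W := by
  have hf2 := memLp_of_normH1_lt_top hf
  set F : Lp ℂ 2 (volume : Measure Plane) := 𝓕 (hf2.toLp f) with hF
  set w : Plane → ℂ := fun ξ => √(1 + (2 * Real.pi * ‖ξ‖) ^ 2) • F ξ with hw
  have hnorm : normH1 f = eLpNorm w 2 volume := by rw [normH1, dif_pos hf2]
  have hwm : MemLp w 2 volume := by
    refine ⟨?_, hnorm ▸ hf⟩
    exact (Continuous.aestronglyMeasurable (f := fun ξ : Plane => √(1 + (2 * Real.pi * ‖ξ‖) ^ 2))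
      (by fun_prop)).smul (Lp.aestronglyMeasurable F)
  have key : ∀ (ψ : 𝓢(Plane, ℂ)) (t : ℝ),
      ∫ ξ, F ξ * (freeSymbol t ξ * 𝓕⁻ ψ ξ) = inner ℂ (dualVec ψ t) (hwm.toLp w) := by
    intro ψ t
    rw [L2.inner_def]
    refine integral_congr_ae ?_
    filter_upwards [(memLp_dualFun ψ t).coeFn_toLp, hwm.coeFn_toLp] with ξ h1 h2
    rw [dualVec, h1, h2, dualFun, RCLike.inner_apply, map_mul, Complex.conj_conj,
      Complex.conj_ofReal, hw]
    have hs : (√(besselSymbol ξ) : ℂ) ≠ 0 := by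
      exact_mod_cast (Real.sqrt_pos.2 (besselSymbol_pos ξ)).ne'
    simp only [Complex.real_smul]
    rw [show 1 + (2 * Real.pi * ‖ξ‖) ^ 2 = besselSymbol ξ from rfl, Complex.ofReal_inv]
    field_simp
  refine ⟨hwm.toLp w, ?_, fun ψ t => ?_, fun ψ => ?_⟩
  · rw [Lp.enorm_def, eLpNorm_congr_ae hwm.coeFn_toLp, hnorm]
  · rw [integral_mul_eq_integral_fourier_mul hf2, ← key]
    simp_rw [fourierInv_freeProp]
    rfl
  · rw [integral_mul_eq_integral_fourier_mul hf2, ← key]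
    simp [freeSymbol, hF]

/-- The Sobolev embedding `H¹ ⊂ L^r`. -/
theorem eLpNorm_le_normH1 {r r' : ℝ} (hr : 2 < r) (hrr' : r.HolderConjugate r') :
    ∃ C : ℝ, 0 ≤ C ∧ ∀ f : Plane → ℂ, normH1 f < ⊤ →
      eLpNorm f (ENNReal.ofReal r) volume ≤ ENNReal.ofReal C * normH1 f := by
  have hr0 : 0 < r := by linarith
  have hr'0 := hrr'.symm.pos
  obtain ⟨κ, hκ, H⟩ := norm_inner_dualVec_le hr hrr' (σ := 0) le_rfl
    (by rw [sub_nonneg, div_le_one hr0]; exact hr.le)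
  refine ⟨√κ, by positivity, fun f hf => ?_⟩
  obtain ⟨W, hW, -, hWf⟩ := exists_H1_vector hf
  refine eLpNorm_le_of_forall_testFunction hrr'
    ((memLp_of_normH1_lt_top hf).locallyIntegrable (by norm_num)) fun g hg hg' => ?_
  set G := hg'.toSchwartzMap hg with hG
  have hGg : (G : Plane → ℂ) = g := rfl
  have h1 := H G G hg' hg' 0 0 (Or.inr rfl)
  rw [inner_self_eq_norm_sq_to_K] at h1
  -- The case `σ = 0` at equal times: the dual embedding of `L^{r'}` into `H^{-1}`, with `|0|^0 =
  -- 1`.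
  have h2 : ‖dualVec G 0‖ ≤ √κ * realNorm r' G := by
    refine le_of_sq_le_sq ?_ (mul_nonneg (Real.sqrt_nonneg _) (realNorm_nonneg _ _))
    rw [mul_pow, Real.sq_sqrt hκ]
    simpa [sq] using h1
  rw [← hGg, hWf, ← ofReal_norm, ← ofReal_realNorm hr'0 (G.memLp _ volume), ← hW,
    ← ofReal_norm W, ← ENNReal.ofReal_mul (by positivity),
    ← ENNReal.ofReal_mul (by positivity)]
  refine ENNReal.ofReal_le_ofReal ((norm_inner_le_norm _ _).trans ?_)
  calc _ ≤ √κ * realNorm r' G * ‖W‖ := by gcongr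
    _ = _ := by ring

/-! ### The homogeneous estimate -/

/-- A countable family of test functions in the unit ball of `L^{r'}`, dense in the sense of `L²`
on the Fourier side. -/
theorem exists_dense_testFunctions (r' : ℝ) : ∃ φ : ℕ → 𝓢(Plane, ℂ),
    (∀ n, HasCompactSupport (φ n) ∧ realNorm r' (φ n) ≤ 1) ∧
    ∀ ψ : 𝓢(Plane, ℂ), HasCompactSupport ψ → realNorm r' ψ ≤ 1 → ∃ k : ℕ → ℕ,
      Tendsto (fun j => (𝓕⁻ (φ (k j))).toLp 2 volume) atTop (𝓝 ((𝓕⁻ ψ).toLp 2 volume)) := by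
  have : Fact ((2 : ℝ≥0∞) ≠ ⊤) := ⟨ENNReal.ofNat_ne_top⟩
  set S : Set 𝓢(Plane, ℂ) := {ψ | HasCompactSupport ψ ∧ realNorm r' ψ ≤ 1} with hS
  set R : Set (Lp ℂ 2 (volume : Measure Plane)) := (fun ψ => (𝓕⁻ ψ).toLp 2 volume) '' S with hR
  have hzero : (0 : 𝓢(Plane, ℂ)) ∈ S := by
    refine ⟨HasCompactSupport.zero, ?_⟩
    unfold realNorm
    rcases eq_or_ne r' 0 with rfl | h
    · simp
    · simp [Real.zero_rpow h, Real.zero_rpow (inv_ne_zero h)]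
  have : Nonempty R := ⟨⟨_, _, hzero, rfl⟩⟩
  choose φ hφ hφR using fun n => (TopologicalSpace.denseSeq R n).2
  refine ⟨φ, hφ, fun ψ hψ hψ1 => ?_⟩
  -- `L²` is a separable metric space, so the set of transforms of admissible test functions has a
  -- dense sequence of its own; density in `L^{r'}` is not needed.
  have hx : (⟨(𝓕⁻ ψ).toLp 2 volume, ψ, ⟨hψ, hψ1⟩, rfl⟩ : R) ∈
      closure (Set.range (TopologicalSpace.denseSeq R)) := TopologicalSpace.denseRange_denseSeq R _
  obtain ⟨x, hx, hlim⟩ := mem_closure_iff_seq_limit.1 hx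
  choose k hk using hx
  refine ⟨k, ?_⟩
  have := (continuous_subtype_val.tendsto _).comp hlim
  refine this.congr fun j => ?_
  rw [Function.comp_apply, ← hk, ← hφR]

theorem realNorm_smul {s : ℝ} (hs : 0 < s) {c : ℝ} (hc : 0 ≤ c) (ψ : 𝓢(Plane, ℂ)) :
    realNorm s (((c : ℂ) • ψ : 𝓢(Plane, ℂ))) = c * realNorm s ψ := by
  unfold realNorm
  simp only [smul_apply, norm_smul, Complex.norm_real, Real.norm_of_nonneg hc,
    Real.mul_rpow hc (norm_nonneg _)]
  rw [integral_const_mul, Real.mul_rpow (by positivity) (integral_nonneg fun _ => by positivity),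
    ← Real.rpow_mul hc, mul_one_div_cancel hs.ne', Real.rpow_one]

theorem eq_zero_of_realNorm_eq_zero {s : ℝ} (hs : 0 < s) {ψ : 𝓢(Plane, ℂ)}
    (h : realNorm s ψ = 0) : ψ = 0 := by
  have h1 := ofReal_realNorm hs (ψ.memLp (ENNReal.ofReal s) volume)
  rw [h, ENNReal.ofReal_zero, eq_comm, eLpNorm_eq_zero_iff
    ψ.continuous.aestronglyMeasurable (by simpa using hs)] at h1
  have h2 := Measure.eq_of_ae_eq h1 ψ.continuous continuous_zero
  ext x
  exact congrFun h2 x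

/-- The Strichartz estimate for the free evolution of data in `H¹`, in dual form. -/
theorem exists_free_evolution_bound {q r r' : ℝ} (hq : 2 < q) (hr : 2 < r)
    (hrr' : r.HolderConjugate r') (hqr : 2 / q ≤ 1 - 2 / r) :
    ∃ C : ℝ, 0 ≤ C ∧ ∀ f : Plane → ℂ, normH1 f < ⊤ → ∃ h : ℝ → ℝ≥0∞, Measurable h ∧
      (∫⁻ t, h t ^ q) ^ (1 / q) ≤ ENNReal.ofReal C * normH1 f ∧
      ∀ (t : ℝ) (ψ : 𝓢(Plane, ℂ)), HasCompactSupport ψ →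
        ‖∫ x, f x * freeProp t ψ x‖ₑ ≤ h t * eLpNorm ψ (ENNReal.ofReal r') volume := by
  have hr'0 := hrr'.symm.pos
  obtain ⟨κ, hκ, H⟩ := norm_inner_dualVec_le hr hrr' (σ := 2 / q) (by positivity) hqr
  obtain ⟨C, hC, HC⟩ :=
    lintegral_iSup_inner_rpow_le_of_inner_le (H := Lp ℂ 2 (volume : Measure Plane)) hq
  obtain ⟨φ, hφ, hdense⟩ := exists_dense_testFunctions r'
  refine ⟨C * √κ, by positivity, fun f hf => ?_⟩
  obtain ⟨W, hW, hWf, -⟩ := exists_H1_vector hf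
  -- `h t` is the norm of `e^{itΔ} f` as a functional on `L^{r'}`. A countable supremum keeps it
  -- measurable and within reach of the maximal `T T*` estimate.
  set h : ℝ → ℝ≥0∞ := fun t => ⨆ n, ‖inner ℂ (dualVec (φ n) t) W‖ₑ with hh
  refine ⟨h, ?_, ?_, ?_⟩
  · exact Measurable.iSup fun n =>
      (((continuous_dualVec (φ n)).inner continuous_const).measurable.enorm)
  · rw [← hW]
    refine HC κ (fun n => ‖(𝓕⁻ (φ n)).toLp 2 volume‖) (fun n => dualVec (φ n)) hκ
      (fun n => (continuous_dualVec (φ n)).stronglyMeasurable) (fun n t => norm_dualVec_le _ _)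
      (fun n m s t hst => ?_) W
    refine (H (φ n) (φ m) (hφ n).1 (hφ m).1 s t (Or.inl hst)).trans ?_
    exact mul_le_of_le_one_right (by positivity)
      (mul_le_one₀ (hφ n).2 (realNorm_nonneg _ _) (hφ m).2)
  -- The supremum over the sequence controls the whole unit ball by approximation; general `ψ`
  -- follow by scaling.
  · have hunit : ∀ (t : ℝ) (ψ : 𝓢(Plane, ℂ)), HasCompactSupport ψ → realNorm r' ψ ≤ 1 →
        ‖inner ℂ (dualVec ψ t) W‖ₑ ≤ h t := by
      intro t ψ hψ hψ1
      obtain ⟨k, hk⟩ := hdense ψ hψ hψ1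
      have h1 : Tendsto (fun j => dualVec (φ (k j)) t) atTop (𝓝 (dualVec ψ t)) := by
        rw [tendsto_iff_norm_sub_tendsto_zero] at hk ⊢
        exact squeeze_zero (fun _ => norm_nonneg _) (fun j => norm_dualVec_sub_le _ _ _) hk
      refine le_of_tendsto (h1.inner tendsto_const_nhds).enorm (Eventually.of_forall fun j => ?_)
      exact le_iSup (fun n => ‖inner ℂ (dualVec (φ n) t) W‖ₑ) (k j)
    intro t ψ hψ
    rw [← ofReal_realNorm hr'0 (ψ.memLp _ volume)]
    rcases (realNorm_nonneg r' ψ).eq_or_lt with h0 | h0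
    · rw [eq_zero_of_realNorm_eq_zero hr'0 h0.symm]
      simp
    set N := realNorm r' ψ with hN
    have h1 := hunit t (((N⁻¹ : ℝ) : ℂ) • ψ) (hψ.comp_left (g := fun z => ((N⁻¹ : ℝ) : ℂ) • z)
      (smul_zero _)) (by
        rw [realNorm_smul hr'0 (by positivity), ← hN, inv_mul_cancel₀ h0.ne'])
    have h2 : ∫ x, f x * freeProp t ψ x =
        (N : ℂ) * inner ℂ (dualVec (((N⁻¹ : ℝ) : ℂ) • ψ) t) W := by
      rw [← hWf, ← integral_const_mul]
      congr 1
      funext x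
      rw [map_smul, smul_apply, smul_eq_mul, Complex.ofReal_inv]
      have : (N : ℂ) ≠ 0 := by exact_mod_cast h0.ne'
      field_simp
    rw [h2, enorm_mul, mul_comm, ← ofReal_norm (N : ℂ), Complex.norm_real,
      Real.norm_of_nonneg h0.le]
    gcongr

/-! ### The nonlinear estimate -/

/-- Bernoulli's inequality for `(y/x)^{p+1}`. The extra factor `y` raises the exponent above one, so
`p < 1` needs no separate treatment. -/
theorem rpow_sub_rpow_mul_le {p x y : ℝ} (hp : 0 < p) (hy : 0 ≤ y) (hxy : y ≤ x) :
    (x ^ p - y ^ p) * y ≤ p * x ^ p * (x - y) := by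
  rcases hy.eq_or_lt with rfl | hy0
  · have : 0 ≤ x ^ p := Real.rpow_nonneg hxy p
    simp only [mul_zero, sub_zero]
    positivity
  have hx0 : 0 < x := hy0.trans_le hxy
  have h1 := one_add_mul_self_le_rpow_one_add (s := y / x - 1) (p := p + 1)
    (by linarith [div_nonneg hy hx0.le]) (by linarith)
  rw [add_sub_cancel, Real.div_rpow hy hx0.le, le_div_iff₀ (by positivity),
    Real.rpow_add_one hx0.ne', Real.rpow_add_one hy0.ne'] at h1
  have h2 : (1 + (p + 1) * (y / x - 1)) * (x ^ p * x) = x ^ p * (x + (p + 1) * (y - x)) := by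
    field_simp
  nlinarith [h1, h2]

/-- The power nonlinearity is locally Lipschitz. -/
theorem norm_rpow_mul_sub_le {p : ℝ} (hp : 0 < p) (z w : ℂ) :
    ‖((‖z‖ ^ p : ℝ) : ℂ) * z - ((‖w‖ ^ p : ℝ) : ℂ) * w‖ ≤
      (p + 1) * ((‖w‖ + ‖z - w‖) ^ p * ‖z - w‖) := by
  have hkey : ∀ z w : ℂ, ‖w‖ ≤ ‖z‖ → ‖((‖z‖ ^ p : ℝ) : ℂ) * z - ((‖w‖ ^ p : ℝ) : ℂ) * w‖ ≤
      (p + 1) * (‖z‖ ^ p * ‖z - w‖) := by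
    intro z w h
    have h1 : ((‖z‖ ^ p : ℝ) : ℂ) * z - ((‖w‖ ^ p : ℝ) : ℂ) * w =
        ((‖z‖ ^ p : ℝ) : ℂ) * (z - w) + ((‖z‖ ^ p - ‖w‖ ^ p : ℝ) : ℂ) * w := by
      push_cast; ring
    have h2 : 0 ≤ ‖z‖ ^ p - ‖w‖ ^ p :=
      sub_nonneg.2 (Real.rpow_le_rpow (norm_nonneg _) h hp.le)
    have h3 : 0 ≤ ‖z‖ ^ p := by positivity
    rw [h1]
    refine (norm_add_le _ _).trans ?_
    rw [norm_mul, norm_mul, Complex.norm_real, Complex.norm_real, Real.norm_of_nonneg h2,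
      Real.norm_of_nonneg h3]
    have h4 := rpow_sub_rpow_mul_le hp (norm_nonneg w) h
    have h5 := mul_le_mul_of_nonneg_left (norm_sub_norm_le z w) (mul_nonneg hp.le h3)
    linarith
  have hz : ‖z‖ ≤ ‖w‖ + ‖z - w‖ := norm_le_norm_add_norm_sub' z w
  rcases le_total ‖w‖ ‖z‖ with h | h
  · refine (hkey z w h).trans ?_
    gcongr
  · rw [norm_sub_rev]
    refine (hkey w z h).trans ?_
    rw [norm_sub_rev]
    gcongr
    linarith [norm_nonneg (z - w)]

/-- The pointwise Lipschitz bound, then Hölder twice: `L^{r/p} · L^r ⊂ L^{r/(p+1)}` for the power,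
and the weight in `L^ρ` from there to `L^β`. -/
theorem eLpNorm_weighted_power_sub_le {p r β : ℝ} {ρ : ℝ≥0∞} (hp : 0 < p) (hr : 1 ≤ r)
    (hρ : ρ.HolderTriple (ENNReal.ofReal (r / (p + 1))) (ENNReal.ofReal β)) {a : Plane → ℝ}
    {f g : Plane → ℂ} (ha : AEStronglyMeasurable a volume) (hf : AEStronglyMeasurable f volume)
    (hg : AEStronglyMeasurable g volume) :
    eLpNorm (fun x => (a x : ℂ) * ((‖f x‖ ^ p : ℝ) : ℂ) * f x -
        (a x : ℂ) * ((‖g x‖ ^ p : ℝ) : ℂ) * g x) (ENNReal.ofReal β) volume ≤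
      ENNReal.ofReal (p + 1) * eLpNorm a ρ volume *
        ((eLpNorm g (ENNReal.ofReal r) volume +
          eLpNorm (fun x => f x - g x) (ENNReal.ofReal r) volume) ^ p *
          eLpNorm (fun x => f x - g x) (ENNReal.ofReal r) volume) := by
  have hr0 : 0 < r := by linarith
  set w : Plane → ℂ := fun x => f x - g x with hw
  have hwm : AEStronglyMeasurable w volume := hf.sub hg
  set k : Plane → ℝ := fun x => ‖g x‖ + ‖w x‖ with hk
  have hkm : AEStronglyMeasurable k volume := hg.norm.add hwm.norm
  have hk0 : ∀ x, 0 ≤ k x := fun x => by positivity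
  have hkn : eLpNorm k (ENNReal.ofReal r) volume ≤
      eLpNorm g (ENNReal.ofReal r) volume + eLpNorm w (ENNReal.ofReal r) volume := by
    rw [← eLpNorm_norm g, ← eLpNorm_norm w]
    exact eLpNorm_add_le hg.norm hwm.norm (by simpa using hr)
  set d : Plane → ℂ := (fun x => k x ^ p) • w with hd
  have hkpm : AEStronglyMeasurable (fun x => k x ^ p) volume :=
    (Real.continuous_rpow_const hp.le).comp_aestronglyMeasurable hkm
  have hT : (ENNReal.ofReal (r / p)).HolderTriple (ENNReal.ofReal r)
      (ENNReal.ofReal (r / (p + 1))) := by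
    constructor
    rw [← ENNReal.ofReal_inv_of_pos (by positivity), ← ENNReal.ofReal_inv_of_pos (by positivity),
      ← ENNReal.ofReal_inv_of_pos (by positivity), ← ENNReal.ofReal_add (by positivity)
        (by positivity)]
    congr 1
    field_simp
  have h1 : eLpNorm d (ENNReal.ofReal (r / (p + 1))) volume ≤
      (eLpNorm g (ENNReal.ofReal r) volume + eLpNorm w (ENNReal.ofReal r) volume) ^ p *
        eLpNorm w (ENNReal.ofReal r) volume := by
    refine (eLpNorm_smul_le_mul_eLpNorm hwm hkpm (hpqr := hT)).trans ?_
    gcongr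
    have h2 : (fun x => k x ^ p) = fun x => ‖k x‖ ^ p := by
      funext x; rw [Real.norm_of_nonneg (hk0 x)]
    rw [h2, eLpNorm_norm_rpow k hp, ← ENNReal.ofReal_mul (by positivity), div_mul_cancel₀ _ hp.ne']
    exact ENNReal.rpow_le_rpow hkn hp.le
  have h3 := eLpNorm_smul_le_mul_eLpNorm (hkpm.smul hwm) ha (hpqr := hρ)
  have hp1 : 0 ≤ p + 1 := by linarith
  have h4 := eLpNorm_le_nnreal_smul_eLpNorm_of_ae_le_mul (μ := (volume : Measure Plane))
    (f := fun x => (a x : ℂ) * ((‖f x‖ ^ p : ℝ) : ℂ) * f x -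
        (a x : ℂ) * ((‖g x‖ ^ p : ℝ) : ℂ) * g x) (g := a • d) (c := Real.toNNReal (p + 1))
    (Eventually.of_forall fun x => by
      rw [← NNReal.coe_le_coe, NNReal.coe_mul, coe_nnnorm, coe_nnnorm, Real.coe_toNNReal _ hp1,
        mul_assoc, mul_assoc, ← mul_sub, norm_mul, Complex.norm_real, Pi.smul_apply', norm_smul,
        hd, Pi.smul_apply', norm_smul, Real.norm_of_nonneg (Real.rpow_nonneg (hk0 x) p),
        mul_left_comm]
      exact mul_le_mul_of_nonneg_left (norm_rpow_mul_sub_le hp (f x) (g x)) (norm_nonneg _))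
    (ENNReal.ofReal β)
  refine h4.trans ?_
  rw [ENNReal.smul_def, smul_eq_mul, mul_assoc]
  refine mul_le_mul_right (h3.trans ?_) _
  gcongr

/-! ### Exponents -/

section Exponents

variable {p : ℝ}

theorem two_lt_rExp (hp : 0 < p) : 2 < rExp p := by
  unfold rExp
  split_ifs with h
  · linarith
  · rw [lt_div_iff₀ hp]; linarith

theorem four_lt_qExp (hp : 0 < p) : 4 < qExp p := by
  unfold qExp
  split_ifs with h
  · nlinarith
  · linarith

theorem holderConjugate_rExp (hp : 0 < p) : (rExp p).HolderConjugate (betaExp p) := by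
  rw [Real.holderConjugate_iff]
  refine ⟨by linarith [two_lt_rExp hp], ?_⟩
  unfold rExp betaExp
  split_ifs with h
  · field_simp; ring
  · field_simp; ring

theorem alphaExp_eq (p : ℝ) : alphaExp p = qExp p / (p + 1) := by
  unfold alphaExp qExp
  split_ifs with h
  · rw [div_div]; congr 1; ring
  · rfl

/-- The scaling relation between `q` and `r`. It makes the Hardy-Littlewood-Sobolev condition an
identity and turns the condition `2/q ≤ 1 - 2/r` for the free evolution into `p + 2 ≤ q`. -/
theorem div_qExp (hp : 0 < p) : p / qExp p = 2 / rExp p := by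
  unfold rExp qExp
  split_ifs with h
  · field_simp
  · field_simp; ring

theorem one_lt_alphaExp (hp : 0 < p) : 1 < qExp p / (p + 1) := by
  rw [lt_div_iff₀ (by linarith)]
  unfold qExp
  split_ifs with h
  · nlinarith
  · linarith

theorem two_div_qExp_le (hp : 0 < p) : 2 / qExp p ≤ 1 - 2 / rExp p := by
  rw [← div_qExp hp, le_sub_iff_add_le, ← add_div, div_le_one (by linarith [four_lt_qExp hp])]
  unfold qExp
  split_ifs with h
  · nlinarith
  · linarith

theorem inv_alphaExp_add (hp : 0 < p) :
    1 / (qExp p / (p + 1)) + (1 - 2 / rExp p) = 1 + 1 / qExp p := by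
  have := four_lt_qExp hp
  rw [← div_qExp hp]
  field_simp
  ring

/-- For `p > 2` one has `β = r/(p+1)` and a bounded weight suffices; for `p ≤ 2` the exponent `ρ` is
what closes the gap between `r/(p+1)` and `β`. -/
theorem holderTriple_rhoExp (hp : 0 < p) : (rhoExp p).HolderTriple
    (ENNReal.ofReal (rExp p / (p + 1))) (ENNReal.ofReal (betaExp p)) := by
  constructor
  unfold rhoExp rExp betaExp
  split_ifs with h
  · simp
  · have h4 : 0 < 4 - p := by linarith
    rw [← ENNReal.ofReal_inv_of_pos (by positivity), ← ENNReal.ofReal_inv_of_pos (by positivity),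
      ← ENNReal.ofReal_inv_of_pos (by positivity), ← ENNReal.ofReal_add (by positivity)
        (by positivity)]
    congr 1
    field_simp
    ring

end Exponents

/-! ### Space-time norms -/

theorem mixedNorm_eq_lnorm {q : ℝ} (hq : 0 < q) (k : ℝ) (I : Set ℝ) (v : ℝ → Plane → ℂ) :
    mixedNorm q k I v = lnorm q I fun t => eLpNorm (v t) (ENNReal.ofReal k) volume := by
  rw [mixedNorm, lnorm, eLpNorm_eq_lintegral_rpow_enorm_toReal (by simpa using hq)
    ENNReal.ofReal_ne_top, ENNReal.toReal_ofReal hq.le]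
  simp only [enorm_eq_self]

theorem aemeasurable_eLpNorm_slice {k : ℝ} (hk : 0 < k) {μ : Measure ℝ} {v : ℝ → Plane → ℂ}
    (hv : AEStronglyMeasurable (fun z : ℝ × Plane => v z.1 z.2) (μ.prod volume)) :
    AEMeasurable (fun t => eLpNorm (v t) (ENNReal.ofReal k) volume) μ := by
  simp_rw [eLpNorm_eq_lintegral_rpow_enorm_toReal (p := ENNReal.ofReal k) (by simpa using hk)
    ENNReal.ofReal_ne_top]
  exact (AEMeasurable.lintegral_prod_right' (f := fun z : ℝ × Plane => ‖v z.1 z.2‖ₑ ^ _)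
    (hv.enorm.pow_const _)).pow_const _

theorem aestronglyMeasurable_nonlin {p : ℝ} (hp : 0 < p) {a : Plane → ℝ} (ha : Continuous a)
    {μ : Measure ℝ} {v : ℝ → Plane → ℂ}
    (hv : AEStronglyMeasurable (fun z : ℝ × Plane => v z.1 z.2) (μ.prod volume)) :
    AEStronglyMeasurable (fun z : ℝ × Plane => nonlin p a v z.1 z.2) (μ.prod volume) := by
  unfold nonlin
  refine (AEStronglyMeasurable.mul ?_ ?_).mul hv
  · exact (Complex.continuous_ofReal.comp (ha.comp continuous_snd)).aestronglyMeasurable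
  · exact (Complex.continuous_ofReal.comp
      (Real.continuous_rpow_const hp.le)).comp_aestronglyMeasurable hv.norm

/-! ### Duhamel solutions -/

/-- A Schwartz function equal to one on a ball shows integrability there; the duality criterion for
`L^r` asks for no more. -/
theorem locallyIntegrable_of_integrable_mul_schwartz {w : Plane → ℂ}
    (h : ∀ ψ : 𝓢(Plane, ℂ), Integrable fun x => w x * ψ x) : LocallyIntegrable w := by
  intro x
  let b : ContDiffBump x := ⟨1, 2, one_pos, one_lt_two⟩
  have hb : ContDiff ℝ ∞ fun y => ((b y : ℝ) : ℂ) := Complex.ofRealCLM.contDiff.comp b.contDiff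
  have hb' : HasCompactSupport fun y => ((b y : ℝ) : ℂ) :=
    b.hasCompactSupport.comp_left (g := Complex.ofReal) Complex.ofReal_zero
  refine ⟨Metric.closedBall x 1, Metric.closedBall_mem_nhds x one_pos, ?_⟩
  refine (h (hb'.toSchwartzMap hb)).integrableOn.congr_fun (fun y hy => ?_)
    Metric.isClosed_closedBall.measurableSet
  simp only [HasCompactSupport.toSchwartzMap_toFun]
  rw [b.one_of_mem_closedBall hy, Complex.ofReal_one, mul_one]

theorem IsDuhamelSolution.mono {I J : Set ℝ} (hIJ : I ⊆ J) {t₀ : ℝ} {v G : ℝ → Plane → ℂ}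
    (h : IsDuhamelSolution J t₀ v G) : IsDuhamelSolution I t₀ v G :=
  ae_restrict_of_ae_restrict_of_subset hIJ h

theorem intervalIntegrable_duhamel {t₀ t : ℝ} {G : ℝ → Plane → ℂ} {φ : ℝ → Plane → ℂ}
    (h : IntegrableOn (fun z : ℝ × Plane => G z.1 z.2 * φ z.1 z.2)
      (Set.uIoc t₀ t ×ˢ Set.univ)) :
    IntervalIntegrable (fun s => ∫ x, G s x * φ s x) volume t₀ t ∧
      ∀ᵐ s ∂volume.restrict (Set.uIoc t₀ t), Integrable fun x => G s x * φ s x := by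
  rw [IntegrableOn, Measure.volume_eq_prod, ← Measure.prod_restrict, Measure.restrict_univ] at h
  exact ⟨intervalIntegrable_iff.2 h.integral_prod_left, h.prod_right_ae⟩

/-- Absolute convergence over space-time gives integrable slices for almost every `s`, so the inner
integrals may be subtracted. -/
theorem IsDuhamelSolution.sub {I : Set ℝ} {t₀ : ℝ} {u v G K : ℝ → Plane → ℂ}
    (hu : IsDuhamelSolution I t₀ u G) (hv : IsDuhamelSolution I t₀ v K) :
    IsDuhamelSolution I t₀ (fun t x => u t x - v t x) (fun t x => G t x - K t x) := by
  filter_upwards [hu, hv] with t hut hvt ψ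
  obtain ⟨hu1, hu2, hu3, hu4⟩ := hut ψ
  obtain ⟨hv1, hv2, hv3, hv4⟩ := hvt ψ
  simp only [sub_mul]
  refine ⟨hu1.sub hv1, hu2.sub hv2, hu3.sub hv3, ?_⟩
  obtain ⟨hu5, hu6⟩ := intervalIntegrable_duhamel (φ := fun s x => freeProp (t - s) ψ x) hu3
  obtain ⟨hv5, hv6⟩ := intervalIntegrable_duhamel (φ := fun s x => freeProp (t - s) ψ x) hv3
  have h7 : ∫ s in t₀..t, ∫ x, (G s x * freeProp (t - s) ψ x - K s x * freeProp (t - s) ψ x) =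
      ∫ s in t₀..t, ((∫ x, G s x * freeProp (t - s) ψ x) -
        ∫ x, K s x * freeProp (t - s) ψ x) := by
    refine intervalIntegral.integral_congr_ae_restrict ?_
    filter_upwards [hu6, hv6] with s h1 h2 using integral_sub h1 h2
  rw [h7, intervalIntegral.integral_sub hu5 hv5, integral_sub hu1 hv1, integral_sub hu2 hv2, hu4,
    hv4]
  ring

theorem enorm_integral_mul_le {r r' : ℝ} (hrr' : r.HolderConjugate r') {f g : Plane → ℂ}
    (hf : AEStronglyMeasurable f volume) (hg : AEStronglyMeasurable g volume) :
    ‖∫ x, f x * g x‖ₑ ≤ eLpNorm f (ENNReal.ofReal r') volume *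
      eLpNorm g (ENNReal.ofReal r) volume := by
  have hT : (ENNReal.ofReal r').HolderTriple (ENNReal.ofReal r) 1 := by
    constructor
    rw [← ENNReal.ofReal_inv_of_pos hrr'.symm.pos, ← ENNReal.ofReal_inv_of_pos hrr'.pos,
      ← ENNReal.ofReal_add (inv_nonneg.2 hrr'.symm.nonneg) (inv_nonneg.2 hrr'.nonneg),
      hrr'.symm.inv_add_inv_eq_one]
    simp
  refine (enorm_integral_le_lintegral_enorm _).trans ?_
  exact (eLpNorm_one_eq_lintegral_enorm (f := f • g)).symm.trans_le
    (eLpNorm_smul_le_mul_eLpNorm hg hf (hpqr := hT))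

/-- The integral inequality for the spatial norms of a Duhamel solution. -/
theorem IsDuhamelSolution.eLpNorm_le {r r' : ℝ} (hr : 2 < r) (hrr' : r.HolderConjugate r')
    {I : Set ℝ} (hI : I.OrdConnected) {t₀ : ℝ} (ht₀ : t₀ ∈ I) {w G : ℝ → Plane → ℂ}
    (hw : IsDuhamelSolution I t₀ w G)
    (hG : ∀ᵐ s ∂volume.restrict I, AEStronglyMeasurable (G s) volume) {h : ℝ → ℝ≥0∞}
    (hh : ∀ (t : ℝ) (ψ : 𝓢(Plane, ℂ)), HasCompactSupport ψ →
      ‖∫ x, w t₀ x * freeProp t ψ x‖ₑ ≤ h t * eLpNorm ψ (ENNReal.ofReal r') volume) :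
    ∀ᵐ t ∂volume.restrict I, eLpNorm (w t) (ENNReal.ofReal r) volume ≤
      h (t - t₀) + ∫⁻ s in Set.uIoc t₀ t,
        eLpNorm (G s) (ENNReal.ofReal r') volume * rieszKer (1 - 2 / r) (t - s) := by
  filter_upwards [hw, ae_restrict_mem hI.measurableSet] with t ht htI
  refine eLpNorm_le_of_forall_testFunction hrr'
    (locallyIntegrable_of_integrable_mul_schwartz fun ψ => (ht ψ).1) fun g hg hg' => ?_
  set ψ := hg'.toSchwartzMap hg with hψ
  have hψg : (ψ : Plane → ℂ) = g := rfl
  have hN : eLpNorm ψ (ENNReal.ofReal r') volume ≠ ⊤ := (ψ.memLp _ volume).eLpNorm_ne_top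
  rw [← hψg, (ht ψ).2.2.2]
  refine enorm_sub_le.trans ?_
  rw [add_mul]
  refine add_le_add (hh _ ψ hg') ?_
  rw [enorm_mul, ← ofReal_norm Complex.I, Complex.norm_I, ENNReal.ofReal_one, one_mul,
    ← lintegral_mul_const' _ _ hN, ← ofReal_norm, intervalIntegral.norm_intervalIntegral_eq,
    ofReal_norm]
  refine (enorm_integral_le_lintegral_enorm _).trans (lintegral_mono_ae ?_)
  have hsub : Set.uIoc t₀ t ⊆ I := Set.uIoc_subset_uIcc.trans (hI.uIcc_subset ht₀ htI)
  -- The time `s = t` is discarded: the dispersive estimate fails there, since the real-power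
  -- convention gives the kernel the value `0`.
  filter_upwards [ae_restrict_of_ae_restrict_of_subset hsub hG,
    ae_restrict_of_ae (Measure.ae_ne volume t)] with s hs hst
  refine (enorm_integral_mul_le hrr' hs (freeProp (t - s) ψ).continuous.aestronglyMeasurable).trans
    ?_
  rw [mul_assoc]
  gcongr
  exact eLpNorm_freeProp_le hr hrr' hg' (sub_ne_zero.2 hst.symm)

/-! ### Local boundedness of the spatial norms -/

/-- Near each time `u` moves by less than one in `H¹`, hence by a bounded amount in `L^r` by the
Sobolev embedding; compactness does the rest. It provides the finiteness without which nothing could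
be absorbed. -/
theorem exists_eLpNorm_le_on_compact {r r' : ℝ} (hr : 2 < r) (hrr' : r.HolderConjugate r')
    {u : ℝ → Plane → ℂ} (hu : ∀ t, normH1 (u t) < ⊤)
    (hc : ∀ t, Tendsto (fun s => normH1 (fun x => u s x - u t x)) (𝓝 t) (𝓝 0))
    {K : Set ℝ} (hK : IsCompact K) :
    ∃ M : NNReal, ∀ s ∈ K, eLpNorm (u s) (ENNReal.ofReal r) volume ≤ M := by
  obtain ⟨C, hC, H⟩ := eLpNorm_le_normH1 hr hrr'
  refine hK.induction_on (p := fun S => ∃ M : NNReal, ∀ s ∈ S,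
    eLpNorm (u s) (ENNReal.ofReal r) volume ≤ M) ⟨0, by simp⟩ ?_ ?_ ?_
  · rintro S T hST ⟨M, hM⟩
    exact ⟨M, fun s hs => hM s (hST hs)⟩
  · rintro S T ⟨M, hM⟩ ⟨N, hN⟩
    refine ⟨max M N, fun s hs => hs.elim (fun h => (hM s h).trans ?_) fun h => (hN s h).trans ?_⟩
    · exact_mod_cast le_max_left M N
    · exact_mod_cast le_max_right M N
  · intro t _
    have hev : ∀ᶠ s in 𝓝 t, normH1 (fun x => u s x - u t x) < 1 :=
      (hc t).eventually_lt_const zero_lt_one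
    refine ⟨_, mem_nhdsWithin_of_mem_nhds hev, ?_⟩
    have hne : ENNReal.ofReal C * 1 + ENNReal.ofReal C * normH1 (u t) ≠ ⊤ := by
      rw [mul_one]
      exact ENNReal.add_ne_top.2 ⟨ENNReal.ofReal_ne_top,
        ENNReal.mul_ne_top ENNReal.ofReal_ne_top (hu t).ne⟩
    refine ⟨(ENNReal.ofReal C * 1 + ENNReal.ofReal C * normH1 (u t)).toNNReal, fun s hs => ?_⟩
    rw [ENNReal.coe_toNNReal hne]
    have hs1 : normH1 (fun x => u s x - u t x) < 1 := hs
    have hms := (memLp_of_normH1_lt_top (hu s)).aestronglyMeasurable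
    have hmt := (memLp_of_normH1_lt_top (hu t)).aestronglyMeasurable
    calc eLpNorm (u s) (ENNReal.ofReal r) volume
        = eLpNorm ((fun x => u s x - u t x) + u t) (ENNReal.ofReal r) volume := by
          congr 1
          funext x
          simp
      _ ≤ eLpNorm (fun x => u s x - u t x) (ENNReal.ofReal r) volume +
          eLpNorm (u t) (ENNReal.ofReal r) volume :=
          eLpNorm_add_le (hms.sub hmt) hmt (by
            rw [ENNReal.one_le_ofReal]; linarith)
      _ ≤ _ := by
          refine add_le_add ((H _ (hs1.trans ENNReal.one_lt_top)).trans ?_) (H _ (hu t))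
          gcongr

theorem lnorm_ne_top_of_le {q : ℝ} (hq : 0 < q) {S : Set ℝ} (hS : volume S ≠ ⊤)
    {f : ℝ → ℝ≥0∞} {M : NNReal} (hf : ∀ᵐ t ∂volume.restrict S, f t ≤ M) :
    lnorm q S f ≠ ⊤ := by
  refine ne_top_of_le_ne_top ?_ (lnorm_mono_ae hq hf)
  rw [lnorm, lintegral_const, Measure.restrict_apply_univ]
  exact ENNReal.rpow_ne_top_of_nonneg (by positivity)
    (ENNReal.mul_ne_top (ENNReal.rpow_ne_top_of_nonneg hq.le ENNReal.coe_ne_top) hS)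

end

end StabilityNLS

/-! ### The stability theorem: reduction to the scalar inequalities -/

open StabilityNLS in
theorem mainTheorem7 (p : ℝ) (hp : 0 < p) (A L : ℝ) (hA : 0 ≤ A) (hL : 0 < L) :
    ∃ ε₁ > (0 : ℝ), ∃ C > (0 : ℝ),
      ∀ a : Plane → ℝ, Admissible p a →
        eLpNorm a (rhoExp p) volume ≤ ENNReal.ofReal A →
      ∀ (I : Set ℝ) (t₀ : ℝ), I.OrdConnected → t₀ ∈ I →
      ∀ u₀ : Plane → ℂ, normH1 u₀ < ⊤ →
      ∀ v e : ℝ → Plane → ℂ, IsApproxSolution p a I t₀ v e →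
        normX p I v ≤ ENNReal.ofReal L →
      ∀ ε : ℝ, ε ≤ ε₁ →
        normH1 (fun x => u₀ x - v t₀ x) + normY p I e < ENNReal.ofReal ε →
      ∀ u : ℝ → Plane → ℂ, IsGlobalSolution p a t₀ u₀ u →
        normX p I (fun t x => u t x - v t x) +
            normY p I (fun t x => nonlin p a u t x - nonlin p a v t x) ≤
          ENNReal.ofReal (C * ε) := by
  have hr := two_lt_rExp hp
  have hq := four_lt_qExp hp
  have hrβ := holderConjugate_rExp hp
  have hα := one_lt_alphaExp hp
  set q := qExp p with hqdef
  set r := rExp p with hrdef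
  set β := betaExp p with hβdef
  have hr0 : 0 < r := by linarith
  have hq0 : 0 < q := by linarith
  have hβ1 : 1 ≤ ENNReal.ofReal β := ENNReal.one_le_ofReal.2 hrβ.symm.lt.le
  have hr1 : 1 ≤ ENNReal.ofReal r := ENNReal.one_le_ofReal.2 hrβ.lt.le
  have hγ0 : 0 < 1 - 2 / r := by rw [sub_pos, div_lt_one hr0]; exact hr
  have hγ1 : 1 - 2 / r < 1 := by linarith [div_pos two_pos hr0]
  obtain ⟨B, hB, hfree⟩ := exists_free_evolution_bound (by linarith) hr hrβ (two_div_qExp_le hp)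
  -- The dispersive estimate has constant one, hence `κ = 1`; the factor `p + 1` is the Lipschitz
  -- constant of the power.
  obtain ⟨ε₁, hε₁, C, hC, hstab⟩ := scalar_stability (κ := 1) (A := (p + 1) * A) hp (by linarith)
    hα hγ0 hγ1 (inv_alphaExp_add hp) (by positivity) zero_le_one hL.le hB
  refine ⟨ε₁, hε₁, C, hC, fun a ha haA I t₀ hI ht₀ u₀ hu₀ v e hv hvL ε hε hsmall u hu => ?_⟩
  -- The strict smallness hypothesis itself forces `ε` to be positive.
  have hε0 : 0 < ε := ENNReal.ofReal_pos.1 (pos_of_gt hsmall)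
  have hdata : normH1 (fun x => u₀ x - v t₀ x) < ENNReal.ofReal ε := lt_of_le_of_lt le_self_add hsmall
  have herr : normY p I e ≤ ENNReal.ofReal ε := (le_add_self.trans_lt hsmall).le
  rw [normX, mixedNorm_eq_lnorm hq0] at hvL ⊢
  rw [normY, alphaExp_eq, mixedNorm_eq_lnorm (by linarith)] at herr ⊢
  obtain ⟨h, hhm, hhq, hh⟩ := hfree _ (hdata.trans ENNReal.ofReal_lt_top)
  have hum : AEStronglyMeasurable (fun z : ℝ × Plane => u z.1 z.2)
      ((volume.restrict I).prod volume) :=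
    hu.measurable.mono_ac (Measure.AbsolutelyContinuous.prod
      Measure.absolutelyContinuous_restrict Measure.AbsolutelyContinuous.rfl)
  have hFm := (aestronglyMeasurable_nonlin hp ha.continuous hum).sub
    (aestronglyMeasurable_nonlin hp ha.continuous hv.measurable)
  have hnm := aemeasurable_eLpNorm_slice hr0 hv.measurable
  refine hstab ε I t₀ _ (fun t => eLpNorm (v t) (ENNReal.ofReal r) volume) _
    (fun t => eLpNorm (e t) (ENNReal.ofReal β) volume) (fun t => h (t - t₀)) hε0 hε
    { ordConnected := hI
      mem := ht₀
      measurable_m := aemeasurable_eLpNorm_slice hr0 (hum.sub hv.measurable)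
      measurable_n := hnm
      measurable_g := aemeasurable_eLpNorm_slice hrβ.symm.pos hFm
      measurable_e := aemeasurable_eLpNorm_slice hrβ.symm.pos hv.measurable_error
      measurable_h := (hhm.comp (measurable_id.sub_const t₀)).aemeasurable
      duhamel := ?_
      nonlinear := ?_
      norm_n := hvL
      finite := fun τ => ?_
      norm_h := ?_
      norm_e := herr }
  · have hD := (hu.duhamel.mono (Set.subset_univ I)).sub hv.duhamel
    have hslice := hFm.prodMk_left
    have heslice := hv.measurable_error.prodMk_left
    have hG : ∀ᵐ s ∂volume.restrict I, AEStronglyMeasurable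
        (fun x => nonlin p a u s x - (nonlin p a v s x + e s x)) volume := by
      filter_upwards [hslice, heslice] with s h1 h2
      simp only [← sub_sub]
      exact h1.sub h2
    have hinit : ∀ (t : ℝ) (ψ : 𝓢(Plane, ℂ)), HasCompactSupport ψ →
        ‖∫ x, (u t₀ x - v t₀ x) * freeProp t ψ x‖ₑ ≤
          h t * eLpNorm ψ (ENNReal.ofReal β) volume := by
      intro t ψ hψ
      refine le_of_eq_of_le (congrArg _ (integral_congr_ae ?_)) (hh t ψ hψ)
      filter_upwards [hu.initial] with x hx
      rw [hx]
    filter_upwards [hD.eLpNorm_le hr hrβ hI ht₀ hG hinit, ae_restrict_mem hI.measurableSet]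
      with t ht htI
    refine ht.trans ?_
    rw [ENNReal.ofReal_one, one_mul]
    gcongr _ + ?_
    have hsub : Set.uIoc t₀ t ⊆ I := Set.uIoc_subset_uIcc.trans (hI.uIcc_subset ht₀ htI)
    refine lintegral_mono_ae ?_
    filter_upwards [ae_restrict_of_ae_restrict_of_subset hsub hslice,
      ae_restrict_of_ae_restrict_of_subset hsub heslice] with s h1 h2
    gcongr
    simp only [← sub_sub]
    exact eLpNorm_sub_le h1 h2 hβ1
  · filter_upwards [hum.prodMk_left, hv.measurable.prodMk_left] with t h1 h2
    refine (eLpNorm_weighted_power_sub_le hp hrβ.lt.le (holderTriple_rhoExp hp)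
      ha.continuous.aestronglyMeasurable h1 h2).trans ?_
    rw [ENNReal.ofReal_mul (by linarith)]
    gcongr
  -- Local finiteness of `m`: `u` is bounded in `L^r` on the compact window and `v` has finite `X`
  -- norm.
  · set S := I ∩ Set.Icc (t₀ - τ) (t₀ + τ) with hS
    have hSI : S ⊆ I := Set.inter_subset_left
    obtain ⟨M, hM⟩ := exists_eLpNorm_le_on_compact hr hrβ hu.mem_H1 hu.continuous_H1
      (isCompact_Icc (a := t₀ - τ) (b := t₀ + τ))
    have hSm : MeasurableSet S := hI.measurableSet.inter measurableSet_Icc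
    have h1 : lnorm q S (fun t => eLpNorm (u t) (ENNReal.ofReal r) volume) ≠ ⊤ := by
      refine lnorm_ne_top_of_le hq0 (M := M) ?_ ?_
      · exact ne_top_of_le_ne_top (by simp) (measure_mono (μ := volume)
          (Set.inter_subset_right (s := I) (t := Set.Icc (t₀ - τ) (t₀ + τ))))
      · filter_upwards [ae_restrict_mem hSm] with t ht using hM t ht.2
    have h2 : lnorm q S (fun t => eLpNorm (v t) (ENNReal.ofReal r) volume) ≠ ⊤ :=
      ne_top_of_le_ne_top ENNReal.ofReal_ne_top ((lnorm_mono_set hq0 hSI _).trans hvL)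
    refine ne_top_of_le_ne_top (ENNReal.add_ne_top.2 ⟨h1, h2⟩) (le_trans (lnorm_mono_ae hq0 ?_)
      (lnorm_add_le (by linarith) ((aemeasurable_eLpNorm_slice hr0 hum).mono_set hSI)
        (hnm.mono_set hSI)))
    filter_upwards [ae_restrict_of_ae_restrict_of_subset hSI hum.prodMk_left,
      ae_restrict_of_ae_restrict_of_subset hSI hv.measurable.prodMk_left] with t h1 h2
    exact eLpNorm_sub_le h1 h2 hr1
  · calc lnorm q I (fun t => h (t - t₀)) ≤ lnorm q Set.univ (fun t => h (t - t₀)) :=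
          lnorm_mono_set hq0 (Set.subset_univ I) _
      _ = (∫⁻ t, h t ^ q) ^ (1 / q) := by
          rw [lnorm, Measure.restrict_univ, lintegral_sub_right_eq_self (fun t => h t ^ q) t₀]
      _ ≤ ENNReal.ofReal B * ENNReal.ofReal ε := hhq.trans (by gcongr)
      _ = ENNReal.ofReal (B * ε) := (ENNReal.ofReal_mul hB).symm
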